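/- Let $\mathcal P_k=\mathbb F_2[x_1,\dots,x_k]$ with $\deg x_i=1$ and the usual action of the Steenrod squares ($Sq^0x_i=x_i$, $Sq^1x_i=x_i^2$, $Sq^jx_i=0$ for $j>1$, Cartan formula). Let $G_k=GL_k(\mathbb F_2)$ act by linear substitutions, let $\mathcal A^+\mathcal P_k=\sum_{i\ge1}Sq^i\mathcal P_k$, and put $(Q\mathcal P_k)_d=(\mathcal P_k)_d/(\mathcal A^+\mathcal P_k\cap(\mathcal P_k)_d)$. Let $H_d=H_d(B(\mathbb Z/2)^k;\mathbb F_2)=((\mathcal P_k)_d)^*$, with the basis of divided power monomials $a^{(I)}=a_1^{(i_1)}\cdots a_k^{(i_k)}$ dual to the monomials $x^I$ and with the contragredient $G_k$-action, and let $P_{\mathcal A}H_d$ be the subspace of elements annihilated by all dual squares $Sq^i_*$, $i\ge1$, where $$a^{(I)}Sq^j_*=\sum_{q_1+\dots+q_k=j,\ q_t\le i_t}\ \prod_t\binom{i_t-q_t}{q_t}\,a^{(I-q)} .$$ Let $\Lambda$ be the Lambda algebra over $\mathbb F_2$: generators $\lambda_n$ ($n\ge0$), relations $\lambda_m\lambda_l=\sum_t\binom{t-l-1}{2t-m}\lambda_{m+l-t}\lambda_t$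 for $m>2l$ (sum over $t$ with $t\ge l+1$ and $2t\ge m$), and differential $\delta$, the derivation with $\delta(\lambda_n)=\sum_{j\ge1}\binom{n-j}{j}\lambda_{j-1}\lambda_{n-j}$. Let $\varphi_k:\Gamma[a_1,\dots,a_k]\to\Lambda$ be the chain-level Singer transfer, $\varphi_0(1)=1$, $$\varphi_k\big(a_k^{(t_k)}\cdots a_1^{(t_1)}\big)=\sum_{i\ge t_1}\lambda_i\,\varphi_{k-1}\big((a_k^{(t_k)}\cdots a_2^{(t_2)})Sq_*^{i-t_1}\big),$$ where on the right $a_k,\dots,a_2$ are renamed $a_{k-1},\dots,a_1$. Let \begin{align*} f={}&x_1x_2x_3x_4^{30}+x_1x_2x_3^3x_4^{28}+x_1x_2^3x_3x_4^{28}+x_1x_2^3x_3^4x_4^{25}+x_1x_2^7x_3^{11}x_4^{14}+x_1x_2^7x_3^{14}x_4^{11}\\ &+x_1^3x_2x_3x_4^{28}+x_1^3x_2x_3^4x_4^{25}+x_1^3x_2^5x_3x_4^{24}+x_1^3x_2^5x_3^{11}x_4^{14}+x_1^3x_2^5x_3^{14}x_4^{11}+x_1^7x_2x_3^{11}x_4^{14}\\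 &+x_1^7x_2x_3^{14}x_4^{11}+x_1^7x_2^7x_3^{11}x_4^8+x_1^7x_2^7x_3^8x_4^{11}+x_1^7x_2^7x_3^9x_4^{10}, \end{align*} and let $x=\sum_{I\in S}a_1^{(i_1)}a_2^{(i_2)}a_3^{(i_3)}a_4^{(i_4)}$, where $S$ consists of the following 62 quadruples $I=(i_1,i_2,i_3,i_4)$: \begin{align*} &(7,7,5,14), (7,9,3,14), (11,5,3,14), (13,3,3,14), (7,7,6,13), (7,10,3,13), (11,6,3,13), (14,3,3,13),\\ &(7,9,6,11), (11,5,6,11), (13,3,6,11), (7,10,5,11), (11,6,5,11), (14,3,5,11), (7,7,9,10), (7,9,7,10),\\ &(11,5,7,10), (13,3,7,10), (7,11,5,10), (7,13,3,10), (7,7,10,9), (7,10,7,9), (11,6,7,9), (14,3,7,9),\\ &(7,11,6,9), (7,14,3,9), (7,9,10,7), (11,5,10,7), (13,3,10,7), (7,10,9,7), (11,6,9,7), (14,3,9,7),\\ &(7,13,6,7), (7,14,5,7), (7,7,13,6), (7,9,11,6), (11,5,11,6), (13,3,11,6), (11,7,9,6), (13,7,7,6),\\ &(11,11,5,6), (11,13,3,6),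 (7,7,14,5), (7,10,11,5), (11,6,11,5), (14,3,11,5), (11,7,10,5), (14,7,7,5),\\ &(11,11,6,5), (11,14,3,5), (7,9,14,3), (11,5,14,3), (13,3,14,3), (7,10,13,3), (11,6,13,3), (14,3,13,3),\\ &(13,7,10,3), (14,7,9,3), (13,11,6,3), (14,11,5,3), (13,14,3,3), (14,13,3,3). \end{align*} Then: 1. $\dim_{\mathbb F_2}[(Q\mathcal P_4)_{33}]^{G_4}=1$, and the class $[f]$ is a basis of $[(Q\mathcal P_4)_{33}]^{G_4}$. 2. $x\in P_{\mathcal A}H_{33}(B(\mathbb Z/2)^4)$, and $$\varphi_4(x)=\lambda_7^2\lambda_5\lambda_{14}+\lambda_7^2\lambda_9\lambda_{10}+\lambda_7\lambda_{11}\lambda_9\lambda_6\quad\text{in }\Lambda .$$ The right-hand side is a cocycle; $p_0\in\mathrm{Ext}^{4,37}_{\mathcal A}(\mathbb F_2,\mathbb F_2)$ denotes the class it represents, so that $x$ is a preimage of $p_0$ under the transfer. 3. $\langle x,f\rangle=1$. The pairing $\langle[u],[v]\rangle=\langle u,v\rangle$ is well defined and induces an isomorphism $[P_{\mathcal A}H_{33}(B(\mathbb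 Z/2)^4)]_{G_4}\cong\big([(Q\mathcal P_4)_{33}]^{G_4}\big)^*$ from the coinvariants onto the dual of the invariants, and under it $[x]$ is the dual basis element: $[f]^*=[x]$. -/

import Mathlib

open MvPolynomial

noncomputable section

namespace SingerTransfer

/-! ## The polynomial algebra and the Steenrod squares -/

/-- The polynomial algebra `P_k = F_2[x_1, ..., x_k]`; the variable `x_{i+1}` is `X i`. -/
abbrev P (k : ℕ) : Type := MvPolynomial (Fin k) (ZMod 2)

/-- The total Steenrod square `∑ Sq^n T^n`, the algebra homomorphism with `x_i ↦ x_i + x_i^2 T`. -/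
def sqTotal (k : ℕ) : P k →ₐ[ZMod 2] Polynomial (P k) :=
  aeval fun i => Polynomial.C (X i) + Polynomial.X * Polynomial.C (X i ^ 2)

/-- The Steenrod square `Sq^n` on `P_k`. -/
def Sq (k n : ℕ) : P k →ₗ[ZMod 2] P k :=
  ((Polynomial.lcoeff (P k) n).restrictScalars (ZMod 2)) ∘ₗ (sqTotal k).toLinearMap

theorem Sq_apply (k n : ℕ) (f : P k) : Sq k n f = (sqTotal k f).coeff n := rfl

theorem Sq_X_zero (k : ℕ) (i : Fin k) : Sq k 0 (X i) = X i := by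
  simp [Sq_apply, sqTotal]

theorem Sq_X_one (k : ℕ) (i : Fin k) : Sq k 1 (X i) = X i ^ 2 := by
  simp [Sq_apply, sqTotal, -map_pow]

theorem Sq_X_of_two_le (k n : ℕ) (hn : 2 ≤ n) (i : Fin k) : Sq k n (X i) = 0 := by
  obtain ⟨m, rfl⟩ : ∃ m, n = m + 2 := ⟨n - 2, by omega⟩
  simp [Sq_apply, sqTotal, -map_pow]

/-- The Cartan formula. -/
theorem Sq_mul (k n : ℕ) (f g : P k) :
    Sq k n (f * g) = ∑ p ∈ Finset.HasAntidiagonal.antidiagonal n, Sq k p.1 f * Sq k p.2 g := by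
  simp [Sq_apply, Polynomial.coeff_mul]

/-- `A⁺ P_k`, the space of hit polynomials: the span of all `Sq^i g` with `i ≥ 1`. -/
def hits (k : ℕ) : Submodule (ZMod 2) (P k) :=
  Submodule.span (ZMod 2) {h | ∃ (i : ℕ) (g : P k), 1 ≤ i ∧ Sq k i g = h}

/-- `(P_k)_d`, the homogeneous polynomials of degree `d`. -/
abbrev PDeg (k d : ℕ) : Submodule (ZMod 2) (P k) := homogeneousSubmodule (Fin k) (ZMod 2) d

/-- The hit polynomials of degree `d`, as a subspace of `(P_k)_d`. -/
def hitsDeg (k d : ℕ) : Submodule (ZMod 2) (PDeg k d) := (hits k).comap (PDeg k d).subtype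

/-- `(Q P_k)_d = (P_k)_d / (A⁺ P_k ∩ (P_k)_d)`. -/
abbrev QP (k d : ℕ) : Type := PDeg k d ⧸ hitsDeg k d

/-! ## The action of the general linear group -/

/-- The group `G_k = GL_k(F_2)`. -/
abbrev G (k : ℕ) : Type := Matrix.GeneralLinearGroup (Fin k) (ZMod 2)

/-- The linear substitution `x_j ↦ ∑_i g_{ij} x_i`. -/
def subst (k : ℕ) (g : G k) : P k →ₐ[ZMod 2] P k :=
  aeval fun j => ∑ i, C (g.val i j) * X i

theorem subst_X (k : ℕ) (g : G k) (j : Fin k) :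
    subst k g (X j) = ∑ i, C (g.val i j) * X i := by
  simp [subst]

theorem subst_C (k : ℕ) (g : G k) (c : ZMod 2) : subst k g (C c) = C c :=
  (subst k g).commutes c

theorem subst_one (k : ℕ) : subst k 1 = AlgHom.id (ZMod 2) (P k) := by
  apply MvPolynomial.algHom_ext
  intro j
  rw [subst_X]
  simp [Matrix.one_apply]

theorem subst_mul (k : ℕ) (g h : G k) : subst k (g * h) = (subst k g).comp (subst k h) := by
  apply MvPolynomial.algHom_ext
  intro j
  simp only [AlgHom.comp_apply, subst_X, map_sum, map_mul, subst_C, Finset.mul_sum,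
    Units.val_mul, Matrix.mul_apply, Finset.sum_mul]
  rw [Finset.sum_comm]
  exact Finset.sum_congr rfl fun _ _ => Finset.sum_congr rfl fun _ _ => by ring

theorem sqTotal_X (k : ℕ) (i : Fin k) :
    sqTotal k (X i) = Polynomial.C (X i) + Polynomial.X * Polynomial.C (X i ^ 2) := by
  simp [sqTotal]

theorem sqTotal_C (k : ℕ) (c : ZMod 2) : sqTotal k (C c) = Polynomial.C (C c) :=
  (sqTotal k).commutes c

theorem sqTotal_linear (k : ℕ) (c : Fin k → ZMod 2) :
    sqTotal k (∑ i, C (c i) * X i) = Polynomial.C (∑ i, C (c i) * X i) +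
      Polynomial.X * Polynomial.C ((∑ i, C (c i) * X i) ^ 2) := by
  have hsq : (∑ i, C (c i) * X i : P k) ^ 2 = ∑ i, C (c i) * X i ^ 2 := by
    rw [sum_pow_char 2]
    refine Finset.sum_congr rfl fun i _ => ?_
    rw [mul_pow, ← C_pow, ZMod.pow_card]
  rw [hsq, map_sum, map_sum, map_sum, Finset.mul_sum, ← Finset.sum_add_distrib]
  refine Finset.sum_congr rfl fun i _ => ?_
  rw [map_mul, sqTotal_C, sqTotal_X, Polynomial.C_mul, Polynomial.C_mul]
  ring

theorem sqTotal_subst (k : ℕ) (g : G k) (f : P k) :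
    sqTotal k (subst k g f) = Polynomial.mapAlgHom (subst k g) (sqTotal k f) := by
  have key : (sqTotal k).comp (subst k g) =
      (Polynomial.mapAlgHom (subst k g)).comp (sqTotal k) := by
    apply MvPolynomial.algHom_ext
    intro j
    rw [AlgHom.comp_apply, AlgHom.comp_apply, subst_X, sqTotal_linear, sqTotal_X, ← subst_X]
    simp
  exact DFunLike.congr_fun key f

theorem Sq_subst (k n : ℕ) (g : G k) (f : P k) :
    Sq k n (subst k g f) = subst k g (Sq k n f) := by
  rw [Sq_apply, Sq_apply, sqTotal_subst]
  simp

theorem subst_mem_PDeg (k d : ℕ) (g : G k) (f : P k) (hf : f ∈ PDeg k d) :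
    subst k g f ∈ PDeg k d := by
  have h := IsHomogeneous.aeval (R := ZMod 2) (m := d) (n := 1) hf
    (fun j => ∑ i, C (g.val i j) * X i : Fin k → P k) fun j =>
      IsHomogeneous.sum _ _ _ fun i _ => by
        simpa using (isHomogeneous_C (Fin k) (g.val i j)).mul (isHomogeneous_X (ZMod 2) i)
  simpa [subst] using h

/-- The action of `G_k` on `P_k` by linear substitutions. -/
def repP (k : ℕ) : Representation (ZMod 2) (G k) (P k) where
  toFun g := (subst k g).toLinearMap
  map_one' := by rw [subst_one]; rfl
  map_mul' g h := by rw [subst_mul]; rfl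

/-- The action of `G_k` on `(P_k)_d`. -/
def repPDeg (k d : ℕ) : Representation (ZMod 2) (G k) (PDeg k d) :=
  (repP k).subrepresentation (PDeg k d) fun g _ hf => subst_mem_PDeg k d g _ hf

theorem coe_repPDeg (k d : ℕ) (g : G k) (f : PDeg k d) :
    (repPDeg k d g f : P k) = subst k g f := rfl

theorem subst_mem_hits (k : ℕ) (g : G k) (f : P k) (hf : f ∈ hits k) :
    subst k g f ∈ hits k := by
  induction hf using Submodule.span_induction with
  | mem x hx =>
    obtain ⟨i, h, hi, rfl⟩ := hx
    exact Submodule.subset_span ⟨i, subst k g h, hi, Sq_subst k i g h⟩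
  | zero => simp
  | add x y _ _ hx hy => rw [map_add]; exact add_mem hx hy
  | smul c x _ hx => rw [map_smul]; exact Submodule.smul_mem _ c hx

/-- The action of `G_k` on `(Q P_k)_d`. -/
def repQP (k d : ℕ) : Representation (ZMod 2) (G k) (QP k d) :=
  (repPDeg k d).quotient (hitsDeg k d) fun g f hf => subst_mem_hits k g f hf

/-- The invariants `[(Q P_k)_d]^{G_k}`. -/
abbrev InvQP (k d : ℕ) : Submodule (ZMod 2) (QP k d) := (repQP k d).invariants

/-! ## Homology, primitives and coinvariants -/

/-- `H_d(B(Z/2)^k; F_2)`, the dual of the degree `d` cohomology `(P_k)_d`. -/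
abbrev H (k d : ℕ) : Type := Module.Dual (ZMod 2) (PDeg k d)

/-- `P_A H_d`: the homology classes `u` annihilated by the transposes `u ↦ u ∘ Sq^i` of all
Steenrod squares `Sq^i : (P_k)_e → (P_k)_d`, `e + i = d`, of positive degree. -/
def prim (k d : ℕ) : Submodule (ZMod 2) (H k d) where
  carrier := {u | ∀ (i e : ℕ) (g : P k), 1 ≤ i → e + i = d → g ∈ PDeg k e →
    ∀ h : Sq k i g ∈ PDeg k d, u ⟨Sq k i g, h⟩ = 0}
  zero_mem' := fun _ _ _ _ _ _ _ => rfl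
  add_mem' := fun hu hv i e g hi he hg h => by
    rw [LinearMap.add_apply, hu i e g hi he hg h, hv i e g hi he hg h, add_zero]
  smul_mem' := fun c u hu i e g hi he hg h => by
    rw [LinearMap.smul_apply, hu i e g hi he hg h, smul_zero]

/-- The action of `G_k` on `P_A H_d`, contragredient to the action on `(P_k)_d`. -/
def repPrim (k d : ℕ) : Representation (ZMod 2) (G k) (prim k d) :=
  (repPDeg k d).dual.subrepresentation (prim k d) fun g u hu i e f hi he hf h => by
    have h1 : Sq k i (subst k g⁻¹ f) ∈ PDeg k d := by
      rw [Sq_subst]; exact subst_mem_PDeg k d g⁻¹ _ h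
    have h2 : repPDeg k d g⁻¹ ⟨Sq k i f, h⟩ = ⟨Sq k i (subst k g⁻¹ f), h1⟩ :=
      Subtype.ext (Sq_subst k i g⁻¹ f).symm
    change u (repPDeg k d g⁻¹ ⟨Sq k i f, h⟩) = 0
    rw [h2]
    exact hu i e _ hi he (subst_mem_PDeg k e g⁻¹ f hf) h1

/-- The coinvariants `[P_A H_d(B(Z/2)^k)]_{G_k}`, the domain of the Singer transfer. -/
abbrev CoinvPrim (k d : ℕ) : Type := (repPrim k d).Coinvariants

/-- The divided power algebra `Γ[a_1, ..., a_k] = H_*(B(Z/2)^k)` as a vector space: the basis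
vector at `I` is `a^{(I)} = a_1^{(I 0)} ⋯ a_k^{(I (k-1))}`. -/
abbrev Gam (k : ℕ) : Type := (Fin k →₀ ℕ) →₀ ZMod 2

/-- The degree `d` part of an element of `Γ[a_1, ..., a_k]` as a functional on `(P_k)_d`:
`a^{(I)}` takes a polynomial to its coefficient at `x^I`. -/
def toH (k d : ℕ) : Gam k →ₗ[ZMod 2] H k d :=
  Finsupp.linearCombination (ZMod 2) fun I => lcoeff (ZMod 2) I ∘ₗ (PDeg k d).subtype

/-- The dual Steenrod square on the divided power algebra:
`a^{(I)} Sq_*^j = ∑_{q_1 + ⋯ + q_k = j} ∏_t binom (I_t - q_t) q_t a^{(I - q)}`.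
The terms in which some `q_t > I_t` vanish. -/
def dualSq (k j : ℕ) : Gam k →ₗ[ZMod 2] Gam k :=
  Finsupp.linearCombination (ZMod 2) fun I =>
    ∑ q ∈ Finset.finsuppAntidiag Finset.univ j,
      Finsupp.single (I - q) (∏ t, ((I t - q t).choose (q t) : ZMod 2))

/-! ## The Lambda algebra and the transfer -/

/-- The Adem relations `λ_k λ_l = ∑_t binom (t-l-1) (2t-k) λ_{k+l-t} λ_t`, for `k > 2l`. -/
inductive AdemRel : FreeAlgebra (ZMod 2) ℕ → FreeAlgebra (ZMod 2) ℕ → Prop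
  | adem (k l : ℕ) (h : 2 * l < k) :
      AdemRel (FreeAlgebra.ι (ZMod 2) k * FreeAlgebra.ι (ZMod 2) l)
        (∑ t ∈ (Finset.range (k + l + 1)).filter (fun t => l + 1 ≤ t ∧ k ≤ 2 * t),
          ((t - l - 1).choose (2 * t - k) : ZMod 2) •
            (FreeAlgebra.ι (ZMod 2) (k + l - t) * FreeAlgebra.ι (ZMod 2) t))

/-- The Lambda algebra. -/
abbrev Lam : Type := RingQuot AdemRel

/-- The projection of the free algebra on the `λ_n` onto the Lambda algebra. -/
def toLam : FreeAlgebra (ZMod 2) ℕ →ₐ[ZMod 2] Lam := RingQuot.mkAlgHom (ZMod 2) AdemRel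

/-- The generator `λ_n`. -/
def lam (n : ℕ) : Lam := toLam (FreeAlgebra.ι (ZMod 2) n)

/-- The differential of a generator, `δ(λ_n) = ∑_{j ≥ 1} binom (n-j) j λ_{j-1} λ_{n-j}`. -/
def diffGen (n : ℕ) : FreeAlgebra (ZMod 2) ℕ :=
  ∑ j ∈ Finset.Icc 1 n, ((n - j).choose j : ZMod 2) •
    (FreeAlgebra.ι (ZMod 2) (j - 1) * FreeAlgebra.ι (ZMod 2) (n - j))

/-- The algebra homomorphism `w ↦ [w, δ w; 0, w]`, which encodes the Leibniz rule for `δ`. -/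
def diffMat : FreeAlgebra (ZMod 2) ℕ →ₐ[ZMod 2]
    Matrix (Fin 2) (Fin 2) (FreeAlgebra (ZMod 2) ℕ) :=
  FreeAlgebra.lift (ZMod 2) fun n =>
    !![FreeAlgebra.ι (ZMod 2) n, diffGen n; 0, FreeAlgebra.ι (ZMod 2) n]

/-- The differential on words in the `λ_n`: the derivation that is `diffGen` on generators. -/
def diff (w : FreeAlgebra (ZMod 2) ℕ) : FreeAlgebra (ZMod 2) ℕ := diffMat w 0 1

theorem diffMat_eq (w : FreeAlgebra (ZMod 2) ℕ) : diffMat w = !![w, diff w; 0, w] := by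
  have h : diffMat w 0 0 = w ∧ diffMat w 1 0 = 0 ∧ diffMat w 1 1 = w := by
    induction w using FreeAlgebra.induction with
    | grade0 r => simp [Matrix.algebraMap_matrix_apply]
    | grade1 n => simp [diffMat]
    | mul a b ha hb => simp [Matrix.mul_apply, Fin.sum_univ_two, ha, hb]
    | add a b ha hb => simp [ha, hb]
  ext i j
  fin_cases i <;> fin_cases j <;> simp [h, diff]

theorem diff_gen (n : ℕ) : diff (FreeAlgebra.ι (ZMod 2) n) = diffGen n := by
  simp [diff, diffMat]

theorem diff_add (v w : FreeAlgebra (ZMod 2) ℕ) : diff (v + w) = diff v + diff w := by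
  simp [diff]

theorem diff_mul (v w : FreeAlgebra (ZMod 2) ℕ) : diff (v * w) = v * diff w + diff v * w := by
  rw [diff, map_mul, diffMat_eq v, diffMat_eq w]
  simp [Matrix.mul_apply, Fin.sum_univ_two]

/-- The chain-level Singer transfer `φ_k : Γ[a_1, ..., a_k] → Λ`,
`φ_k(a_k^{(t_k)} ⋯ a_1^{(t_1)}) = ∑_{i ≥ t_1} λ_i φ_{k-1}((a_k^{(t_k)} ⋯ a_2^{(t_2)}) Sq_*^{i-t_1})`,
with `i = t_1 + j`; the terms with `j > t_2 + ⋯ + t_k` vanish. -/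
def transfer : (k : ℕ) → Gam k →ₗ[ZMod 2] Lam
  | 0 => Finsupp.linearCombination (ZMod 2) fun _ => 1
  | k + 1 => Finsupp.linearCombination (ZMod 2) fun I =>
      ∑ j ∈ Finset.range (I.tail.degree + 1),
        lam (I 0 + j) * transfer k (dualSq k j (Finsupp.single I.tail 1))

/-! ## The explicit elements of degree 33 -/

/-- The exponents of the 16 monomials of `f`. -/
def fExponents : List (Fin 4 → ℕ) :=
  [
    ![1, 1, 1, 30], ![1, 1, 3, 28], ![1, 3, 1, 28], ![1, 3, 4, 25],
    ![1, 7, 11, 14], ![1, 7, 14, 11], ![3, 1, 1, 28], ![3, 1, 4, 25],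
    ![3, 5, 1, 24], ![3, 5, 11, 14], ![3, 5, 14, 11], ![7, 1, 11, 14],
    ![7, 1, 14, 11], ![7, 7, 11, 8], ![7, 7, 8, 11], ![7, 7, 9, 10]]

/-- `f = x_1 x_2 x_3 x_4^30 + ⋯ + x_1^7 x_2^7 x_3^9 x_4^10`. -/
def f : P 4 := (fExponents.map fun e => ∏ i, (X i : P 4) ^ e i).sum

theorem f_mem : f ∈ PDeg 4 33 := by
  refine list_sum_mem fun m hm => ?_
  obtain ⟨e, he, rfl⟩ := List.mem_map.1 hm
  have h1 : ∀ e ∈ fExponents, ∑ i, e i = 33 := by decide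
  rw [← h1 e he]
  exact IsHomogeneous.prod _ _ _ fun i _ => by
    simpa using (isHomogeneous_X (ZMod 2) i).pow (e i)

/-- The class `[f]` in `(Q P_4)_33`. -/
def fClass : QP 4 33 := (hitsDeg 4 33).mkQ ⟨f, f_mem⟩

/-- The exponents `(t_1, t_2, t_3, t_4)` of the 62 terms `a_4^{(t_4)} a_3^{(t_3)} a_2^{(t_2)}
a_1^{(t_1)}` of `x`. -/
def xExponents : List (Fin 4 → ℕ) :=
  [
    ![7, 7, 5, 14], ![7, 9, 3, 14], ![11, 5, 3, 14], ![13, 3, 3, 14],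
    ![7, 7, 6, 13], ![7, 10, 3, 13], ![11, 6, 3, 13], ![14, 3, 3, 13],
    ![7, 9, 6, 11], ![11, 5, 6, 11], ![13, 3, 6, 11], ![7, 10, 5, 11],
    ![11, 6, 5, 11], ![14, 3, 5, 11], ![7, 7, 9, 10], ![7, 9, 7, 10],
    ![11, 5, 7, 10], ![13, 3, 7, 10], ![7, 11, 5, 10], ![7, 13, 3, 10],
    ![7, 7, 10, 9], ![7, 10, 7, 9], ![11, 6, 7, 9], ![14, 3, 7, 9],
    ![7, 11, 6, 9], ![7, 14, 3, 9], ![7, 9, 10, 7], ![11, 5, 10, 7],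
    ![13, 3, 10, 7], ![7, 10, 9, 7], ![11, 6, 9, 7], ![14, 3, 9, 7],
    ![7, 13, 6, 7], ![7, 14, 5, 7], ![7, 7, 13, 6], ![7, 9, 11, 6],
    ![11, 5, 11, 6], ![13, 3, 11, 6], ![11, 7, 9, 6], ![13, 7, 7, 6],
    ![11, 11, 5, 6], ![11, 13, 3, 6], ![7, 7, 14, 5], ![7, 10, 11, 5],
    ![11, 6, 11, 5], ![14, 3, 11, 5], ![11, 7, 10, 5], ![14, 7, 7, 5],
    ![11, 11, 6, 5], ![11, 14, 3, 5], ![7, 9, 14, 3], ![11, 5, 14, 3],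
    ![13, 3, 14, 3], ![7, 10, 13, 3], ![11, 6, 13, 3], ![14, 3, 13, 3],
    ![13, 7, 10, 3], ![14, 7, 9, 3], ![13, 11, 6, 3], ![14, 11, 5, 3],
    ![13, 14, 3, 3], ![14, 13, 3, 3]]

/-- `x = a_1^{(7)} a_2^{(7)} a_3^{(5)} a_4^{(14)} + ⋯ + a_1^{(14)} a_2^{(13)} a_3^{(3)} a_4^{(3)}`. -/
def x : Gam 4 := (xExponents.map fun e => Finsupp.single (Finsupp.equivFunOnFinite.symm e) 1).sum

/-- The word `λ_7^2 λ_5 λ_14 + λ_7^2 λ_9 λ_10 + λ_7 λ_11 λ_9 λ_6`. -/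
def p0Word : FreeAlgebra (ZMod 2) ℕ :=
  let l := FreeAlgebra.ι (ZMod 2)
  l 7 * l 7 * l 5 * l 14 + l 7 * l 7 * l 9 * l 10 + l 7 * l 11 * l 9 * l 6

end SingerTransfer

end

/-! The space of invariants is computed by linear algebra over `ZMod 2`, after a structural
reduction from degree 33 to degree 15.

Every polynomial is uniquely a sum of terms `x^e y_e^2` with `x^e` squarefree. In degree 33 on four
variables, `x^e` has one or three factors. A term `x_i y^2` with `y` of degree 16 is hit, by a
telescoping sum of squares (`X_mul_sq_mem_hits`). So modulo hits only four polynomials `y_i` of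
degree 15 matter, where `y_i` belongs to the product `X_i` of the variables other than the `i`-th.
By the Cartan formula `X_i y^2` is hit when `y` is (`mulSq_cofactor_mem_hits`). The only further
relations come from squares of `x_1 x_2 x_3 x_4 y^2`, whose four components are `x_i w` with one
common `w`. Hence the quotient in degree 33 is the cokernel of `w ↦ (x_i w)_i` from degree 14 to
four copies of the quotient in degree 15. This is the content of `coords33_Sq` (hits have
coordinates zero) and `mem_hits_of_coords33` (the converse). The quotient in degree 15 has dimension
75 and is given by a table, certified from both sides: the table kills all squares, and each
monomial differs from its tabulated normal form by a hit.

`GL_4(F_2)` is generated by the four transvections `x_t ↦ x_t + x_{t+1}`, indices modulo four.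
Invariance of `[f]` is therefore four identities of coordinates. Conversely, Gaussian elimination on
the map that sends a class to itself together with its four differences under these transvections
leaves no invariant besides 0 and `[f]`.

That `f` is not hit follows from duality: `x` is annihilated by all dual squares, and `x` and `f`
have exactly one exponent in common, `(7, 7, 9, 10)`, so that they pair to 1. Primitives are the
functionals on the quotient by hits, and for a finite group the coinvariants of a dual are the dual
of the invariants (`ker_primInvariants`). The statements on dual squares, on the transfer and on the
cocycle are counts of monomials or words modulo two.

All finite computations use natural numbers as bit vectors. The map `bits` and the linear map
`reduceLin` carry their results over to vector spaces. -/

noncomputable section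

namespace SingerTransfer

/-! ## Bit vectors and elimination over `F_2` -/

/-- The sequence of binary digits of `v`, as a vector over `F_2`. -/
def bits (v : ℕ) : ℕ → ZMod 2 := fun n => if v.testBit n then 1 else 0

theorem bits_xor (v w : ℕ) : bits (v ^^^ w) = bits v + bits w := by
  funext n
  simp only [bits, Nat.testBit_xor, Pi.add_apply]
  cases v.testBit n <;> cases w.testBit n <;> decide

theorem bits_zero : bits 0 = 0 := by
  funext n
  simp [bits]

theorem bits_injective : Function.Injective bits := fun v w h => Nat.eq_of_testBit_eq fun n => by
  have := congrFun h n
  simp only [bits] at this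
  cases hv : v.testBit n <;> cases hw : w.testBit n <;> simp_all

theorem bits_eq_zero {v : ℕ} : bits v = 0 ↔ v = 0 := by
  rw [← bits_zero, bits_injective.eq_iff]

theorem bits_two_pow (n : ℕ) : bits (2 ^ n) = Pi.single n 1 := by
  funext m
  by_cases h : n = m
  · subst h; simp [bits]
  · simp [bits, h, Ne.symm h]

/-- The bitwise sum of a list of bit vectors. -/
def xorSum (l : List ℕ) : ℕ :=
  List.rec (motive := fun _ => ℕ) 0 (fun v _ s => Nat.xor s v) l

theorem xorSum_cons (v : ℕ) (l : List ℕ) : xorSum (v :: l) = xorSum l ^^^ v := rfl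

theorem bits_xorSum (l : List ℕ) : bits (xorSum l) = (l.map bits).sum := by
  induction l with
  | nil => exact bits_zero
  | cons v l ih => rw [xorSum_cons, bits_xor, ih, List.map_cons, List.sum_cons, add_comm]

/-- Elimination by the rows `s.2` with pivots `s.1`: each row in turn is added if the digit at its
pivot is one. -/
def reduce (E : List (ℕ × ℕ)) : ℕ → ℕ :=
  List.rec (motive := fun _ => ℕ → ℕ) (fun v => v)
    (fun s _ ih v => Nat.rec (motive := fun _ => ℕ) (ih v) (fun _ _ => ih (Nat.xor v s.2))
      (Nat.mod (Nat.shiftRight v s.1) 2)) E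

theorem reduce_cons (s : ℕ × ℕ) (E : List (ℕ × ℕ)) (v : ℕ) :
    reduce (s :: E) v = reduce E (if v.testBit s.1 then v ^^^ s.2 else v) := by
  have h : reduce (s :: E) v = Nat.rec (motive := fun _ => ℕ) (reduce E v)
    (fun _ _ => reduce E (v ^^^ s.2)) ((v >>> s.1) % 2) := rfl
  have h2 : v.testBit s.1 = decide ((v >>> s.1) % 2 = 1) := by
    rw [Nat.testBit, Nat.one_and_eq_mod_two]
    rcases Nat.mod_two_eq_zero_or_one (v >>> s.1) with h | h <;> simp [h]
  rw [h, h2]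
  rcases Nat.mod_two_eq_zero_or_one (v >>> s.1) with h | h <;> simp [h]

/-- The linear map that `reduce` computes. -/
def reduceLin : List (ℕ × ℕ) → (ℕ → ZMod 2) →ₗ[ZMod 2] (ℕ → ZMod 2)
  | [] => LinearMap.id
  | s :: E => reduceLin E ∘ₗ (LinearMap.id + (LinearMap.proj s.1).smulRight (bits s.2))

/-- Elimination is linear, so what it does to generators determines what it does to their span. -/
theorem bits_reduce (E : List (ℕ × ℕ)) (v : ℕ) : bits (reduce E v) = reduceLin E (bits v) := by
  induction E generalizing v with
  | nil => rfl
  | cons s E ih =>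
    rw [reduce_cons, ih, reduceLin, LinearMap.comp_apply]
    congr 1
    by_cases h : v.testBit s.1
    · rw [if_pos h, bits_xor]
      simp [bits, h]
    · rw [if_neg h]
      simp [bits, h]

/-- Each step of the elimination adds a multiple of a row. With the span of known relations as `R`,
a vector that reduces to zero is itself a relation. -/
theorem reduceLin_sub_mem (R : Submodule (ZMod 2) (ℕ → ZMod 2)) (E : List (ℕ × ℕ))
    (hE : ∀ s ∈ E, bits s.2 ∈ R) (u : ℕ → ZMod 2) : reduceLin E u - u ∈ R := by
  induction E generalizing u with
  | nil => simp [reduceLin]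
  | cons s E ih =>
    rw [reduceLin, LinearMap.comp_apply]
    have h1 := ih (fun t ht => hE t (List.mem_cons_of_mem _ ht)) (u + u s.1 • bits s.2)
    have h2 := R.add_mem h1 (R.smul_mem (u s.1) (hE s List.mem_cons_self))
    convert h2 using 1
    simp only [LinearMap.add_apply, LinearMap.id_apply, LinearMap.smulRight_apply,
      LinearMap.proj_apply]
    abel

theorem reduce_zero (E : List (ℕ × ℕ)) : reduce E 0 = 0 := by
  rw [← bits_eq_zero, bits_reduce, bits_zero, map_zero]

theorem reduce_append (E E' : List (ℕ × ℕ)) (v : ℕ) :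
    reduce (E ++ E') v = reduce E' (reduce E v) := by
  induction E generalizing v with
  | nil => rfl
  | cons s E ih => rw [List.cons_append, reduce_cons, reduce_cons, ih]

/-- Appends the reduced vector to the rows, with its leading digit as pivot, unless it is zero. -/
def insertRow (E : List (ℕ × ℕ)) (v : ℕ) : List (ℕ × ℕ) :=
  (fun w => Nat.rec (motive := fun _ => List (ℕ × ℕ)) E (fun _ _ => E ++ [(Nat.log2 w, w)]) w)
    (reduce E v)

theorem insertRow_eq (E : List (ℕ × ℕ)) (v : ℕ) : insertRow E v =
    if reduce E v = 0 then E else E ++ [(Nat.log2 (reduce E v), reduce E v)] := by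
  unfold insertRow
  generalize reduce E v = w
  cases w <;> simp

/-- Gaussian elimination. -/
def gauss (l : List ℕ) : List (ℕ × ℕ) := l.foldl insertRow []

/-- Soundness of the elimination: its rows are combinations of the given vectors. -/
theorem mem_of_mem_gauss (R : Submodule (ZMod 2) (ℕ → ZMod 2)) (l : List ℕ)
    (hl : ∀ v ∈ l, bits v ∈ R) : ∀ s ∈ gauss l, bits s.2 ∈ R := by
  suffices h : ∀ E : List (ℕ × ℕ), (∀ s ∈ E, bits s.2 ∈ R) →
      ∀ s ∈ l.foldl insertRow E, bits s.2 ∈ R from h [] (by simp)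
  induction l with
  | nil => intro E hE; exact hE
  | cons v l ih =>
    intro E hE
    refine ih (fun w hw => hl w (List.mem_cons_of_mem _ hw)) _ ?_
    rw [insertRow_eq]
    split_ifs with h
    · exact hE
    · intro s hs
      rcases List.mem_append.1 hs with hs | hs
      · exact hE s hs
      · rw [List.mem_singleton.1 hs, bits_reduce]
        simpa using R.add_mem (reduceLin_sub_mem R E hE (bits v)) (hl v List.mem_cons_self)

/-- Completeness of the elimination: once a vector reduces to zero, appending rows does not change
this, and a vector just inserted is cancelled by the row made from it. -/
theorem reduce_gauss (l : List ℕ) : ∀ v ∈ l, reduce (gauss l) v = 0 := by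
  suffices h : ∀ E : List (ℕ × ℕ), (∀ v, reduce E v = 0 → reduce (l.foldl insertRow E) v = 0) ∧
      ∀ v ∈ l, reduce (l.foldl insertRow E) v = 0 from (h []).2
  induction l with
  | nil => intro E; simp
  | cons v l ih =>
    intro E
    have h1 : ∀ u, reduce E u = 0 → reduce (insertRow E v) u = 0 := by
      intro u hu
      rw [insertRow_eq]
      split_ifs with h
      · exact hu
      · rw [reduce_append, hu, reduce_zero]
    have h2 : reduce (insertRow E v) v = 0 := by
      rw [insertRow_eq]
      split_ifs with h
      · exact h
      · rw [reduce_append, reduce_cons]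
        -- The pivot is the leading digit of the reduced vector, which is one, so the new row is
        -- added to itself.
        rw [if_pos (Nat.testBit_log2 h), Nat.xor_self]
        rfl
    refine ⟨fun u hu => (ih _).1 u (h1 u hu), fun u hu => ?_⟩
    rcases List.mem_cons.1 hu with rfl | hu
    · exact (ih _).1 _ h2
    · exact (ih _).2 u hu

/-- The linear combination of `F 0, …, F (N - 1)` with a given vector of coefficients. -/
def combo {A : Type*} [AddCommGroup A] [Module (ZMod 2) A] (N : ℕ) (F : ℕ → A) :
    (ℕ → ZMod 2) →ₗ[ZMod 2] A :=
  ∑ n ∈ Finset.range N, (LinearMap.proj n).smulRight (F n)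

theorem combo_two_pow {A : Type*} [AddCommGroup A] [Module (ZMod 2) A] (N : ℕ) (F : ℕ → A)
    {n : ℕ} (hn : n < N) : combo N F (bits (2 ^ n)) = F n := by
  rw [bits_two_pow, combo, LinearMap.sum_apply, Finset.sum_eq_single n]
  · simp
  · intro b _ hb
    simp [hb]
  · simp [hn]

/-- If `code` determines `G`, an equality of two numbers `xorSum` becomes an equality of sums in any
vector space over `ZMod 2`. -/
theorem combo_xorSum {A α : Type*} [AddCommGroup A] [Module (ZMod 2) A] (N : ℕ) (F : ℕ → A)
    (G : α → A) (code : α → ℕ) (l : List α)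
    (h : ∀ a ∈ l, code a < N ∧ F (code a) = G a) :
    combo N F (bits (xorSum (l.map fun a => 2 ^ code a))) = (l.map G).sum := by
  rw [bits_xorSum, List.map_map, map_list_sum, List.map_map]
  refine congrArg List.sum (List.map_congr_left fun a ha => ?_)
  obtain ⟨h1, h2⟩ := h a ha
  rw [← h2, ← combo_two_pow N F h1]
  rfl

/-! ## Steenrod squares and dual squares on lists of exponents -/

/-- The `n`-th row of Pascal's triangle modulo two, as a bit vector. -/
def pascal (n : ℕ) : ℕ :=
  Nat.rec (motive := fun _ => ℕ) 1 (fun _ r => Nat.xor r (Nat.shiftLeft r 1)) n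

/-- Pascal's rule: the next row is the sum of the row and its shift by one place. -/
theorem bits_pascal (n q : ℕ) : bits (pascal n) q = (n.choose q : ZMod 2) := by
  induction n generalizing q with
  | zero =>
    cases q with
    | zero => simp [pascal, bits]
    | succ q => simp [pascal, bits, Nat.testBit_succ]
  | succ n ih =>
    have h : pascal (n + 1) = pascal n ^^^ (pascal n <<< 1) := rfl
    rw [h, bits_xor, Pi.add_apply, ih]
    cases q with
    | zero => simp [bits]
    | succ q =>
      have h2 : bits (pascal n <<< 1) (q + 1) = bits (pascal n) q := by
        simp [bits]
      rw [h2, ih, Nat.choose_succ_succ, Nat.cast_add, add_comm]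

/-- Whether `n.choose q` is odd. -/
def oddChoose (n q : ℕ) : Bool := Nat.beq (Nat.mod (Nat.shiftRight (pascal n) q) 2) 1

theorem oddChoose_eq (n q : ℕ) : (n.choose q : ZMod 2) = if oddChoose n q then 1 else 0 := by
  have h : oddChoose n q = (pascal n).testBit q := by
    rw [Nat.testBit, Nat.one_and_eq_mod_two]
    change Nat.beq ((pascal n >>> q) % 2) 1 = _
    rcases Nat.mod_two_eq_zero_or_one (pascal n >>> q) with h | h <;> rw [h] <;> rfl
  rw [← bits_pascal, bits, h]

/-- The exponent vector with the entries of a list. -/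
def expo : (k : ℕ) → List ℕ → (Fin k →₀ ℕ)
  | 0, _ => 0
  | k + 1, l => Finsupp.cons (l.headD 0) (expo k l.tail)

theorem exists_expo (k : ℕ) (I : Fin k →₀ ℕ) : ∃ l : List ℕ, l.length = k ∧ expo k l = I := by
  induction k with
  | zero => exact ⟨[], rfl, Subsingleton.elim _ _⟩
  | succ k ih =>
    obtain ⟨l, hl, h⟩ := ih I.tail
    exact ⟨I 0 :: l, by simp [hl], by simp [expo, h, Finsupp.cons_tail]⟩

theorem degree_expo (k : ℕ) (l : List ℕ) (hl : l.length = k) : (expo k l).degree = l.sum := by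
  induction k generalizing l with
  | zero => simp [List.length_eq_zero_iff.1 hl, expo]
  | succ k ih =>
    obtain ⟨m, l, rfl⟩ := List.exists_cons_of_length_eq_add_one hl
    have := ih l (by simpa using hl)
    rw [Finsupp.degree_eq_sum] at this ⊢
    simp [Fin.sum_univ_succ, expo, this]

theorem oddChoose_eq_false {n q : ℕ} (h : n < q) : oddChoose n q = false := by
  by_contra hc
  have h2 := oddChoose_eq n q
  rw [if_pos (by simpa using hc), Nat.choose_eq_zero_of_lt h] at h2
  exact absurd h2 (by decide)

/-- The `n`-th member of a list, with a default value. -/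
def nth {α : Type} (l : List α) (d : α) : ℕ → α :=
  List.rec (motive := fun _ => ℕ → α) (fun _ => d)
    (fun a _ ih n => Nat.rec (motive := fun _ => α) a (fun m _ => ih m) n) l

/-- The default value is `f n` itself, so the lookup is correct beyond the end of the table too. -/
theorem nth_map_range {α : Type} (f : ℕ → α) (N n : ℕ) :
    nth ((List.range N).map f) (f n) n = f n := by
  have h : ∀ (l : List α) (d : α) (n : ℕ), nth l d n = l.getD n d := by
    intro l d
    induction l with
    | nil => intro n; simp [nth]
    | cons a l ih =>
      intro n
      cases n with
      | zero => rfl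
      | succ n =>
        rw [List.getD_cons_succ, ← ih n]
        rfl
  rw [h, List.getD_eq_getElem?_getD, List.getElem?_map]
  by_cases hn : n < N
  · simp [hn]
  · simp [hn]

/-- The numbers `q ≤ m` with `c m q`. -/
def choices (c : ℕ → ℕ → Bool) (m : ℕ) : List ℕ := (List.range (m + 1)).filter (c m)

/-- `List.append`, defined by the recursor so that it evaluates quickly in the kernel. -/
def recAppend {α : Type} (l l' : List α) : List α :=
  List.rec (motive := fun _ => List α) l' (fun a _ r => a :: r) l

/-- `List.map`, defined by the recursor so that it evaluates quickly in the kernel. -/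
def recMap {α β : Type} (f : α → β) (l : List α) : List β :=
  List.rec (motive := fun _ => List β) [] (fun a _ r => f a :: r) l

/-- `List.flatMap`, defined by the recursor so that it evaluates quickly in the kernel. -/
def recFlatMap {α β : Type} (f : α → List β) (l : List α) : List β :=
  List.rec (motive := fun _ => List β) [] (fun a _ r => recAppend (f a) r) l

theorem recAppend_eq {α : Type} (l l' : List α) : recAppend l l' = l ++ l' := by
  induction l with
  | nil => rfl
  | cons a l ih => exact congrArg (a :: ·) ih

theorem recMap_eq {α β : Type} (f : α → β) (l : List α) : recMap f l = l.map f := by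
  induction l with
  | nil => rfl
  | cons a l ih => exact congrArg (f a :: ·) ih

theorem recFlatMap_eq {α β : Type} (f : α → List β) (l : List α) :
    recFlatMap f l = l.flatMap f := by
  induction l with
  | nil => rfl
  | cons a l ih =>
    rw [List.flatMap_cons, ← ih, ← recAppend_eq]
    rfl

/-- The lists obtained from `l` by applying `h` entrywise with sequences of sum at most `J` whose
entries are drawn from the lists `c m`, together with the difference of `J` and that sum. -/
def terms (c : ℕ → List ℕ) (h : ℕ → ℕ → ℕ) (l : List ℕ) : ℕ → List (ℕ × List ℕ) :=
  List.rec (motive := fun _ => ℕ → List (ℕ × List ℕ)) (fun J => [(J, [])])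
    (fun m _ ih J => recFlatMap (fun q => Bool.rec (motive := fun _ => List (ℕ × List ℕ)) []
      (recMap (fun p => (p.1, h m q :: p.2)) (ih (Nat.sub J q))) (Nat.ble q J)) (c m)) l

theorem terms_nil (c : ℕ → List ℕ) (h : ℕ → ℕ → ℕ) (J : ℕ) : terms c h [] J = [(J, [])] := rfl

theorem terms_cons (c : ℕ → List ℕ) (h : ℕ → ℕ → ℕ) (m : ℕ) (l : List ℕ) (J : ℕ) :
    terms c h (m :: l) J = (c m).flatMap fun q =>
      bif Nat.ble q J then (terms c h l (Nat.sub J q)).map fun p => (p.1, h m q :: p.2) else [] := by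
  rw [← recFlatMap_eq]
  simp only [← recMap_eq]
  have h1 : ∀ (b : Bool) (L : List (ℕ × List ℕ)),
      (bif b then L else []) = Bool.rec (motive := fun _ => List (ℕ × List ℕ)) [] L b := by
    intro b L
    cases b <;> rfl
  simp only [h1]
  rfl

theorem terms_spec {c : ℕ → List ℕ} {h : ℕ → ℕ → ℕ} {l : List ℕ} {J : ℕ} {p : ℕ × List ℕ}
    (hp : p ∈ terms c h l J) : p.1 ≤ J ∧ p.2.length = l.length := by
  induction l generalizing p J with
  | nil => simp_all [terms_nil]
  | cons m l ih =>
    simp only [terms_cons, List.mem_flatMap] at hp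
    obtain ⟨q, -, hq⟩ := hp
    cases hc : Nat.ble q J
    · simp [hc] at hq
    · simp only [hc, cond_true, List.mem_map] at hq
      obtain ⟨t, ht, rfl⟩ := hq
      have h1 := ih ht
      exact ⟨h1.1.trans (Nat.sub_le J q), by simp [h1.2]⟩

theorem sum_finsuppAntidiag_succ {A : Type*} [AddCommMonoid A] (k j : ℕ)
    (F : (Fin (k + 1) →₀ ℕ) → A) :
    ∑ q ∈ Finset.finsuppAntidiag Finset.univ j, F q =
      ∑ a ∈ Finset.range (j + 1), ∑ q ∈ Finset.finsuppAntidiag Finset.univ (j - a),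
        F (Finsupp.cons a q) := by
  rw [Finset.sum_sigma']
  refine Finset.sum_nbij' (fun q => ⟨q 0, q.tail⟩) (fun p => Finsupp.cons p.1 p.2) ?_ ?_ ?_ ?_ ?_
  · intro q hq
    simp only [Finset.mem_finsuppAntidiag, Fin.sum_univ_succ] at hq
    simp only [Finset.mem_sigma, Finset.mem_range, Finset.mem_finsuppAntidiag, Finsupp.tail_apply]
    have h1 : ∑ i : Fin k, q.tail i = ∑ i : Fin k, q i.succ := rfl
    refine ⟨by omega, ?_, Finset.subset_univ _⟩
    change ∑ i : Fin k, q.tail i = _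
    omega
  · intro p hp
    simp only [Finset.mem_sigma, Finset.mem_range, Finset.mem_finsuppAntidiag] at hp
    simp only [Finset.mem_finsuppAntidiag, Fin.sum_univ_succ, Finsupp.cons_zero, Finsupp.cons_succ]
    refine ⟨?_, Finset.subset_univ _⟩
    have h1 : ∑ i : Fin k, p.2 i = j - p.1 := hp.2.1
    omega
  · intro q _
    exact Finsupp.cons_tail q
  · intro p _
    simp
  · intro q _
    rw [Finsupp.cons_tail]

theorem sum_map_flatMap {A α β : Type*} [AddCommMonoid A] (L : List α) (g : α → List β)
    (F : β → A) : ((L.flatMap g).map F).sum = (L.map fun a => ((g a).map F).sum).sum := by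
  induction L with
  | nil => simp
  | cons a L ih => simp [ih]

theorem sum_map_range {A : Type*} [AddCommMonoid A] (n : ℕ) (g : ℕ → A) :
    ((List.range n).map g).sum = ∑ a ∈ Finset.range n, g a := by
  induction n with
  | zero => simp
  | succ n ih => simp [List.range_succ, Finset.sum_range_succ, ih]

theorem sum_list_comm {A α : Type*} [AddCommMonoid A] (s : Finset ℕ) (L : List α)
    (g : ℕ → α → A) : ∑ j ∈ s, (L.map (g j)).sum = (L.map fun a => ∑ j ∈ s, g j a).sum := by
  induction L with
  | nil => simp
  | cons a L ih => simp [Finset.sum_add_distrib, ih]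

theorem sum_map_filter {A α : Type*} [AddCommMonoid A] (L : List α) (c : α → Bool) (g : α → A) :
    ((L.filter c).map g).sum = (L.map fun a => if c a then g a else 0).sum := by
  induction L with
  | nil => simp
  | cons a L ih => cases h : c a <;> simp [h, ih]

/-- One enumeration serves both kinds of squares: `C` is the binomial coefficient modulo two, `c`
its parity, and `h` the operation on an exponent (addition for `Sq`, subtraction for the dual). A
single list covers all `j ≤ J`, because each entry carries the unused part `J - j` of the budget.
The proof is by induction on the number of variables, splitting off the first entry of `q`. -/
theorem sum_terms {A : Type*} [AddCommGroup A] [Module (ZMod 2) A]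
    (C : ℕ → ℕ → ZMod 2) (c : ℕ → ℕ → Bool) (hc : ∀ m q, C m q = if c m q then 1 else 0)
    (hc0 : ∀ m q, m < q → c m q = false)
    (h : ℕ → ℕ → ℕ) (H : (k : ℕ) → (Fin k →₀ ℕ) → (Fin k →₀ ℕ) → (Fin k →₀ ℕ))
    (hH : ∀ k I q t, H k I q t = h (I t) (q t))
    (k : ℕ) (l : List ℕ) (hl : l.length = k) (J j : ℕ) (hj : j ≤ J) (F : (Fin k →₀ ℕ) → A) :
    ∑ q ∈ Finset.finsuppAntidiag Finset.univ j, (∏ t, C (expo k l t) (q t)) • F (H k (expo k l) q) =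
      ((terms (choices c) h l J).map fun p => if p.1 + j = J then F (expo k p.2) else 0).sum := by
  induction k generalizing l J j with
  | zero =>
    rw [List.length_eq_zero_iff.1 hl]
    cases j with
    | zero =>
      simp only [Finset.univ_eq_empty, Finset.finsuppAntidiag_empty_zero, Finset.sum_singleton]
      simp only [Finset.prod_empty, one_smul, terms_nil]
      simp only [List.map_cons, List.map_nil, List.sum_singleton, add_zero, if_true]
      exact congrArg F (Subsingleton.elim _ _)
    | succ j => simp [terms_nil]
  | succ k ih =>
    obtain ⟨m, l, rfl⟩ := List.exists_cons_of_length_eq_add_one hl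
    have hl : l.length = k := by simpa using hl
    have h1 : ∀ (a : ℕ) (q : Fin k →₀ ℕ), H (k + 1) (expo (k + 1) (m :: l)) (Finsupp.cons a q) =
        Finsupp.cons (h m a) (H k (expo k l) q) := by
      intro a q
      ext t
      rw [hH]
      refine Fin.cases ?_ (fun t => ?_) t
      · simp [expo]
      · simp [expo, hH]
    have h2 : expo (k + 1) (m :: l) 0 = m := by simp [expo]
    have h3 : ∀ t : Fin k, expo (k + 1) (m :: l) t.succ = expo k l t := by simp [expo]
    -- The contribution of a first entry `a`. One side sums it up to `j`, the other up to `m`. It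
    -- vanishes beyond either bound: for `a > m` by parity, for `a > j` because too little of the
    -- budget is left.
    let S : ℕ → A := fun a => if c m a ∧ a ≤ J then ((terms (choices c) h l (J - a)).map fun p =>
      if p.1 + j = J then F (Finsupp.cons (h m a) (expo k p.2)) else 0).sum else 0
    have hS : ∀ a, m < a ∨ j < a → S a = 0 := by
      rintro a (ha | ha)
      · simp [S, hc0 m a ha]
      · refine ite_eq_right_iff.2 fun hJ => List.sum_eq_zero fun y hy => ?_
        obtain ⟨p, hp, rfl⟩ := List.mem_map.1 hy
        have := (terms_spec hp).1
        rw [if_neg (by omega)]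
    have hL : ∑ q ∈ Finset.finsuppAntidiag Finset.univ j,
        (∏ t, C (expo (k + 1) (m :: l) t) (q t)) • F (H (k + 1) (expo (k + 1) (m :: l)) q) =
        ∑ a ∈ Finset.range (j + 1), S a := by
      rw [sum_finsuppAntidiag_succ]
      refine Finset.sum_congr rfl fun a ha => ?_
      have ha : a ≤ j := by simpa [Nat.lt_succ_iff] using ha
      simp only [h1, Fin.prod_univ_succ, Finsupp.cons_zero, Finsupp.cons_succ, h2, h3, hc m a, S]
      cases c m a
      · simp
      · have hJ : a ≤ J := ha.trans hj
        simp only [if_true, one_mul, hJ, and_true]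
        rw [ih l hl (J - a) (j - a) (by omega) fun I => F (Finsupp.cons (h m a) I)]
        refine congrArg List.sum (List.map_congr_left fun p _ => ?_)
        by_cases hp : p.1 + j = J
        · rw [if_pos hp, if_pos (by omega)]
        · rw [if_neg hp, if_neg (by omega)]
    have hR : ((terms (choices c) h (m :: l) J).map fun p =>
        if p.1 + j = J then F (expo (k + 1) p.2) else 0).sum = ∑ a ∈ Finset.range (m + 1), S a := by
      rw [terms_cons, choices, sum_map_flatMap, sum_map_filter, sum_map_range]
      refine Finset.sum_congr rfl fun a _ => ?_
      by_cases ha : a ≤ J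
      · rw [Nat.ble_eq_true_of_le ha, cond_true, List.map_map]
        simp only [S, ha, and_true]
        rfl
      · have : Nat.ble a J = false := by
          rw [← Bool.not_eq_true]
          exact fun h => ha (Nat.le_of_ble_eq_true h)
        simp [this, S, ha]
    rw [hL, hR, Finset.sum_subset (Finset.range_mono (show j + 1 ≤ m + j + 1 by omega)),
      Finset.sum_subset (Finset.range_mono (show m + 1 ≤ m + j + 1 by omega))]
    · intro a _ ha
      exact hS a (Or.inl (by simpa [Nat.lt_succ_iff] using ha))
    · intro a _ ha
      exact hS a (Or.inr (by simpa [Nat.lt_succ_iff] using ha))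

/-- The numbers `q` such that `m.choose q` is odd. -/
def sqChoices (m : ℕ) : List ℕ :=
  nth ((List.range 16).map (choices oddChoose)) (choices oddChoose m) m

/-- The exponents of the monomials of `Sq^j x^l` for `j ≤ J`, together with `J - j`. -/
def sqTerms (l : List ℕ) (J : ℕ) : List (ℕ × List ℕ) := terms sqChoices Nat.add l J

/-- The numbers `q` such that `(m - q).choose q` is odd. -/
def dualChoices (m : ℕ) : List ℕ :=
  nth ((List.range 16).map (choices fun m q => oddChoose (Nat.sub m q) q))
    (choices (fun m q => oddChoose (Nat.sub m q) q) m) m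

/-- The exponents of the divided power monomials of `a^{(l)} Sq_*^j` for `j ≤ J`, together with
`J - j`. -/
def dualTerms (l : List ℕ) (J : ℕ) : List (ℕ × List ℕ) := terms dualChoices Nat.sub l J

/-- The monomial whose exponents are the entries of `l`. -/
def mono (k : ℕ) (l : List ℕ) : P k := monomial (expo k l) 1

theorem dualSq_single (k j J : ℕ) (hj : j ≤ J) (l : List ℕ) (hl : l.length = k) :
    dualSq k j (Finsupp.single (expo k l) 1) = ((dualTerms l J).map fun p =>
      if p.1 + j = J then (Finsupp.single (expo k p.2) 1 : Gam k) else 0).sum := by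
  have hc : dualChoices = choices fun m q => oddChoose (Nat.sub m q) q :=
    funext fun m => nth_map_range _ _ _
  have h := sum_terms (fun m q => ((m - q).choose q : ZMod 2)) _
    (fun m q => oddChoose_eq (m - q) q) (fun m q h => oddChoose_eq_false (by omega)) Nat.sub
    (fun k I q => I - q) (fun _ _ _ _ => rfl) k l hl J j hj fun I => (Finsupp.single I 1 : Gam k)
  rw [dualSq, Finsupp.linearCombination_single, one_smul, dualTerms, hc]
  refine Eq.trans (Finset.sum_congr rfl fun q _ => ?_) h
  rw [Finsupp.smul_single, smul_eq_mul, mul_one]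

/-! ### Steenrod squares of monomials -/

theorem coeff_one_add_X_mul_C_pow {R : Type*} [CommRing R] (a : R) (m q : ℕ) :
    ((Polynomial.C a + Polynomial.X * Polynomial.C (a ^ 2)) ^ m).coeff q =
      (m.choose q : R) * a ^ (m + q) := by
  rw [add_comm, add_pow, Polynomial.finsetSum_coeff]
  have h : ∀ i, ((Polynomial.X * Polynomial.C (a ^ 2)) ^ i * Polynomial.C a ^ (m - i) *
      ((m.choose i : ℕ) : Polynomial R)).coeff q =
      if q = i then a ^ (2 * i + (m - i)) * (m.choose i : R) else 0 := by
    intro i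
    have : (Polynomial.X * Polynomial.C (a ^ 2)) ^ i * Polynomial.C a ^ (m - i) *
      ((m.choose i : ℕ) : Polynomial R) =
      Polynomial.C (a ^ (2 * i + (m - i)) * (m.choose i : R)) * Polynomial.X ^ i := by
      simp only [mul_pow, map_mul, map_pow, map_natCast, pow_add, pow_mul]
      ring
    rw [this, Polynomial.coeff_C_mul_X_pow]
  simp only [h, Finset.sum_ite_eq, Finset.mem_range]
  split_ifs with hq
  · rw [mul_comm]
    congr 2
    omega
  · rw [Nat.choose_eq_zero_of_lt (by omega)]
    simp

theorem Sq_monomial (k j : ℕ) (I : Fin k →₀ ℕ) :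
    Sq k j (monomial I 1) = ∑ q ∈ Finset.finsuppAntidiag Finset.univ j,
      (∏ t, ((I t).choose (q t) : ZMod 2)) • (monomial (I + q) 1 : P k) := by
  have h : (monomial I 1 : P k) = ∏ t, X t ^ I t := by
    rw [monomial_eq, C_1, one_mul, Finsupp.prod_fintype _ _ fun _ => pow_zero _]
  -- In power series, a coefficient of a finite product is a sum over all `q` of total `j`; this is
  -- the iterated Cartan formula.
  rw [Sq_apply, h, map_prod, ← Polynomial.coeff_coe, ← Polynomial.coeToPowerSeries.ringHom_apply,
    map_prod, PowerSeries.coeff_prod]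
  refine Finset.sum_congr rfl fun q _ => ?_
  have h2 : (monomial (I + q) 1 : P k) = ∏ t, X t ^ (I t + q t) := by
    rw [monomial_eq, C_1, one_mul, Finsupp.prod_fintype _ _ fun _ => pow_zero _]
    rfl
  rw [h2, smul_eq_C_mul, map_prod, ← Finset.prod_mul_distrib]
  refine Finset.prod_congr rfl fun t _ => ?_
  rw [Polynomial.coeToPowerSeries.ringHom_apply, Polynomial.coeff_coe, map_pow, sqTotal_X,
    coeff_one_add_X_mul_C_pow, map_natCast]

theorem Sq_mono (k j J : ℕ) (hj : j ≤ J) (l : List ℕ) (hl : l.length = k) :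
    Sq k j (mono k l) =
      ((sqTerms l J).map fun p => if p.1 + j = J then mono k p.2 else 0).sum := by
  have hc : sqChoices = choices oddChoose := funext fun m => nth_map_range _ _ _
  rw [mono, Sq_monomial, sqTerms, hc]
  exact sum_terms (fun m q => (m.choose q : ZMod 2)) _ oddChoose_eq
    (fun _ _ => oddChoose_eq_false) Nat.add (fun k I q => I + q)
    (fun _ _ _ _ => rfl) k l hl J j hj fun I => monomial I 1

/-! ## Sums over lists of lists, modulo two -/

/-- The number whose digits in base `b` are the entries of `l`, the first entry being the last
digit. -/
def encode (b : ℕ) : List ℕ → ℕ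
  | [] => 0
  | a :: l => Nat.add a (Nat.mul b (encode b l))

/-- The last `k` digits of `n` in base `b`. -/
def decode (b : ℕ) : ℕ → ℕ → List ℕ
  | 0, _ => []
  | k + 1, n => n % b :: decode b k (n / b)

/-- Lists of fixed length with entries below `b` correspond to bit positions below `b ^ l.length`,
so that `xorSum` counts occurrences modulo two without collisions. -/
theorem decode_encode (b : ℕ) (l : List ℕ) (h : ∀ a ∈ l, a < b) :
    decode b l.length (encode b l) = l ∧ encode b l < b ^ l.length := by
  induction l with
  | nil => simp [decode, encode]
  | cons a l ih =>
    have ha : a < b := h a List.mem_cons_self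
    obtain ⟨h1, h2⟩ := ih fun c hc => h c (List.mem_cons_of_mem _ hc)
    have h3 : encode b (a :: l) = a + b * encode b l := rfl
    rw [h3, List.length_cons, decode, Nat.add_mul_mod_self_left, Nat.mod_eq_of_lt ha,
      Nat.add_mul_div_left _ _ (by omega), Nat.div_eq_of_lt ha, zero_add, h1]
    refine ⟨rfl, ?_⟩
    calc a + b * encode b l < b * (encode b l + 1) := by rw [mul_add]; omega
      _ ≤ b * b ^ l.length := Nat.mul_le_mul_left _ h2
      _ = b ^ (l.length + 1) := by ring

/-- The set of lists that occur an odd number of times in `L`, as a bit vector. -/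
def encodeSum (b : ℕ) (L : List (List ℕ)) : ℕ := xorSum (L.map fun l => Nat.pow 2 (encode b l))

/-- Whether all members of `L` are lists of `k` numbers smaller than `b`. -/
def isBounded (b k : ℕ) (L : List (List ℕ)) : Bool :=
  L.all fun l => Nat.beq l.length k && l.all fun a => Nat.ble (Nat.succ a) b

theorem combo_encodeSum {A : Type*} [AddCommGroup A] [Module (ZMod 2) A] {b k : ℕ}
    {L : List (List ℕ)} (hL : isBounded b k L = true) (F : List ℕ → A) :
    combo (b ^ k) (fun n => F (decode b k n)) (bits (encodeSum b L)) = (L.map F).sum := by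
  refine combo_xorSum _ _ F _ L fun l hl => ?_
  have h := List.all_eq_true.1 hL l hl
  rw [Bool.and_eq_true, List.all_eq_true] at h
  have h2 := decode_encode b l fun a ha => Nat.le_of_ble_eq_true (h.2 a ha)
  rw [← Nat.eq_of_beq_eq_true h.1]
  exact ⟨h2.2, by rw [h2.1]⟩

/-- Whether every list of `k` numbers smaller than `b` occurs in `L` and in `L'` with the same
parity, and no other lists occur. -/
def sameParity (b k : ℕ) (L L' : List (List ℕ)) : Bool :=
  isBounded b k L && isBounded b k L' && Nat.beq (encodeSum b L) (encodeSum b L')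

/-- In characteristic two a sum depends only on the parity with which each term occurs. This turns
one numerical comparison into an identity for every `F`. -/
theorem sum_map_eq_of_sameParity {A : Type*} [AddCommGroup A] [Module (ZMod 2) A] {b k : ℕ}
    {L L' : List (List ℕ)} (h : sameParity b k L L' = true) (F : List ℕ → A) :
    (L.map F).sum = (L'.map F).sum := by
  rw [sameParity, Bool.and_eq_true, Bool.and_eq_true] at h
  rw [← combo_encodeSum h.1.1, ← combo_encodeSum h.1.2, Nat.eq_of_beq_eq_true h.2]

/-! ## The element `x` is annihilated by the dual squares -/

/-- The exponents of the terms of `x`, as lists. -/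
def xLists : List (List ℕ) := xExponents.map fun e => [e 0, e 1, e 2, e 3]

theorem equivFunOnFinite_symm_eq (e : Fin 4 → ℕ) :
    Finsupp.equivFunOnFinite.symm e = expo 4 [e 0, e 1, e 2, e 3] := by
  ext t
  fin_cases t <;> rfl

theorem length_xLists {l : List ℕ} (hl : l ∈ xLists) : l.length = 4 := by
  obtain ⟨e, -, rfl⟩ := List.mem_map.1 hl
  rfl

theorem x_eq : x = (xLists.map fun l => Finsupp.single (expo 4 l) 1).sum := by
  simp only [x, xLists, List.map_map, equivFunOnFinite_symm_eq]
  rfl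

/-- The total dual square fixes `x`: the terms for all `j` at once add up to `x`, which is the
contribution of `j = 0`. -/
theorem xLists_dualTerms_check :
    sameParity 16 4 (xLists.flatMap fun l => (dualTerms l 33).map Prod.snd) xLists = true := by
  decide +kernel

theorem xLists_sum_check : (xLists.all fun l => Nat.beq l.sum 33 &&
    (dualTerms l 33).all fun p => Nat.beq p.2.sum p.1) = true := by
  decide +kernel

theorem dualSq_x (j : ℕ) (hj : 1 ≤ j) : dualSq 4 j x = 0 := by
  have hx : ∀ l ∈ xLists, l.sum = 33 ∧ ∀ p ∈ dualTerms l 33, p.2.sum = p.1 := by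
    intro l hl
    have h := List.all_eq_true.1 xLists_sum_check l hl
    rw [Bool.and_eq_true, List.all_eq_true] at h
    exact ⟨Nat.eq_of_beq_eq_true h.1, fun p hp => Nat.eq_of_beq_eq_true (h.2 p hp)⟩
  by_cases h33 : j ≤ 33
  -- `F` picks out the part of degree `33 - j` of the total dual square. Since `j ≥ 1`, the element
  -- `x` has no such part.
  · let F : List ℕ → Gam 4 := fun l => if l.sum + j = 33 then Finsupp.single (expo 4 l) 1 else 0
    have h1 := sum_map_eq_of_sameParity xLists_dualTerms_check F
    have h2 : (xLists.map F).sum = 0 := List.sum_eq_zero fun y hy => by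
      obtain ⟨l, hl, rfl⟩ := List.mem_map.1 hy
      have := (hx l hl).1
      exact if_neg (by omega)
    rw [h2, sum_map_flatMap] at h1
    rw [x_eq, map_list_sum, List.map_map, ← h1]
    refine congrArg List.sum (List.map_congr_left fun l hl => ?_)
    rw [Function.comp_apply, dualSq_single 4 j 33 h33 l (length_xLists hl), List.map_map]
    refine congrArg List.sum (List.map_congr_left fun p hp => ?_)
    rw [Function.comp_apply, ← (hx l hl).2 p hp]
  -- For `j > 33` each `q` exceeds some exponent, where the truncated difference is 0 and the
  -- binomial coefficient vanishes.
  · rw [x_eq, map_list_sum]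
    refine List.sum_eq_zero fun y hy => ?_
    simp only [List.map_map, List.mem_map, Function.comp_apply] at hy
    obtain ⟨l, hl, rfl⟩ := hy
    have hd := degree_expo 4 l (length_xLists hl)
    rw [(hx l hl).1, Finsupp.degree_eq_sum] at hd
    rw [dualSq, Finsupp.linearCombination_single, one_smul]
    refine Finset.sum_eq_zero fun q hq => ?_
    have hq : ∑ t, q t = j := (Finset.mem_finsuppAntidiag.1 hq).1
    obtain ⟨t, ht⟩ : ∃ t, expo 4 l t < q t := by
      by_contra! hc
      have := Finset.sum_le_sum fun t (_ : t ∈ Finset.univ) => hc t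
      omega
    rw [Finset.prod_eq_zero (Finset.mem_univ t), Finsupp.single_zero]
    rw [Nat.choose_eq_zero_of_lt (by omega), Nat.cast_zero]

/-! ## The transfer of `x` -/

/-- A product of generators of the Lambda algebra. -/
def lamWord (w : List ℕ) : Lam := (w.map lam).prod

/-- The words of the transfer of a divided power monomial in `k` variables. -/
def transferTerms : ℕ → List ℕ → List (List ℕ)
  | 0, _ => [[]]
  | _ + 1, [] => []
  | k + 1, t :: l => (fun J => (dualTerms l J).flatMap fun p =>
      (transferTerms k p.2).map (Nat.add t (Nat.sub J p.1) :: ·)) l.sum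

theorem transfer_single (k : ℕ) (l : List ℕ) (hl : l.length = k) :
    transfer k (Finsupp.single (expo k l) 1) = ((transferTerms k l).map lamWord).sum := by
  induction k generalizing l with
  | zero => simp [transfer, transferTerms, lamWord]
  | succ k ih =>
    obtain ⟨t, l, rfl⟩ := List.exists_cons_of_length_eq_add_one hl
    have hl : l.length = k := by simpa using hl
    have h1 : (expo (k + 1) (t :: l)).tail = expo k l := by simp [expo]
    have h2 : expo (k + 1) (t :: l) 0 = t := by simp [expo]
    rw [transfer, Finsupp.linearCombination_single, one_smul, h1, h2, degree_expo k l hl,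
      transferTerms, sum_map_flatMap]
    have h3 : ∀ j ∈ Finset.range (l.sum + 1),
        lam (t + j) * transfer k (dualSq k j (Finsupp.single (expo k l) 1)) =
        ((dualTerms l l.sum).map fun p => if p.1 + j = l.sum then
          lam (t + j) * ((transferTerms k p.2).map lamWord).sum else 0).sum := by
      intro j hj
      rw [dualSq_single k j l.sum (Nat.lt_succ_iff.1 (Finset.mem_range.1 hj)) l hl, map_list_sum,
        List.map_map, ← List.sum_map_mul_left]
      refine congrArg List.sum (List.map_congr_left fun p hp => ?_)
      rw [Function.comp_apply]
      split_ifs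
      · rw [ih p.2 ((terms_spec hp).2.trans hl)]
      · rw [map_zero, mul_zero]
    rw [Finset.sum_congr rfl h3, sum_list_comm]
    refine congrArg List.sum (List.map_congr_left fun p hp => ?_)
    have hp1 := (terms_spec hp).1
    -- A term with unused budget `p.1` occurs for exactly one square, `j = l.sum - p.1`.
    rw [Finset.sum_eq_single (l.sum - p.1)]
    · rw [if_pos (by omega), ← List.sum_map_mul_left, List.map_map]
      rfl
    · intro j _ hj
      exact if_neg (by omega)
    · intro hj
      exact absurd (Finset.mem_range.2 (by omega)) hj

/-- The words of `p0Word`. -/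
def p0Words : List (List ℕ) := [[7, 7, 5, 14], [7, 7, 9, 10], [7, 11, 9, 6]]

theorem toLam_p0Word : toLam p0Word = (p0Words.map lamWord).sum := by
  simp [p0Word, p0Words, lamWord, lam, mul_assoc, add_assoc]

/-- The words already cancel in the free algebra, so the transfer of `x` needs no Adem relation. The
base is 32 because letters above 15 occur before cancellation. -/
theorem xLists_transfer_check :
    sameParity 32 4 (xLists.flatMap (transferTerms 4)) p0Words = true := by
  decide +kernel

theorem transfer_x : transfer 4 x = toLam p0Word := by
  rw [toLam_p0Word, x_eq, map_list_sum, List.map_map]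
  refine Eq.trans ?_ (sum_map_eq_of_sameParity xLists_transfer_check lamWord)
  rw [sum_map_flatMap]
  exact congrArg List.sum (List.map_congr_left fun l hl => transfer_single 4 l (length_xLists hl))

/-! ## The differential of `p0Word` -/

/-- A product of generators of the free algebra. -/
def freeWord (w : List ℕ) : FreeAlgebra (ZMod 2) ℕ := (w.map (FreeAlgebra.ι (ZMod 2))).prod

theorem freeWord_cons (n : ℕ) (w : List ℕ) :
    freeWord (n :: w) = FreeAlgebra.ι (ZMod 2) n * freeWord w := by
  simp [freeWord]

theorem freeWord_append (v w : List ℕ) : freeWord (v ++ w) = freeWord v * freeWord w := by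
  simp [freeWord]

theorem toLam_freeWord (w : List ℕ) : toLam (freeWord w) = lamWord w := by
  rw [freeWord, lamWord, map_list_prod, List.map_map]
  rfl

/-- The words of the differential of a generator. -/
def diffGenTerms (n : ℕ) : List (List ℕ) := (List.range n).flatMap fun j =>
  bif oddChoose (Nat.sub n (j + 1)) (j + 1) then [[j, Nat.sub n (j + 1)]] else []

theorem diffGen_eq (n : ℕ) : diffGen n = ((diffGenTerms n).map freeWord).sum := by
  rw [diffGenTerms, sum_map_flatMap, sum_map_range, diffGen, Finset.sum_bij' (fun j _ => j - 1)
    (fun j _ => j + 1)]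
  · intro j hj
    have := Finset.mem_Icc.1 hj
    exact Finset.mem_range.2 (by omega)
  · intro j hj
    have := Finset.mem_range.1 hj
    exact Finset.mem_Icc.2 (by omega)
  · intro j hj
    have := Finset.mem_Icc.1 hj
    omega
  · intro j _
    rfl
  · intro j hj
    obtain ⟨i, rfl⟩ : ∃ i, j = i + 1 := ⟨j - 1, by have := Finset.mem_Icc.1 hj; omega⟩
    rw [oddChoose_eq]
    change _ = (List.map freeWord (bif oddChoose (n - (i + 1)) (i + 1) then
      [[i, n - (i + 1)]] else [])).sum
    cases oddChoose (n - (i + 1)) (i + 1) <;> simp [freeWord]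

/-- The words of the differential of a word. -/
def diffTerms : List ℕ → List (List ℕ)
  | [] => []
  | n :: w => (diffTerms w).map (n :: ·) ++ (diffGenTerms n).map (· ++ w)

theorem diff_freeWord (w : List ℕ) : diff (freeWord w) = ((diffTerms w).map freeWord).sum := by
  induction w with
  | nil => simp [freeWord, diffTerms, diff]
  | cons n w ih =>
    rw [freeWord_cons, diff_mul, ih, diff_gen, diffGen_eq, diffTerms, List.map_append,
      List.sum_append, List.map_map, List.map_map, ← List.sum_map_mul_left,
      ← List.sum_map_mul_right]
    simp [Function.comp_def, freeWord_cons, freeWord_append]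

/-- The words of an inadmissible product of two generators. -/
def ademTerms (a b : ℕ) : List (List ℕ) := (List.range (a + b + 1)).flatMap fun t =>
  bif (Nat.ble (b + 1) t && Nat.ble a (2 * t)) && oddChoose (t - b - 1) (2 * t - a) then
    [[a + b - t, t]] else []

theorem lamWord_adem (a b : ℕ) (h : 2 * b < a) :
    lamWord [a, b] = ((ademTerms a b).map lamWord).sum := by
  have h1 := RingQuot.mkAlgHom_rel (ZMod 2) (AdemRel.adem a b h)
  rw [map_mul, map_sum] at h1
  rw [ademTerms, sum_map_flatMap, sum_map_range]
  refine (by simp [lamWord, lam, toLam] : lamWord [a, b] = _).trans (h1.trans ?_)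
  rw [Finset.sum_filter]
  refine Finset.sum_congr rfl fun t _ => ?_
  by_cases ht : b + 1 ≤ t ∧ a ≤ 2 * t
  · rw [if_pos ht, oddChoose_eq, Nat.ble_eq_true_of_le ht.1, Nat.ble_eq_true_of_le ht.2]
    cases oddChoose (t - b - 1) (2 * t - a) <;> simp [lamWord, lam, toLam]
  · rw [if_neg ht]
    have h3 : (Nat.ble (b + 1) t && Nat.ble a (2 * t)) = false := by
      rw [← Bool.not_eq_true, Bool.and_eq_true]
      exact fun h => ht ⟨Nat.le_of_ble_eq_true h.1, Nat.le_of_ble_eq_true h.2⟩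
    simp [h3]

/-- Applies an Adem relation to the first inadmissible pair of a word. -/
def ademStep : List ℕ → List (List ℕ)
  | [] => [[]]
  | [a] => [[a]]
  | a :: b :: w => bif Nat.ble (2 * b + 1) a then (ademTerms a b).map (· ++ w)
      else (ademStep (b :: w)).map (a :: ·)

theorem lamWord_append (v w : List ℕ) : lamWord (v ++ w) = lamWord v * lamWord w := by
  simp [lamWord]

/-- One rewriting round does not change the element of the Lambda algebra. No admissible basis or
confluence is needed, since only vanishing is to be shown. -/
theorem sum_ademStep (w : List ℕ) : ((ademStep w).map lamWord).sum = lamWord w := by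
  induction w with
  | nil => simp [ademStep]
  | cons a w ih =>
    cases w with
    | nil => simp [ademStep]
    | cons b w =>
      rw [ademStep]
      by_cases h : Nat.ble (2 * b + 1) a = true
      · rw [h, cond_true, List.map_map, show a :: b :: w = [a, b] ++ w from rfl, lamWord_append,
          lamWord_adem a b (Nat.le_of_ble_eq_true h), ← List.sum_map_mul_right]
        simp [Function.comp_def, lamWord_append]
      · rw [Bool.not_eq_true] at h
        rw [h, cond_false, List.map_map, show a :: b :: w = [a] ++ (b :: w) from rfl,
          lamWord_append, ← ih, ← List.sum_map_mul_left]
        simp [Function.comp_def, lamWord]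

/-- Three rounds of rewriting suffice for all words of the differential to cancel in pairs. -/
theorem p0Words_diff_check : sameParity 16 5
    ((((p0Words.flatMap diffTerms).flatMap ademStep).flatMap ademStep).flatMap ademStep) [] =
      true := by
  decide +kernel

theorem toLam_diff_p0Word : toLam (diff p0Word) = 0 := by
  have h0 : p0Word = (p0Words.map freeWord).sum := by
    simp [p0Word, p0Words, freeWord, mul_assoc, add_assoc]
  have h1 : diff p0Word = ((p0Words.flatMap diffTerms).map freeWord).sum := by
    rw [h0, sum_map_flatMap]
    simp [p0Words, diff_add, ← diff_freeWord]
  have h2 : ∀ L : List (List ℕ), ((L.flatMap ademStep).map lamWord).sum = (L.map lamWord).sum :=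
    fun L => by simp only [sum_map_flatMap, sum_ademStep]
  have h3 := (h2 _).symm.trans ((h2 _).symm.trans ((h2 _).symm.trans
    (sum_map_eq_of_sameParity p0Words_diff_check lamWord)))
  rw [h1, map_list_sum, List.map_map]
  simpa [Function.comp_def, toLam_freeWord] using h3

/-! ## The pairing of divided powers with polynomials -/

/-- The pairing of the divided power algebra with the polynomial algebra. -/
def pairing (k : ℕ) : Gam k →ₗ[ZMod 2] P k →ₗ[ZMod 2] ZMod 2 :=
  Finsupp.linearCombination (ZMod 2) fun I => lcoeff (ZMod 2) I

theorem toH_apply (k d : ℕ) (u : Gam k) (v : PDeg k d) : toH k d u v = pairing k u v := by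
  induction u using Finsupp.induction_linear with
  | zero => simp
  | add u w hu hw => simp [hu, hw]
  | single I c => simp [toH, pairing]

theorem pairing_single (k : ℕ) (I : Fin k →₀ ℕ) (g : P k) :
    pairing k (Finsupp.single I 1) g = coeff I g := by
  simp [pairing]

/-- The dual squares are the transposes of the squares: on `a^{(I)}` and `x^m` both sides receive
the same binomial product from `q = I - m`. -/
theorem pairing_Sq (k j : ℕ) (u : Gam k) (g : P k) :
    pairing k u (Sq k j g) = pairing k (dualSq k j u) g := by
  induction u using Finsupp.induction_linear with
  | zero => simp
  | add u w hu hw => simp [hu, hw]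
  | single I c =>
    have hc : (Finsupp.single I c : Gam k) = c • Finsupp.single I 1 := by simp
    rw [hc]
    simp only [map_smul, LinearMap.smul_apply]
    congr 1
    induction g using MvPolynomial.induction_on' with
    | add p q hp hq => simp only [map_add, hp, hq]
    | monomial m a =>
      have ha : (monomial m a : P k) = a • monomial m 1 := by simp [smul_monomial]
      rw [ha]
      simp only [map_smul]
      congr 1
      rw [pairing_single, Sq_monomial, dualSq, Finsupp.linearCombination_single, one_smul,
        map_sum, LinearMap.sum_apply, coeff_sum]
      refine Finset.sum_congr rfl fun q _ => ?_
      have h1 : (Finsupp.single (I - q) (∏ t, ((I t - q t).choose (q t) : ZMod 2)) : Gam k) =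
          (∏ t, ((I t - q t).choose (q t) : ZMod 2)) • Finsupp.single (I - q) 1 := by simp
      rw [h1, map_smul, LinearMap.smul_apply, pairing_single, coeff_smul, coeff_monomial,
        coeff_monomial]
      by_cases h : m + q = I
      · have h2 : m = I - q := by rw [← h, add_tsub_cancel_right]
        have h3 : ∀ t, I t - q t = m t := fun t => by rw [h2]; rfl
        rw [if_pos h, if_pos h2]
        simp only [h3]
      · rw [if_neg h, smul_zero]
        -- Truncation can give `m = I - q` although `m + q ≠ I`. Then some `q t` exceeds `I t`, and
        -- its binomial coefficient is that of 0 over a positive number.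
        by_cases h2 : m = I - q
        · obtain ⟨t, ht⟩ : ∃ t, I t < q t := by
            by_contra! hle
            refine h (Finsupp.ext fun t => ?_)
            have := hle t
            rw [h2]
            simp only [Finsupp.add_apply, Finsupp.tsub_apply]
            omega
          rw [Finset.prod_eq_zero (Finset.mem_univ t), zero_smul]
          rw [Nat.choose_eq_zero_of_lt (by omega), Nat.cast_zero]
        · rw [if_neg h2, smul_zero]

theorem toH_mem_prim (k d : ℕ) (u : Gam k) (hu : ∀ j, 1 ≤ j → dualSq k j u = 0) :
    toH k d u ∈ prim k d := fun i _ g hi _ _ _ => by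
  rw [toH_apply, pairing_Sq, hu i hi, map_zero, LinearMap.zero_apply]

/-- The exponents of the terms of `f`, as lists. -/
def fLists : List (List ℕ) := fExponents.map fun e => [e 0, e 1, e 2, e 3]

theorem mono_four (a b c d : ℕ) : mono 4 [a, b, c, d] =
    X 0 ^ a * X 1 ^ b * X 2 ^ c * X 3 ^ d := by
  rw [mono, monomial_eq, C_1, one_mul, Finsupp.prod_fintype _ _ fun _ => pow_zero _,
    Fin.prod_univ_four]
  rfl

theorem f_eq : f = (fLists.map (mono 4)).sum := by
  rw [f, fLists, List.map_map]
  refine congrArg List.sum (List.map_congr_left fun e _ => ?_)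
  rw [Function.comp_apply, mono_four, Fin.prod_univ_four]

theorem expo_injective {k : ℕ} {l l' : List ℕ} (hl : l.length = k) (hl' : l'.length = k)
    (h : expo k l = expo k l') : l = l' := by
  induction k generalizing l l' with
  | zero => rw [List.length_eq_zero_iff.1 hl, List.length_eq_zero_iff.1 hl']
  | succ k ih =>
    obtain ⟨m, l, rfl⟩ := List.exists_cons_of_length_eq_add_one hl
    obtain ⟨m', l', rfl⟩ := List.exists_cons_of_length_eq_add_one hl'
    have h1 := Finsupp.cons_injective2 h
    exact congrArg₂ _ h1.1 (ih (by simpa using hl) (by simpa using hl') h1.2)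

theorem pairing_x_f : toH 4 33 x ⟨f, f_mem⟩ = 1 := by
  have hx : ∀ l ∈ xLists, l.length = 4 := fun l => length_xLists
  have hf : ∀ l ∈ fLists, l.length = 4 := by decide
  -- The number of common exponents modulo two; the only one is `(7, 7, 9, 10)`.
  have h : (fLists.map fun l' => (xLists.map fun l => if l' = l then (1 : ZMod 2) else 0).sum).sum =
      1 := by decide +kernel
  rw [toH_apply]
  change pairing 4 x f = 1
  rw [f_eq, map_list_sum, List.map_map, ← h]
  refine congrArg List.sum (List.map_congr_left fun l' hl' => ?_)
  rw [Function.comp_apply, x_eq, ← LinearMap.flip_apply, map_list_sum, List.map_map]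
  refine congrArg List.sum (List.map_congr_left fun l hl => ?_)
  rw [Function.comp_apply, LinearMap.flip_apply]
  rw [pairing_single, mono, coeff_monomial]
  exact if_congr ⟨fun h => expo_injective (hf l' hl') (hx l hl) h, fun h => by rw [h]⟩ rfl rfl

/-! ## Coinvariants of primitives and invariants of the quotient -/

theorem Sq_mem_PDeg (k j e : ℕ) (g : P k) (hg : g ∈ PDeg k e) : Sq k j g ∈ PDeg k (e + j) := by
  rw [g.as_sum, map_sum]
  refine Submodule.sum_mem _ fun m hm => ?_
  have hd : m.degree = e := by
    have := hg (mem_support_iff.1 hm)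
    rw [Finsupp.degree_eq_weight_one]
    exact this
  have ha : (monomial m (coeff m g) : P k) = coeff m g • monomial m 1 := by simp [smul_monomial]
  rw [ha, map_smul, Sq_monomial]
  refine Submodule.smul_mem _ _ (Submodule.sum_mem _ fun q hq => Submodule.smul_mem _ _ ?_)
  refine isHomogeneous_monomial 1 ?_
  have hq : ∑ t, q t = j := (Finset.mem_finsuppAntidiag.1 hq).1
  rw [map_add, hd, Finsupp.degree_eq_sum q, hq]

/-- The span of the squares of positive degree of homogeneous polynomials that lie in degree
`d`. -/
def homHits (k d : ℕ) : Submodule (ZMod 2) (P k) :=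
  Submodule.span (ZMod 2) {h | ∃ (j e : ℕ) (g : P k), 1 ≤ j ∧ e + j = d ∧ g ∈ PDeg k e ∧
    Sq k j g = h}

/-- `hits` allows squares of inhomogeneous polynomials, whereas primitives are tested on homogeneous
ones. Squares raise degrees by a fixed amount, so projecting to degree `d` bridges the gap. -/
theorem homogeneousComponent_mem_homHits (k d : ℕ) (h : P k) (hh : h ∈ hits k) :
    homogeneousComponent d h ∈ homHits k d := by
  induction hh using Submodule.span_induction with
  | mem y hy =>
    obtain ⟨j, g, hj, rfl⟩ := hy
    induction g using MvPolynomial.induction_on' with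
    | add p q hp hq => rw [map_add, map_add]; exact add_mem hp hq
    | monomial m a =>
      have hm : (monomial m a : P k) ∈ PDeg k m.degree := isHomogeneous_monomial a rfl
      rw [homogeneousComponent_of_mem (Sq_mem_PDeg k j _ _ hm)]
      split_ifs with hd
      · exact Submodule.subset_span ⟨j, _, _, hj, hd.symm, hm, rfl⟩
      · exact zero_mem _
  | zero => rw [map_zero]; exact zero_mem _
  | add y z _ _ hy hz => rw [map_add]; exact add_mem hy hz
  | smul c y _ hy => rw [map_smul]; exact Submodule.smul_mem _ c hy

theorem mem_homHits_of_mem_hits {k d : ℕ} {h : P k} (hd : h ∈ PDeg k d) (hh : h ∈ hits k) :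
    h ∈ homHits k d := by
  have h1 := homogeneousComponent_mem_homHits k d h hh
  rwa [homogeneousComponent_of_mem hd, if_pos rfl] at h1

theorem prim_apply_eq_zero {k d : ℕ} {u : H k d} (hu : u ∈ prim k d) (v : PDeg k d)
    (hv : (v : P k) ∈ hits k) : u v = 0 := by
  have key : ∀ h ∈ homHits k d, ∀ hd : h ∈ PDeg k d, u ⟨h, hd⟩ = 0 := by
    have h1 : homHits k d ≤ (LinearMap.ker u).map (PDeg k d).subtype := by
      refine Submodule.span_le.2 ?_
      rintro _ ⟨j, e, g, hj, he, hg, rfl⟩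
      have hd : Sq k j g ∈ PDeg k d := he ▸ Sq_mem_PDeg k j e g hg
      exact ⟨⟨_, hd⟩, hu j e g hj he hg hd, rfl⟩
    intro h hh hd
    obtain ⟨w, hw, rfl⟩ := h1 hh
    exact hw
  exact key v (mem_homHits_of_mem_hits v.2 hv) v.2

/-- Primitives are the functionals on the quotient by the hit polynomials. -/
def primEquiv (k d : ℕ) : prim k d ≃ₗ[ZMod 2] Module.Dual (ZMod 2) (QP k d) where
  toFun u := (hitsDeg k d).liftQ u.1 fun v hv => prim_apply_eq_zero u.2 v hv
  map_add' u w := by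
    apply Submodule.linearMap_qext
    rfl
  map_smul' c u := by
    apply Submodule.linearMap_qext
    rfl
  invFun φ := ⟨φ ∘ₗ (hitsDeg k d).mkQ, fun i e g hi _ _ h => by
    have h0 : (hitsDeg k d).mkQ ⟨Sq k i g, h⟩ = 0 :=
      (Submodule.Quotient.mk_eq_zero _).2 (Submodule.subset_span ⟨i, g, hi, rfl⟩)
    rw [LinearMap.comp_apply, h0, map_zero]⟩
  left_inv u := rfl
  right_inv φ := by
    apply Submodule.linearMap_qext
    rfl

/-- The inverse comes from the contragredient action. -/
theorem primEquiv_repPrim (k d : ℕ) (g : G k) (u : prim k d) :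
    primEquiv k d (repPrim k d g u) = primEquiv k d u ∘ₗ repQP k d g⁻¹ := by
  apply Submodule.linearMap_qext
  rfl

/-- The pairing of primitives with invariant classes. -/
def primInvariants (k d : ℕ) : prim k d →ₗ[ZMod 2] Module.Dual (ZMod 2) (InvQP k d) :=
  (InvQP k d).subtype.dualMap ∘ₗ (primEquiv k d).toLinearMap

/-- A functional on the subspace of invariants extends to the whole quotient. -/
theorem primInvariants_surjective (k d : ℕ) : Function.Surjective (primInvariants k d) :=
  (LinearMap.dualMap_surjective_of_injective (InvQP k d).injective_subtype).comp
    (primEquiv k d).surjective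

/-- The invariants are the intersection of the kernels of `g - 1`. As the group is finite, the
annihilator of this intersection is the sum of the annihilators, and each of those is the range of
the transpose of `g - 1`, consisting of the differences `g⁻¹ w - w`. These differences span the
kernel of the map to coinvariants. -/
theorem ker_primInvariants (k d : ℕ) :
    LinearMap.ker (primInvariants k d) = Representation.Coinvariants.ker (repPrim k d) := by
  apply le_antisymm
  · intro u hu
    have hinv : InvQP k d = ⨅ g : G k, LinearMap.ker (repQP k d g - LinearMap.id) := by
      ext v
      simp [Representation.mem_invariants, Submodule.mem_iInf, sub_eq_zero]
    have h1 : primEquiv k d u ∈ (InvQP k d).dualAnnihilator := by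
      rw [Submodule.mem_dualAnnihilator]
      intro w hw
      exact LinearMap.congr_fun hu (⟨w, hw⟩ : InvQP k d)
    -- Finiteness of the group enters here.
    rw [hinv, Subspace.dualAnnihilator_iInf_eq] at h1
    have h2 : ∀ φ ∈ ⨆ g : G k, (LinearMap.ker (repQP k d g - LinearMap.id)).dualAnnihilator,
        (primEquiv k d).symm φ ∈ Representation.Coinvariants.ker (repPrim k d) := by
      intro φ hφ
      induction hφ using Submodule.iSup_induction' with
      | mem g φ hφ =>
        rw [← LinearMap.range_dualMap_eq_dualAnnihilator_ker] at hφ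
        obtain ⟨ψ, rfl⟩ := hφ
        obtain ⟨w, rfl⟩ := (primEquiv k d).surjective ψ
        have h3 : (repQP k d g - LinearMap.id).dualMap (primEquiv k d w) =
            primEquiv k d (repPrim k d g⁻¹ w - w) := by
          refine Eq.trans ?_ ((primEquiv k d).toLinearMap.map_sub (repPrim k d g⁻¹ w) w).symm
          rw [LinearEquiv.coe_coe, primEquiv_repPrim, inv_inv]
          exact LinearMap.ext fun v => LinearMap.map_sub (primEquiv k d w) (repQP k d g v) v
        rw [h3, LinearEquiv.symm_apply_apply]
        exact Submodule.subset_span ⟨(g⁻¹, w), rfl⟩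
      | zero => rw [map_zero]; exact zero_mem _
      | add φ ψ _ _ hφ hψ => rw [map_add]; exact add_mem hφ hψ
    simpa using h2 _ h1
  · refine Submodule.span_le.2 ?_
    rintro _ ⟨⟨g, u⟩, rfl⟩
    change primInvariants k d (repPrim k d g u - u) = 0
    ext w
    have h1 : repQP k d g⁻¹ w.1 = w.1 := w.2 g⁻¹
    rw [LinearMap.map_sub, LinearMap.sub_apply]
    change primEquiv k d (repPrim k d g u) w.1 - primEquiv k d u w.1 = 0
    rw [primEquiv_repPrim, LinearMap.comp_apply, h1, sub_self]

/-- The coinvariants of the primitives are dual to the invariants. -/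
def coinvEquiv (k d : ℕ) : CoinvPrim k d ≃ₗ[ZMod 2] Module.Dual (ZMod 2) (InvQP k d) :=
  (Submodule.quotEquivOfEq _ _ (ker_primInvariants k d).symm).trans
    ((primInvariants k d).quotKerEquivOfSurjective (primInvariants_surjective k d))

theorem coinvEquiv_mk (k d : ℕ) (u : prim k d) (v : PDeg k d)
    (hv : (hitsDeg k d).mkQ v ∈ InvQP k d) :
    coinvEquiv k d (Representation.Coinvariants.mk (repPrim k d) u) ⟨(hitsDeg k d).mkQ v, hv⟩ =
      (u : H k d) v := rfl

/-! ## Hit polynomials of degree 15 -/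

/-- The lists of sum `d` whose positive entries are at the places where `s` is true. -/
def compositions : List Bool → ℕ → List (List ℕ)
  | [], 0 => [[]]
  | [], _ + 1 => []
  | false :: s, d => (compositions s d).map (0 :: ·)
  | [true], 0 => []
  | [true], d + 1 => [[d + 1]]
  | true :: b :: s, d => (List.range d).flatMap fun a =>
      (compositions (b :: s) (Nat.sub d (Nat.succ a))).map (Nat.succ a :: ·)

theorem mem_compositions (l : List ℕ) :
    l ∈ compositions (l.map fun a => Nat.blt 0 a) l.sum := by
  induction l with
  | nil => simp [compositions]
  | cons a l ih =>
    cases a with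
    | zero =>
      change 0 :: l ∈ compositions (false :: l.map fun a => Nat.blt 0 a) (0 + l.sum)
      rw [zero_add, compositions]
      exact List.mem_map_of_mem ih
    | succ a =>
      cases l with
      | nil => exact List.mem_singleton.2 rfl
      | cons b l =>
        change _ ∈ compositions (true :: Nat.blt 0 b :: l.map fun a => Nat.blt 0 a)
          (a + 1 + (b :: l).sum)
        rw [compositions, List.mem_flatMap]
        refine ⟨a, List.mem_range.2 (by omega), List.mem_map.2 ⟨b :: l, ?_, rfl⟩⟩
        have h : Nat.sub (a + 1 + (b :: l).sum) a.succ = (b :: l).sum :=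
          Nat.add_sub_cancel_left _ _
        rw [h]
        exact ih

/-- The possible supports of a list of four numbers. -/
def supports : List (List Bool) := List.flatMap (fun s => [true :: s, false :: s])
  (List.flatMap (fun s => [true :: s, false :: s])
    [[true, true], [true, false], [false, true], [false, false]])

theorem map_blt_mem_supports (l : List ℕ) (hl : l.length = 4) :
    (l.map fun a => Nat.blt 0 a) ∈ supports := by
  have h : ∀ a b c d : Bool, [a, b, c, d] ∈ supports := by decide
  match l, hl with
  | [a, b, c, d], _ => exact h _ _ _ _

/-- The exponents of monomials of degree 15 whose classes form a basis of `(Q P_4)_15`. -/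
def basis15 : List (List ℕ) := [
  [0, 0, 0, 15], [0, 0, 1, 14], [0, 0, 15, 0], [0, 1, 0, 14], [0, 1, 1, 13], [0, 1, 7, 7],
  [0, 1, 14, 0], [0, 3, 5, 7], [0, 3, 7, 5], [0, 7, 1, 7], [0, 7, 3, 5], [0, 7, 7, 1],
  [0, 15, 0, 0], [1, 0, 0, 14], [1, 0, 1, 13], [1, 0, 7, 7], [1, 0, 14, 0], [1, 1, 0, 13],
  [1, 1, 1, 12], [1, 1, 6, 7], [1, 1, 7, 6], [1, 1, 13, 0], [1, 2, 5, 7], [1, 2, 7, 5],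
  [1, 3, 4, 7], [1, 3, 5, 6], [1, 3, 6, 5], [1, 3, 7, 4], [1, 6, 1, 7], [1, 6, 3, 5], [1, 6, 7, 1],
  [1, 7, 0, 7], [1, 7, 1, 6], [1, 7, 2, 5], [1, 7, 3, 4], [1, 7, 6, 1], [1, 7, 7, 0],
  [1, 14, 0, 0], [3, 0, 5, 7], [3, 0, 7, 5], [3, 1, 4, 7], [3, 1, 5, 6], [3, 1, 6, 5],
  [3, 1, 7, 4], [3, 3, 2, 7], [3, 3, 3, 6], [3, 3, 4, 5], [3, 3, 5, 4], [3, 3, 7, 2], [3, 5, 0, 7],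
  [3, 5, 1, 6], [3, 5, 2, 5], [3, 5, 3, 4], [3, 5, 6, 1], [3, 5, 7, 0], [3, 7, 0, 5], [3, 7, 1, 4],
  [3, 7, 3, 2], [3, 7, 5, 0], [7, 0, 1, 7], [7, 0, 3, 5], [7, 0, 7, 1], [7, 1, 0, 7], [7, 1, 1, 6],
  [7, 1, 2, 5], [7, 1, 3, 4], [7, 1, 6, 1], [7, 1, 7, 0], [7, 3, 0, 5], [7, 3, 1, 4], [7, 3, 3, 2],
  [7, 3, 5, 0], [7, 7, 0, 1], [7, 7, 1, 0], [15, 0, 0, 0]]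

/-- The coordinates of the monomials of degree 15 modulo hit polynomials: the digits of the `a`-th
row are divided into blocks of 75 digits, one for each `x_1^a x_2^b x_3^c x_4^d`. -/
def tableRows : List ℕ := [
  0x2000000000000000000010000000000000000000400000000000000000400000000000000000020000000000000000002000000000000000002000000000000000000100000000000000000020000000000000000002000000000000000002000000000000000000100000000000000000020000000000000000004000000000000000000400000000000000000400000000000000000020000000000000000004000000000000000000800000000000000000100000000000000000010000000000000000010000000000000000000800000000000000000100000000000000000020000000000000000004000000000000000000800000000000000000080000000000000000080000000000000000004000000000000000000800000000000000000100000000000000000020000000000000000004000000000000000000800000000000000000080000000000000000080000000000000000200000000000000000000800000000000000004000000000000000000020000000000000000100000000000000000000800000000000000002000000000000000000010000000000000000010000000000000000000800000000000000000100000000000000000020000000000000000004000000000000000000800000000000000000100000000000000000020000000000000000004000000000000000000400000000000000000400000000000000000020000000000000000004000000000000000008000000000000000000100000000000000000020000000000000000004000000000000000004000000000000000000100000000000000000020000000000000000002000000000000000002000000000000000000100000000000000000020000000000000000004000000000000000000800000000000000000100000000000000000020000000000000000004000000000000000000800000000000000000100000000000000000020000000000000000002000000000000000002000000000000000000100000000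00000000002000000000000000000400000000000000000080000000000000000100000000000000000002000000000000000002000000000000000000080000000000000000010000000000000000002000000000000000000400000000000000000040000000000000000040000000000000000002000000000000000000400000000000000000080000000000000000010000000000000000002000000000000000000400000000000000000080000000000000000010000000000000000002000000000000000000400000000000000000080000000000000000010000000000000000001000000000000000001000000000000000000080000000000000000010000000000000000002000000000000000000400000000000000000080000000000000000010000000000000000004000000000000000000400000000000000000080000000000000000010000000000000000002000000000000000000400000000000000000080000000000000000008000000000000000000800000000000000000080000000000000000010000000000000000002000000000000000000400000000000000000080000000000000000010000000000000000002000000000000000000400000000000000000080000000000000000010000000000000000002000000000000000000400000000000000000080000000000000000010000000000000000001,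
  0x4000000000000000000000080000000000000000001000000000000000002000000000000000000080000000000000000008000000000000000010000000000000000000400000000000000000080000000000000000008000000000000000010000000000000000000400000000000000000080000000000000000010000000000000000001000000000000000002000000000000000000080000000000000000010000000000000000002000000000000000000400000000000000000040000000000000000080000000000000000002000000000000000000400000000000000000080000000000000000010000000000000000002000000000000000000200000000000002000000000000000000200000000000000000020000000000000000002000000000000000000800000000000000000080000000000000000008000000000000000000800000000000000000000400000000000000010000000000000000000002000000000000000200000000000000000000080000000000000008000000000000000000002000000000000000100000000000000000000040000000000000000080000000000000000002000000000000000080000000000000000008000000000000000000010000000000000000002000000000000000020000000000000000002000000000000000000010000000000000000001000000000000000002000000000000000000080000000000000000010000000000000000040000000000000000000400000000000000000080000000000000000010000000000000000020000000000000000000400000000000000000080000000000000000008000000000000000010000000000000000000400000000000000000080000000000000000010000000000000000400000000000000000040000000000000000004000000000000000000400000000000000000002000000000000000000400000000000000000080000000000000000008000000000000000010000000000000000000400000000000000000080000000000000000010000000000000000002000000000000000008000000000000000000080000000000000000100000000000000000002000000000000000000400000000000000000080000000000000000010000000000000000001000000000000000002000000000000000000080000000000000000010000000000000000002000000000000000000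40000000000000000008000000000000000004000000000000000000400000000000000000040000000000000000008000000000000000001000000000000000000200000000000000000040000000000000000004000000000000000000400000000000000000020000000000000000004000000000000000000800000000000000000100000000000000000020000000000000000004000000000000000001000000000000000000100000000000000000020000000000000000004000000000000000000800000000000000000100000000000000000020000000000000000002000,
  0x200000000000000000000004000000000000000000080000000000000000100000000000000000004000000000000000000400000000000000000800000000000000000020000000000000000004000000000000000000400000000000000000800000000000000000020000000000000000004000000000000000000800000000000000000080000000000000000100000000000000000004000000000000000000800000000000000000100000000000000000020000000000000000002000000000000000004000000000000003000100000000000000000020000000000000060004000000000000000000800000000000000c0010000000000000000001000000000000000002000000000000000000080000000000000000010000000000000000002000000000000000000400000000000000000080000000000000000010000000000000000001000000000000000002000000000000000090080000000000000000010000000000000001202000000000000000000400000000000000044080000000000000000010000000000000000882000000000000000000200000000000000000400000000000000000010000000000000000002000000000000000000400000000000000000080000000000000000010000000000000000002000000000000000000400000000000000000080000000000000000008000000000000000010000000000000000000400000000000000000080000000000000002210000000000000000002000000000000000060400000000000000000080000000000000000510000000000000000002000000000000000000400000000000000000040000000000000000080000000000000000002000000000000000000400000000000000000080000000000000000010000000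00000000000200000000000000000040000000000000000008000000000000000001000000000000000000200000000000000000040000000000000000004000000000000000008000000000000000000200000000000000000040000000000000000008000000000000000001000000000000000004a00000000000000000040000000000000000098000000000000000001000000000000000000200000000000000000040000000000000000008000000000000000000800000000000000000080000000000000000004000000000000000000800000000000000000100000000000000000020000000000000000004000000000000000000800000000000000000100000000000000000020000000000000000004000000000000000000800000000000000000100000000000000000020000000000000000002000,
  0x8000000000000000000000100000000000000000002000000000000000004000000000000000000100000000000000000010000000000000000020000000000000000000800000000000000000100000000000000000010000000000000000020000000000000000000800000000000000000100000000000000000020000000000000000002000000008000000000000000000800003000000000000100000000000000000010000030000000000002000000000000000000200000000000000000000000000100000000003080000000000000000000000000800000000061000018000000000000000000020000000000c0000000400000000000000000040000000010000000000000000001000000000000000000108000000400000000010800000080000000004000000000000000000400000000000000000040000000000000000004000000000000000000000000080000000000080002400000000000000000000400000000000cc0048080000000000000000010000000000030001202000000000000000000400000000000200022000000000000000000008000000000000000010000000000000000000400000000002000000000000000000398001800000000000040000000000000000004000000000000000000400000000000000000040000000000000000000000002000000000000000000200000000000000000400000000000000000010000000000000000002000000000000800009000000000000000000080000000000018000010000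00000000000000200000000000010000480000000000000000008000000000000000001000000000000000000100000000000000000200000000000000000008000000000000000001000000000000000000200000000000080000000000000000008000000000000000000800000000000000000080000000000000000000000040000000000000000008000000000000000001000000000000000000100000000000000000010000000000000000000800000000000000000100000000000000000020000000000000000004000000000001000000000000000000000000100000000000020000000000000000000000004000000000000000000800000000000000000100000000000000000020000000000000000002000,
  0x1000000000000000000000020000000000000000000400000000000000000800000000000000000020000000000000000002000000000000000004000000000000000000100000000000000000020000000000000000002000000000000000004000000000000003000100000000000000000020000000000000030004000000000000000000400000000000000000800000000000000000020000000000000000004000000000000000000800000000000000000100000000000000000010000000000000000020000000000000000000800000000000000000100000000000000003020000000000000000004000000000000000000800000000000000000080000000000000000100000000000000000004000000000000000000800000000000000000100000000000000000020000000000000000004000000000000000000800000000000000000080000000000000000100000000000000004804000000000000000000800000000000000088100000000000000000020000000000000002404000000000000000000800000000000000044100000000000000000010000000000000000020000000000000000000800000000000000000100000000000000000020000000000000000004000000000000000000800000000000000000100000000000000000020000000000000000004000000000000000000400000000000000000800000000000000000020000000000000000004000000000000000012800000000000000000100000000000000000020000000000000000004000000000000000009800000000000000000100000000000000000020000000000000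0000020000000000000000002000000000000000000100000000000000000020000000000000000004000000000000000000800000000000000000100000000000000000020000000000000000004000000000000000000800000000000000000100000000000000000020000000000000000002000,
  0x10000000000000000000000200000000000000000004000000000000000008000000000000000000200000000000000000020000000080000000000000000008000030000000000000800000000000000000080000000000000000000000000040000000000c2000000000000000000000000020000000000c000000040000000000000000004000000000000000008000000000000000000200000000000800000000000000000080000000000000000000000001000000000000000000100000000000000000200000000000000000008000000000000000001000000000000300000200000000000000000040000000000000000008000000000000000000800000000200000000000000000020000000000000000002000000000000000000200000000000000000084000000200000000008400000040000000000800000000000000000080000000000000000000000001000000000001000048000000000000000000008000000000018000901000000000000000000200000000000660024040000000000000000008000000000004000440000000000000000000100000000000000000200000000000000000008000000000002000000000000000000200000000000000000000000040000000000000000008000000000000800000000000000000080000000000000000000000040000000000000000004000000000000000000400000000000000000020000000000000000004000000000001000000000000000000000000100000000000000000020000000000000000004000000000000800000000000000000000000100000000000000000020000000000000000002000,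
  0x8000000000000000000000100000000000000000002000000000000000004000000000c00003000100000000000000000010000000000000000020000000000000000000800000000000000000100000000000000000010000000000000000020000000000600000000800000000000000000100000000006200000000000000000000000002000000000000000004000000000000000000100000000000000000020000000000000000004000000000000000000800000000000000000080000000000000000100000000003000000004000000000000000000800000000062180000000000000000000000020000000000c4000000000000000000000000040000000000000000080000000000000000002000000000000000000400000000000000000080000000000000000010000000000000000002000000000000000000400000000000000000040000000000000000080000000000084002402000000000000000000400000000000c8004800000000000000000001000000000003200120000000000000000000040000000000022002208000000000000000000800000000000000000080000000000000000004000000000000000000800000000000000000100000000000000000020000000000000000004000000000000000000800000000000000000100000000000000000020000000000000000002000,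
  0x2000000000400000000000000000040000000000000000000000000000001000000660000000000040000000000000000004000020000000000000000002300000000000000000200000000000000000020000000000000000000000000000008000000300000000000200000000000000000040000003000000000008000000000000000000800004000000000000000000460000000000000000080000000000000000008600000000000000001000000000000000000100000000000000000000000000000040000001800000000001000000000000000000200000030000000000040000000000000000008000000600000000001000000000000000000100000080000000000000000008000000000000000000800000000000000000080000000000000000020000000000000000002000000000000000000200000000000000000020000000000000000000000000000010000000400000000000000000000000000000100000008000000000000000000000000000004000000200000000000000000000000000000100000004000000000000000000000000000002000,
  0x400000000000000000000008000000000000000000100000000000000000200000000000000000008000000000000000000800000000000000001000000000000000000040000000000000000008000000000000000000800000000000000001000000000000000000040000000000000000008000000000000000001000000000000000000100000000000000000200000000000000000008000000000000000001000000000000000000200000000000000000040000000000000000004000000000000000008000000000000000000200000000000000000040000000000000000008000000000000000001000000000000000000200000000000000000020000000000000000002000000000000000000100000000000000000020000000000000000004000000000000000000800000000000000000100000000000000000020000000000000000002000,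
  0x400000000000000000000008000000000000000000100000000000000000200000000000000000008000000000000000000800000000000000001000000000000000000040000000000000000008000000000000000000800000000000000001000000000000000000040000000000000000008000000000000000001000000000000000000100000000000000000200000000000000000008000000000000000001000000000000000000200000000000000000040000000000000000004000000000000000000400000000000000000020000000000000000004000000000000000000800000000000000000100000000000000000020000000000000000002000,
  0x2000000000000000000000040000000000000000000800000000000000001000000000000000000040000000000000000004000000000000000008000000000000000000200000000000000000040000000000000000004000000000000000008000000000000000000200000000000000000040000000000000000008000000000000000000800000000000000000080000000000000000004000000000000000000800000000000000000100000000000000000020000000000000000002000,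
  0x80000000000000000000001000000000000000000020000000000000000040000000000000000001000000000000000000100000000000000000200000000000000000008000000000000000001000000000000000000100000000000000000010000000000000000000800000000000000000100000000000000000020000000000000000002000,
  0x10000000000000000000000200000000000000000004000000000000000008000000000000000000200000000000000000020000000000000000002000000000000000000100000000000000000020000000000000000002000,
  0x10000000000000000000000200000000000000000004000000000000000000400000000000000000020000000000000000002000,
  0x80000000000000000000000080000000000000000002000,
  0x4000000000000000000]

/-- The coordinates of a monomial of degree 15 in the basis `basis15`. -/
def normalForm : List ℕ → ℕ
  -- The block number counts the pairs before `(b, c)` in row `a`: each smaller `b'` has `16 - a -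
  -- b'` values of `c`, in total `b (33 - 2a - b) / 2`. The modulus is `2 ^ 75`, the size of a
  -- block.
  | [a, b, c, _] => Nat.mod (Nat.shiftRight (nth tableRows 0 a)
      (Nat.mul 75 (Nat.add (Nat.div (Nat.mul b (Nat.sub (Nat.sub 33 (Nat.mul 2 a)) b)) 2) c)))
      0x8000000000000000000
  | _ => 0

/-- The sum of `F p.2` over those `p` for which `p.1 = 0`. -/
def xorSumZero (F : List ℕ → ℕ) (L : List (ℕ × List ℕ)) : ℕ :=
  List.rec (motive := fun _ => ℕ) 0 (fun p _ s => Nat.rec (motive := fun _ => ℕ)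
    (Nat.xor s (F p.2)) (fun _ _ => s) p.1) L

/-- The table kills every square that lands in degree 15. All of `Sq^1, …, Sq^15` are tested, so no
generating set of the Steenrod algebra is needed. Squares preserve the support of a monomial, which
is why supports can be treated separately. -/
theorem normalForm_sq_check : (supports.all fun s => (List.range 15).all fun j =>
    (compositions s (Nat.sub 14 j)).all fun l =>
      Nat.beq (xorSumZero normalForm (sqTerms l (Nat.succ j))) 0) = true := by
  decide +kernel

/-- The position of a monomial of degree 15. -/
def position (l : List ℕ) : ℕ := encode 16 (l.take 3)

/-- Replaces the coordinates with respect to a list of monomials by their positions. -/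
def expand (B : List (List ℕ)) : ℕ → ℕ :=
  List.rec (motive := fun _ => ℕ → ℕ) (fun _ => 0)
    (fun l _ ih v => Nat.rec (motive := fun _ => ℕ) 0
      (fun _ _ => Nat.xor (ih (Nat.div v 2)) (Nat.mul (Nat.mod v 2) (Nat.pow 2 (position l)))) v) B

/-- The hit polynomials `Sq^j x^l` of degree 15 with given support, for `j = 1, 2, 4`. -/
def hitRows (s : List Bool) : List ℕ := [1, 2, 4].flatMap fun j =>
  (compositions s (Nat.sub 15 j)).map fun l =>
    xorSumZero (fun l => Nat.pow 2 (position l)) (sqTerms l j)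

/-- Whether the given rows reduce all monomials of degree 15 with given support to their normal
forms. -/
def reducesTo (E : List (ℕ × ℕ)) (s : List Bool) : Bool :=
  (compositions s 15).all fun l =>
    Nat.beq (reduce E (Nat.xor (Nat.pow 2 (position l)) (expand basis15 (normalForm l)))) 0

/-- The converse direction: every monomial differs from its normal form by a combination of `Sq^1`,
`Sq^2` and `Sq^4`. The square `Sq^8` would act on degree 7, where it vanishes. -/
theorem normalForm_hit_check :
    (supports.all fun s => reducesTo (gauss (hitRows s)) s) = true := by
  decide +kernel

attribute [irreducible] basis15 tableRows

/-! ### Coordinates in degree 15 -/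

theorem mono_induction {k : ℕ} (S : Submodule (ZMod 2) (P k))
    (h : ∀ l : List ℕ, l.length = k → mono k l ∈ S) (g : P k) : g ∈ S := by
  rw [g.as_sum]
  refine Submodule.sum_mem _ fun m _ => ?_
  obtain ⟨l, hl, rfl⟩ := exists_expo k m
  have h1 : (monomial (expo k l) (coeff (expo k l) g) : P k) =
      coeff (expo k l) g • mono k l := by simp [mono, smul_monomial]
  rw [h1]
  exact S.smul_mem _ (h l hl)

theorem mono_mem_PDeg {k : ℕ} {l : List ℕ} (hl : l.length = k) : mono k l ∈ PDeg k l.sum :=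
  isHomogeneous_monomial 1 (degree_expo k l hl)

theorem PDeg_induction {k d : ℕ} (S : Submodule (ZMod 2) (P k))
    (h : ∀ l : List ℕ, l.length = k → l.sum = d → mono k l ∈ S) {g : P k} (hg : g ∈ PDeg k d) :
    g ∈ S := by
  rw [← show homogeneousComponent d g = g by rw [homogeneousComponent_of_mem hg, if_pos rfl]]
  refine mono_induction (S.comap (homogeneousComponent d)) (fun l hl => ?_) g
  rw [Submodule.mem_comap, homogeneousComponent_of_mem (mono_mem_PDeg hl)]
  split_ifs with h1
  · exact h l hl h1.symm
  · exact S.zero_mem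

/-- The linear map that takes monomials of degree 15 to their coordinates in `basis15` and other
monomials to zero. -/
def coords15 : P 4 →ₗ[ZMod 2] (ℕ → ZMod 2) :=
  (basisMonomials (Fin 4) (ZMod 2)).constr (ZMod 2) fun I =>
    if I.degree = 15 then bits (normalForm [I 0, I 1, I 2, I 3]) else 0

theorem list_expo (l : List ℕ) (hl : l.length = 4) :
    [expo 4 l 0, expo 4 l 1, expo 4 l 2, expo 4 l 3] = l := by
  match l, hl with
  | [a, b, c, d], _ => rfl

theorem coords15_mono (l : List ℕ) (hl : l.length = 4) :
    coords15 (mono 4 l) = if l.sum = 15 then bits (normalForm l) else 0 := by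
  have h : mono 4 l = basisMonomials (Fin 4) (ZMod 2) (expo 4 l) := by
    rw [coe_basisMonomials, mono]
  rw [h, coords15, Module.Basis.constr_basis, degree_expo 4 l hl, list_expo l hl]

theorem coords15_eq_zero {e : ℕ} (he : e ≠ 15) {g : P 4} (hg : g ∈ PDeg 4 e) : coords15 g = 0 :=
  PDeg_induction (LinearMap.ker coords15) (fun l hl hs => by
    rw [LinearMap.mem_ker, coords15_mono l hl, if_neg (by omega)]) hg

theorem bits_xorSumZero (F : List ℕ → ℕ) (L : List (ℕ × List ℕ)) :
    bits (xorSumZero F L) = (L.map fun p => if p.1 = 0 then bits (F p.2) else 0).sum := by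
  induction L with
  | nil => exact bits_zero
  | cons p L ih =>
    rw [List.map_cons, List.sum_cons, ← ih]
    obtain ⟨n, l⟩ := p
    cases n with
    | zero =>
      rw [if_pos rfl, add_comm, ← bits_xor]
      rfl
    | succ n =>
      rw [if_neg (Nat.succ_ne_zero n), zero_add]
      rfl

/-- What is added to the exponents is taken from the budget, so their total is constant. -/
theorem sum_of_mem_sqTerms {l : List ℕ} {J : ℕ} {p : ℕ × List ℕ} (hp : p ∈ sqTerms l J) :
    p.2.sum + p.1 = l.sum + J := by
  rw [sqTerms] at hp
  induction l generalizing p J with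
  | nil => simp_all [terms_nil]
  | cons m l ih =>
    simp only [terms_cons, List.mem_flatMap] at hp
    obtain ⟨q, -, hq⟩ := hp
    cases hc : Nat.ble q J
    · simp [hc] at hq
    · simp only [hc, cond_true, List.mem_map] at hq
      obtain ⟨t, ht, rfl⟩ := hq
      have h1 : t.2.sum + t.1 = l.sum + (J - q) := ih ht
      have h2 := Nat.le_of_ble_eq_true hc
      have h3 : m.add q = m + q := rfl
      simp only [List.sum_cons, h3]
      omega

theorem Sq_mono_eq (j : ℕ) (l : List ℕ) (hl : l.length = 4) : Sq 4 j (mono 4 l) =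
    ((sqTerms l j).map fun p => if p.1 = 0 then mono 4 p.2 else 0).sum := by
  rw [Sq_mono 4 j j le_rfl l hl]
  simp only [Nat.add_eq_right]

/-- In degree 15 this is `normalForm_sq_check`; in other degrees `coords15` is zero by definition.
-/
theorem coords15_Sq (j : ℕ) (hj : 1 ≤ j) (g : P 4) : coords15 (Sq 4 j g) = 0 := by
  refine mono_induction (LinearMap.ker (coords15 ∘ₗ Sq 4 j)) (fun l hl => ?_) g
  rw [LinearMap.mem_ker, LinearMap.comp_apply]
  by_cases h : l.sum + j = 15
  · obtain ⟨i, rfl⟩ : ∃ i, j = i + 1 := ⟨j - 1, by omega⟩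
    have h1 := List.all_eq_true.1 (List.all_eq_true.1 (List.all_eq_true.1 normalForm_sq_check _
      (map_blt_mem_supports l hl)) i (List.mem_range.2 (by omega))) l (by
        have h2 := mem_compositions l
        rwa [show l.sum = Nat.sub 14 i by rw [Nat.sub_eq]; omega] at h2)
    rw [← bits_zero, ← Nat.eq_of_beq_eq_true h1, bits_xorSumZero, Sq_mono_eq _ l hl, map_list_sum,
      List.map_map]
    refine congrArg List.sum (List.map_congr_left fun p hp => ?_)
    rw [Function.comp_apply, apply_ite coords15, map_zero]
    split_ifs with h0
    · have h3 := sum_of_mem_sqTerms hp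
      rw [coords15_mono _ ((terms_spec hp).2.trans hl), if_pos (by omega)]
    · rfl
  · exact coords15_eq_zero h (Sq_mem_PDeg 4 j _ _ (mono_mem_PDeg hl))

/-- The linear combination of the monomials of a list with given coefficients. -/
def span15 : List (List ℕ) → (ℕ → ZMod 2) →ₗ[ZMod 2] P 4
  | [] => 0
  | l :: B => (LinearMap.proj 0).smulRight (mono 4 l) +
      span15 B ∘ₗ LinearMap.funLeft (ZMod 2) (ZMod 2) Nat.succ

/-- In degree 15 the first three exponents determine the fourth, so three digits in base 16 recover
the monomial. -/
theorem exists_ofPositions : ∃ D : (ℕ → ZMod 2) →ₗ[ZMod 2] P 4, ∀ l : List ℕ, l.length = 4 →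
    l.sum = 15 → D (bits (Nat.pow 2 (position l))) = mono 4 l := by
  refine ⟨combo (16 ^ 3) fun n => mono 4 (decode 16 3 n ++ [15 - (decode 16 3 n).sum]),
    fun l hl hs => ?_⟩
  match l, hl with
  | [a, b, c, d], _ =>
    simp only [List.sum_cons, List.sum_nil] at hs
    have h := decode_encode 16 [a, b, c] (by simp; omega)
    have h3 : decode 16 3 (encode 16 [a, b, c]) = [a, b, c] := by simpa using h.1
    have h4 : Nat.pow 2 (position [a, b, c, d]) = 2 ^ encode 16 [a, b, c] := rfl
    rw [h4, combo_two_pow _ _ (by simpa using h.2), h3]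
    simp only [List.sum_cons, List.sum_nil]
    rw [show 15 - (a + (b + (c + 0))) = d by omega]
    rfl

theorem expand_zero (B : List (List ℕ)) : expand B 0 = 0 := by
  cases B <;> rfl

theorem expand_nil (v : ℕ) : expand [] v = 0 := rfl

theorem expand_cons_succ (l : List ℕ) (B : List (List ℕ)) (v : ℕ) : expand (l :: B) (v + 1) =
    expand B ((v + 1) / 2) ^^^ ((v + 1) % 2 * Nat.pow 2 (position l)) := rfl

theorem span15_eq_expand (D : (ℕ → ZMod 2) →ₗ[ZMod 2] P 4)
    (hD : ∀ l : List ℕ, l.length = 4 → l.sum = 15 → D (bits (Nat.pow 2 (position l))) = mono 4 l)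
    (B : List (List ℕ)) (hB : ∀ l ∈ B, l.length = 4 ∧ l.sum = 15) (v : ℕ) :
    D (bits (expand B v)) = span15 B (bits v) := by
  induction B generalizing v with
  | nil => rw [expand_nil, bits_zero, D.map_zero, span15, LinearMap.zero_apply]
  | cons l B ih =>
    cases v with
    | zero => rw [expand_zero, bits_zero, D.map_zero, LinearMap.map_zero]
    | succ v =>
      obtain ⟨h2, h3⟩ := hB l List.mem_cons_self
      rw [expand_cons_succ, bits_xor, map_add,
        ih (fun l hl => hB l (List.mem_cons_of_mem _ hl)), span15, LinearMap.add_apply, add_comm]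
      congr 1
      · rw [LinearMap.smulRight_apply, LinearMap.proj_apply]
        have h4 : (v + 1).testBit 0 = decide ((v + 1) % 2 = 1) := Nat.testBit_zero _
        rw [show bits (v + 1) 0 = if (v + 1).testBit 0 then 1 else 0 from rfl, h4]
        rcases Nat.mod_two_eq_zero_or_one (v + 1) with h | h
        · rw [h, Nat.zero_mul, bits_zero, map_zero]
          simp
        · rw [h, Nat.one_mul, hD l h2 h3]
          simp
      · rw [LinearMap.comp_apply]
        congr 1
        funext n
        simp [bits, LinearMap.funLeft_apply, Nat.testBit_succ]

theorem basis15_spec : ∀ l ∈ basis15, l.length = 4 ∧ l.sum = 15 := by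
  have h : (basis15.all fun l => Nat.beq l.length 4 && Nat.beq l.sum 15) = true := by
    decide +kernel
  intro l hl
  have h1 := List.all_eq_true.1 h l hl
  rw [Bool.and_eq_true] at h1
  exact ⟨Nat.eq_of_beq_eq_true h1.1, Nat.eq_of_beq_eq_true h1.2⟩

theorem length_of_mem_compositions {s : List Bool} {d : ℕ} {l : List ℕ}
    (h : l ∈ compositions s d) : l.length = s.length ∧ l.sum = d := by
  fun_induction compositions s d generalizing l with
  | case1 => simp_all
  | case2 => simp_all
  | case3 s d ih =>
    obtain ⟨t, ht, rfl⟩ := List.mem_map.1 h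
    simp [ih ht]
  | case4 => simp_all
  | case5 => simp_all
  | case6 b s d ih =>
    obtain ⟨a, ha, h⟩ := List.mem_flatMap.1 h
    obtain ⟨t, ht, rfl⟩ := List.mem_map.1 h
    have h1 := ih a ht
    have h2 := List.mem_range.1 ha
    rw [Nat.sub_eq] at h1
    simp only [List.length_cons, List.sum_cons] at h1 ⊢
    omega

theorem bits_hitRow_mem (D : (ℕ → ZMod 2) →ₗ[ZMod 2] P 4)
    (hD : ∀ l : List ℕ, l.length = 4 → l.sum = 15 → D (bits (Nat.pow 2 (position l))) = mono 4 l)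
    (s : List Bool) (hs : s.length = 4) :
    ∀ v ∈ hitRows s, bits v ∈ (homHits 4 15).comap D := by
  intro v hv
  obtain ⟨j, hj, hv⟩ := List.mem_flatMap.1 hv
  obtain ⟨l, hl, rfl⟩ := List.mem_map.1 hv
  obtain ⟨h1, h2⟩ := length_of_mem_compositions hl
  have hj : 1 ≤ j ∧ j ≤ 15 := by
    simp only [List.mem_cons, List.not_mem_nil, or_false] at hj
    omega
  rw [Nat.sub_eq] at h2
  have hl4 := h1.trans hs
  have h3 : D (bits (xorSumZero (fun l => Nat.pow 2 (position l)) (sqTerms l j))) =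
      Sq 4 j (mono 4 l) := by
    rw [bits_xorSumZero, map_list_sum, List.map_map, Sq_mono_eq j l hl4]
    refine congrArg List.sum (List.map_congr_left fun p hp => ?_)
    rw [Function.comp_apply, apply_ite D, D.map_zero]
    split_ifs with h0
    · have h3 := sum_of_mem_sqTerms hp
      exact hD _ ((terms_spec hp).2.trans hl4) (by omega)
    · rfl
  rw [Submodule.mem_comap, h3]
  exact Submodule.subset_span ⟨j, l.sum, _, hj.1, by omega, mono_mem_PDeg hl4, rfl⟩

/-- With `coords15_Sq` this shows that in degree 15 hit means coordinates zero. The sum is a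
difference, as the characteristic is two. -/
theorem add_span15_coords15_mem (g : P 4) (hg : g ∈ PDeg 4 15) :
    g + span15 basis15 (coords15 g) ∈ homHits 4 15 := by
  obtain ⟨D, hD⟩ := exists_ofPositions
  refine PDeg_induction ((homHits 4 15).comap (LinearMap.id + span15 basis15 ∘ₗ coords15))
    (fun l hl hs => ?_) hg
  rw [Submodule.mem_comap, LinearMap.add_apply, LinearMap.comp_apply, LinearMap.id_apply,
    coords15_mono l hl, if_pos hs, ← span15_eq_expand D hD basis15 basis15_spec,
    ← hD l hl hs, ← map_add, ← bits_xor]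
  have h2 := mem_compositions l
  rw [hs] at h2
  have h1 := Nat.eq_of_beq_eq_true (List.all_eq_true.1 (List.all_eq_true.1 normalForm_hit_check _
    (map_blt_mem_supports l hl)) l h2)
  have h3 := reduceLin_sub_mem _ _ (mem_of_mem_gauss _ _ (bits_hitRow_mem D hD
    (l.map fun a => Nat.blt 0 a) (by simpa using hl)))
    (bits (Nat.xor (Nat.pow 2 (position l)) (expand basis15 (normalForm l))))
  rw [← bits_reduce, h1, bits_zero, zero_sub, Submodule.neg_mem_iff] at h3
  exact h3

/-! ## Rows for degree 33 -/

/-- The exponents of the variable `x_{i+1}`. -/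
def unitList (i : ℕ) : List ℕ := (List.range 4).map fun t => bif Nat.beq t i then 1 else 0

/-- The exponents of the product of the variables other than `x_{i+1}`. -/
def cofactor (i : ℕ) : List ℕ := (List.range 4).map fun t => bif Nat.beq t i then 0 else 1

/-- The coordinates of `∑ e_i ⊗ x_i x^l`. -/
def koszulRow (l : List ℕ) : ℕ := xorSum ((List.range 4).map fun i =>
  Nat.shiftLeft (normalForm (List.zipWith Nat.add (unitList i) l)) (Nat.mul 75 i))

/-- The rows from which the relations in degree 33 are computed. -/
def koszulRows : List ℕ := supports.flatMap fun s => (compositions s 14).map koszulRow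

/-- The relations between the classes of `X_i b^2`, with `X_i` the product of three variables
and `b` in `basis15`. -/
def relations33 : List (ℕ × ℕ) := gauss koszulRows

/-- The coordinates of a monomial of degree 33, before the reduction by `relations33`. -/
def row33 (l : List ℕ) : ℕ := xorSum ((List.range 4).map fun i =>
  bif l.map (fun a => Nat.mod a 2) == cofactor i then
    Nat.shiftLeft (normalForm (l.map fun a => Nat.div a 2)) (Nat.mul 75 i) else 0)

/-- The terms of the image of a monomial under the substitution `x_t ↦ x_t + x_{t+1}`, indices
modulo four. -/
def transvectionTerms : ℕ → List ℕ → List (List ℕ)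
  | 0, [a, b, c, d] => (sqChoices a).map fun q => [Nat.sub a q, Nat.add b q, c, d]
  | 1, [a, b, c, d] => (sqChoices b).map fun q => [a, Nat.sub b q, Nat.add c q, d]
  | 2, [a, b, c, d] => (sqChoices c).map fun q => [a, b, Nat.sub c q, Nat.add d q]
  | 3, [a, b, c, d] => (sqChoices d).map fun q => [Nat.add a q, b, c, Nat.sub d q]
  | _, _ => []

/-- The coordinates of the image of `X_i x^{2l}` under the substitution `x_t ↦ x_t + x_{t+1}`. -/
def transvectionRow (t i : ℕ) (l : List ℕ) : ℕ :=
  (fun y => Nat.xor (Nat.shiftLeft y (Nat.mul 75 i))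
    (bif Nat.beq i (Nat.mod (Nat.succ t) 4) then Nat.shiftLeft y (Nat.mul 75 t) else 0))
      (xorSum ((transvectionTerms t l).map normalForm))

/-- The coordinates of `v = X_i b^2`, where `b` is the `n`-th member of `basis15`, followed by those
of the differences of `v` and its images under the substitutions `x_t ↦ x_t + x_{t+1}`. -/
def invarianceRow (i n : ℕ) : ℕ :=
  (fun e => Nat.xor (reduce relations33 e) (xorSum ((List.range 4).map fun t =>
    Nat.shiftLeft (reduce relations33 (Nat.xor (transvectionRow t i (nth basis15 [] n)) e))
      (Nat.mul 300 (Nat.succ t))))) (Nat.pow 2 (Nat.add (Nat.mul 75 i) n))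

/-- The rows from which the invariants are computed. -/
def invarianceRows : List ℕ := (List.range 4).flatMap fun i =>
  (List.range 75).map fun n => invarianceRow i n

/-- The coordinates of `f`. -/
def fRow : ℕ := 0x8004220000000000

/-- Together with the next check: `f` and its images under the four transvections have the same
coordinates, so their differences are hit. -/
theorem fRow_check :
    Nat.beq (reduce relations33 (xorSum (fLists.map row33))) fRow = true := by
  decide +kernel

theorem fRow_transvection_check : ((List.range 4).all fun t =>
    Nat.beq (reduce relations33 (xorSum ((fLists.flatMap (transvectionTerms t)).map row33))) fRow) =
      true := by
  decide +kernel

/-- Pivots are leading digits, so a row with pivot below 300 has no digits in the four blocks of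
differences and represents an invariant. Every such row is that of `f`. -/
theorem invarianceRows_check :
    ((gauss invarianceRows).all fun s => Nat.ble 300 s.1 || Nat.beq s.2 fRow) = true := by
  decide +kernel

attribute [irreducible] koszulRows relations33 invarianceRows

/-! ## Squares and odd parts -/

/-- The total square is multiplicative, and squaring a polynomial in `T` in characteristic two
squares the coefficients and doubles the exponents. -/
theorem Sq_sq (k j : ℕ) (y : P k) : Sq k j (y ^ 2) = if 2 ∣ j then Sq k (j / 2) y ^ 2 else 0 := by
  rw [Sq_apply, map_pow, ← Polynomial.map_frobenius_expand, Polynomial.coeff_map,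
    Polynomial.coeff_expand two_pos]
  split_ifs
  · rfl
  · exact map_zero _

theorem prod_choose_ne_zero {k : ℕ} {I q : Fin k →₀ ℕ}
    (h : ∏ t, ((I t).choose (q t) : ZMod 2) ≠ 0) (t : Fin k) : q t ≤ I t := by
  by_contra hc
  refine h (Finset.prod_eq_zero (Finset.mem_univ t) ?_)
  rw [Nat.choose_eq_zero_of_lt (by omega), Nat.cast_zero]

/-- Instability: some `q t` must exceed its exponent. -/
theorem Sq_eq_zero {k e j : ℕ} (hj : e < j) {g : P k} (hg : g ∈ PDeg k e) : Sq k j g = 0 := by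
  refine PDeg_induction (LinearMap.ker (Sq k j)) (fun l hl hs => ?_) hg
  rw [LinearMap.mem_ker, mono, Sq_monomial]
  refine Finset.sum_eq_zero fun q hq => ?_
  by_contra hc
  have h1 := Finset.sum_le_sum fun t (_ : t ∈ Finset.univ) =>
    prod_choose_ne_zero (left_ne_zero_of_smul hc) t
  rw [(Finset.mem_finsuppAntidiag.1 hq).1, ← Finsupp.degree_eq_sum, degree_expo k l hl] at h1
  omega

/-- The linear map `y ↦ u y^2`. -/
def mulSq {k : ℕ} (u : P k) : P k →ₗ[ZMod 2] P k where
  toFun y := u * y ^ 2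
  map_add' y z := by rw [add_pow_char, mul_add]
  map_smul' c y := by
    rw [smul_pow, ZMod.pow_card c, mul_smul_comm, RingHom.id_apply]

theorem mulSq_apply {k : ℕ} (u y : P k) : mulSq u y = u * y ^ 2 := rfl

theorem Sq_self {k e : ℕ} {g : P k} (hg : g ∈ PDeg k e) : Sq k e g = g ^ 2 := by
  suffices h : g ∈ LinearMap.ker (Sq k e - mulSq 1) by
    rw [LinearMap.mem_ker, LinearMap.sub_apply, sub_eq_zero, mulSq_apply, one_mul] at h
    exact h
  refine PDeg_induction _ (fun l hl hs => ?_) hg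
  rw [LinearMap.mem_ker, LinearMap.sub_apply, sub_eq_zero, mulSq_apply, one_mul, mono, Sq_monomial,
    Finset.sum_eq_single (expo k l)]
  · rw [Finset.prod_eq_one fun t _ => by rw [Nat.choose_self, Nat.cast_one], one_smul, sq,
      monomial_mul, one_mul]
  · intro q hq hne
    by_contra hc
    have h1 := prod_choose_ne_zero (left_ne_zero_of_smul hc)
    have h2 := (Finset.mem_finsuppAntidiag.1 hq).1
    rw [← hs, ← degree_expo k l hl, Finsupp.degree_eq_sum] at h2
    refine hne (Finsupp.ext fun t => ?_)
    exact (Finset.sum_eq_sum_iff_of_le fun t _ => h1 t).1 h2 t (Finset.mem_univ t)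
  · intro hc
    refine absurd (Finset.mem_finsuppAntidiag.2 ⟨?_, Finset.subset_univ _⟩) hc
    change ∑ t, expo k l t = e
    rw [← hs, ← degree_expo k l hl, Finsupp.degree_eq_sum]

/-- By Frobenius the total square of `x_i^{2^m}` has only two terms. -/
theorem Sq_X_pow_mul (k m j : ℕ) (i : Fin k) (y : P k) : Sq k j (X i ^ 2 ^ m * y) =
    X i ^ 2 ^ m * Sq k j y + if 2 ^ m ≤ j then X i ^ 2 ^ (m + 1) * Sq k (j - 2 ^ m) y else 0 := by
  have h : sqTotal k (X i ^ 2 ^ m) = Polynomial.C (X i ^ 2 ^ m) +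
      Polynomial.C (X i ^ 2 ^ (m + 1)) * Polynomial.X ^ 2 ^ m := by
    rw [map_pow, sqTotal_X, add_pow_char_pow, mul_pow, ← Polynomial.C_pow, ← Polynomial.C_pow,
      ← pow_mul, mul_comm (Polynomial.X ^ 2 ^ m), ← pow_succ']
  rw [Sq_apply, map_mul, h, add_mul, Polynomial.coeff_add, Polynomial.coeff_C_mul, mul_assoc,
    Polynomial.coeff_C_mul, Polynomial.coeff_X_pow_mul']
  split_ifs
  · rfl
  · rw [mul_zero]
    rfl

/-- `Sq^{17-2^m}(x^{2^m} y) = x^{2^m} Sq^{17-2^m} y + x^{2^{m+1}} Sq^{17-2^{m+1}} y`, where the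
second term is absent for `m = 4`. Summed over `m = 0, …, 4` this telescopes to `x Sq^16 y = x y^2`.
-/
theorem X_mul_sq_mem_hits {k : ℕ} (i : Fin k) {y : P k} (hy : y ∈ PDeg k 16) :
    X i * y ^ 2 ∈ hits k := by
  have h : ∀ m, m ≤ 4 → Sq k (17 - 2 ^ m) (X i ^ 2 ^ m * y) ∈ hits k := fun m hm =>
    Submodule.subset_span ⟨_, _, by
      have := Nat.pow_le_pow_right two_pos hm
      omega, rfl⟩
  have h0 := h 0 (by omega)
  have h1 := h 1 (by omega)
  have h2 := h 2 (by omega)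
  have h3 := h 3 (by omega)
  have h4 := h 4 (by omega)
  rw [Sq_X_pow_mul] at h0 h1 h2 h3 h4
  norm_num at h0 h1 h2 h3 h4
  have h5 := add_mem (add_mem (add_mem (add_mem h0 h1) h2) h3) h4
  rw [← Sq_self hy]
  convert h5 using 1
  linear_combination (-1 : P k) * (X i ^ 2 * Sq k 15 y + X i ^ 4 * Sq k 13 y +
    X i ^ 8 * Sq k 9 y + X i ^ 16 * Sq k 1 y) * (CharTwo.two_eq_zero : (2 : P k) = 0)

theorem mono_mul_sq (a b c d a' b' c' d' : ℕ) : mulSq (mono 4 [a, b, c, d])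
    (mono 4 [a', b', c', d']) = mono 4 [a + 2 * a', b + 2 * b', c + 2 * c', d + 2 * d'] := by
  rw [mulSq_apply, mono_four, mono_four, mono_four]
  ring

/-- The polynomial `y_i` in the decomposition `g = ∑ x^e y_e^2`, where `x^e` runs through the
squarefree monomials, that belongs to the product of the variables other than `x_{i+1}`. -/
def comp (i : ℕ) : P 4 →ₗ[ZMod 2] P 4 :=
  (basisMonomials (Fin 4) (ZMod 2)).constr (ZMod 2) fun I =>
    if [I 0 % 2, I 1 % 2, I 2 % 2, I 3 % 2] = cofactor i then
      mono 4 [I 0 / 2, I 1 / 2, I 2 / 2, I 3 / 2] else 0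

theorem comp_mono (i a b c d : ℕ) : comp i (mono 4 [a, b, c, d]) =
    if [a % 2, b % 2, c % 2, d % 2] = cofactor i then
      mono 4 [a / 2, b / 2, c / 2, d / 2] else 0 := by
  have h : mono 4 [a, b, c, d] = basisMonomials (Fin 4) (ZMod 2) (expo 4 [a, b, c, d]) := by
    rw [coe_basisMonomials, mono]
  rw [h, comp, Module.Basis.constr_basis]
  rfl

theorem exists_four {l : List ℕ} (hl : l.length = 4) : ∃ a b c d, l = [a, b, c, d] := by
  match l, hl with
  | [a, b, c, d], _ => exact ⟨a, b, c, d, rfl⟩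

/-- Multiplying by a square does not change the odd part of a monomial. Both sides are additive in
`y`, as squaring is, so monomials suffice. -/
theorem comp_mul_sq (i : ℕ) (u y : P 4) : comp i (u * y ^ 2) = comp i u * y := by
  have h : ∀ u : P 4,
      y ∈ LinearMap.ker (comp i ∘ₗ mulSq u - LinearMap.mulLeft (ZMod 2) (comp i u)) →
      comp i (u * y ^ 2) = comp i u * y := by
    intro u h
    rwa [LinearMap.mem_ker, LinearMap.sub_apply, sub_eq_zero] at h
  suffices h2 : u ∈ LinearMap.ker (comp i ∘ₗ LinearMap.mulRight (ZMod 2) (y ^ 2) -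
      LinearMap.mulRight (ZMod 2) y ∘ₗ comp i) by
    rwa [LinearMap.mem_ker, LinearMap.sub_apply, sub_eq_zero] at h2
  refine mono_induction _ (fun l hl => ?_) u
  rw [LinearMap.mem_ker, LinearMap.sub_apply, sub_eq_zero]
  refine h _ (mono_induction _ (fun l' hl' => ?_) y)
  obtain ⟨a, b, c, d, rfl⟩ := exists_four hl
  obtain ⟨a', b', c', d', rfl⟩ := exists_four hl'
  rw [LinearMap.mem_ker, LinearMap.sub_apply, sub_eq_zero, LinearMap.comp_apply, mono_mul_sq,
    comp_mono, LinearMap.mulLeft_apply, comp_mono]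
  simp only [Nat.add_mul_mod_self_left, Nat.add_mul_div_left _ _ two_pos]
  split_ifs
  · rw [mono_four, mono_four, mono_four]
    ring
  · rw [zero_mul]

/-- The lists of four zeros and ones. -/
def binaryLists : List (List ℕ) := supports.map fun s => s.map fun b => bif b then 1 else 0

theorem map_mod_mem_binaryLists (a b c d : ℕ) : [a % 2, b % 2, c % 2, d % 2] ∈ binaryLists := by
  have h : ∀ p q r s : ℕ, p < 2 → q < 2 → r < 2 → s < 2 → [p, q, r, s] ∈ binaryLists := by
    intro p q r s hp hq hr hs
    interval_cases p <;> interval_cases q <;> interval_cases r <;> interval_cases s <;> decide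
  exact h _ _ _ _ (Nat.mod_lt _ two_pos) (Nat.mod_lt _ two_pos) (Nat.mod_lt _ two_pos)
    (Nat.mod_lt _ two_pos)

theorem sqTerms_filter_check : ∀ e ∈ binaryLists, ∀ i < 4, ∀ b < 5,
    ((sqTerms e b).filter fun p => p.1 == 0 && p.2.map (· % 2) == cofactor i).map
      (fun p => p.2.map (· / 2)) =
    if b = 0 ∧ e = cofactor i then [[0, 0, 0, 0]] else
      if b = 1 ∧ e = [1, 1, 1, 1] then [unitList i] else [] := by
  decide +kernel

theorem binaryLists_spec : ∀ e ∈ binaryLists, e.length = 4 ∧ e.sum ≤ 4 := by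
  decide +kernel

/-- `Sq^b` of a squarefree monomial is the sum over the ways to square `b` of its variables, and
this removes them from the odd part. The odd part `X_i` arises either from `X_i` itself with `b =
0`, or from the product of all variables by squaring the `i`-th. -/
theorem comp_Sq_mono {e : List ℕ} (he : e ∈ binaryLists) {i : ℕ} (hi : i < 4) (b : ℕ) :
    comp i (Sq 4 b (mono 4 e)) = if b = 0 ∧ e = cofactor i then 1 else
      if b = 1 ∧ e = [1, 1, 1, 1] then mono 4 (unitList i) else 0 := by
  obtain ⟨hl, hs⟩ := binaryLists_spec e he
  by_cases hb : b < 5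
  · have h1 := congrArg (fun L => (L.map (mono 4)).sum) (sqTerms_filter_check e he i hi b hb)
    simp only [List.map_map, sum_map_filter] at h1
    rw [Sq_mono_eq _ _ hl, map_list_sum, List.map_map]
    have h2 : mono 4 [0, 0, 0, 0] = 1 := by rw [mono_four]; simp
    refine Eq.trans (congrArg List.sum (List.map_congr_left fun p hp => ?_)) (h1.trans ?_)
    · obtain ⟨n, l⟩ := p
      obtain ⟨a, b, c, d, rfl⟩ := exists_four ((terms_spec hp).2.trans hl)
      simp only [Function.comp_apply]
      by_cases hn : n = 0
      · rw [if_pos hn, comp_mono]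
        simp [hn]
      · simp [hn]
    · split_ifs <;> simp [h2]
  · rw [Sq_eq_zero (by omega) (mono_mem_PDeg hl), map_zero, if_neg (by omega), if_neg (by omega)]

theorem comp_Sq_mulSq {e : List ℕ} {i : ℕ} (j : ℕ) (y : P 4) :
    comp i (Sq 4 j (mulSq (mono 4 e) y)) = ∑ a ∈ Finset.range (j + 1),
      comp i (Sq 4 a (mono 4 e)) * if 2 ∣ j - a then Sq 4 ((j - a) / 2) y else 0 := by
  rw [mulSq_apply, Sq_mul, Finset.Nat.sum_antidiagonal_eq_sum_range_succ
    (fun a b => Sq 4 a (mono 4 e) * Sq 4 b (y ^ 2)), map_sum]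
  refine Finset.sum_congr rfl fun a _ => ?_
  rw [Sq_sq]
  split_ifs
  · rw [comp_mul_sq]
  · rw [mul_zero, mul_zero, map_zero]

theorem comp_Sq_mulSq_of_ne {e : List ℕ} (he : e ∈ binaryLists) (h1 : e ≠ [1, 1, 1, 1]) {i : ℕ}
    (hi : i < 4) (j : ℕ) (y : P 4) : comp i (Sq 4 j (mulSq (mono 4 e) y)) =
      if e = cofactor i ∧ 2 ∣ j then Sq 4 (j / 2) y else 0 := by
  rw [comp_Sq_mulSq, Finset.sum_eq_single 0]
  · rw [comp_Sq_mono he hi, if_neg (by tauto : ¬(0 = 1 ∧ e = [1, 1, 1, 1])), Nat.sub_zero]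
    by_cases h2 : e = cofactor i <;> by_cases h3 : 2 ∣ j <;> simp [h2, h3]
  · intro a _ ha
    rw [comp_Sq_mono he hi, if_neg (by tauto), if_neg (by tauto), zero_mul]
  · simp

theorem comp_Sq_mulSq_ones {i : ℕ} (hi : i < 4) (j : ℕ) (hj : 1 ≤ j) (y : P 4) :
    comp i (Sq 4 j (mulSq (mono 4 [1, 1, 1, 1]) y)) =
      if 2 ∣ j - 1 then mono 4 (unitList i) * Sq 4 ((j - 1) / 2) y else 0 := by
  have he : [1, 1, 1, 1] ∈ binaryLists := by decide
  have hne : [1, 1, 1, 1] ≠ cofactor i := by revert i; decide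
  rw [comp_Sq_mulSq, Finset.sum_eq_single 1]
  · rw [comp_Sq_mono he hi, if_neg (by simp), if_pos (by simp)]
    split_ifs <;> simp
  · intro a _ ha
    rw [comp_Sq_mono he hi, if_neg (by tauto), if_neg (by tauto), zero_mul]
  · intro h
    exact absurd (Finset.mem_range.2 (by omega)) h

/-! ## Coordinates modulo hit polynomials in degree 33 -/

theorem mono_eq_mulSq (a b c d : ℕ) : mono 4 [a, b, c, d] =
    mulSq (mono 4 [a % 2, b % 2, c % 2, d % 2]) (mono 4 [a / 2, b / 2, c / 2, d / 2]) := by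
  simp only [mono_mul_sq, Nat.mod_add_div]

theorem mono_unitList (i : Fin 4) : mono 4 (unitList i) = X i := by
  fin_cases i
  · exact (mono_four 1 0 0 0).trans (by simp)
  · exact (mono_four 0 1 0 0).trans (by simp)
  · exact (mono_four 0 0 1 0).trans (by simp)
  · exact (mono_four 0 0 0 1).trans (by simp)

theorem binaryLists_odd : ∀ e ∈ binaryLists, e.sum % 2 = 1 →
    (∃ i < 4, e = cofactor i) ∨ ∃ i < 4, e = unitList i := by
  decide +kernel

theorem cofactor_inj : ∀ i < 4, ∀ k < 4, cofactor i = cofactor k → i = k := by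
  decide +kernel

theorem unitList_spec : ∀ i < 4, (unitList i).length = 4 ∧ (unitList i).sum = 1 := by
  decide +kernel

theorem unitList_ne_cofactor : ∀ i < 4, ∀ k < 4, unitList i ≠ cofactor k := by
  decide +kernel

theorem cofactor_spec : ∀ i < 4, cofactor i ∈ binaryLists ∧ cofactor i ≠ [1, 1, 1, 1] ∧
    (cofactor i).length = 4 ∧ (cofactor i).sum = 3 := by
  decide +kernel

/-- The terms not recovered by the four components have a single variable as odd part, so they are
hit by `X_mul_sq_mem_hits`. -/
theorem add_sum_mulSq_comp_mem {g : P 4} (hg : g ∈ PDeg 4 33) :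
    g + ∑ i ∈ Finset.range 4, mulSq (mono 4 (cofactor i)) (comp i g) ∈ hits 4 := by
  suffices h : PDeg 4 33 ≤ (hits 4).comap
      (LinearMap.id + ∑ i ∈ Finset.range 4, mulSq (mono 4 (cofactor i)) ∘ₗ comp i) by
    have h2 := h hg
    rwa [Submodule.mem_comap, LinearMap.add_apply, LinearMap.sum_apply] at h2
  refine fun g hg => PDeg_induction _ (fun l hl hs => ?_) hg
  rw [Submodule.mem_comap, LinearMap.add_apply, LinearMap.sum_apply, LinearMap.id_apply]
  simp only [LinearMap.comp_apply]
  obtain ⟨a, b, c, d, rfl⟩ := exists_four hl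
  simp only [List.sum_cons, List.sum_nil] at hs
  rcases binaryLists_odd _ (map_mod_mem_binaryLists a b c d)
    (by simp only [List.sum_cons, List.sum_nil]; omega) with ⟨i, hi, h⟩ | ⟨i, hi, h⟩
  · rw [Finset.sum_eq_single i]
    · rw [comp_mono, if_pos h, mono_eq_mulSq, h, CharTwo.add_self_eq_zero]
      exact zero_mem _
    · intro k hk hne
      rw [comp_mono, h, if_neg fun hc => hne (cofactor_inj i hi k (Finset.mem_range.1 hk) hc).symm,
        map_zero]
    · simp [hi]
  · rw [Finset.sum_eq_zero]
    · rw [add_zero, mono_eq_mulSq, h, mulSq_apply]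
      have h2 : mono 4 (unitList i) = X (⟨i, hi⟩ : Fin 4) := mono_unitList ⟨i, hi⟩
      rw [h2]
      refine X_mul_sq_mem_hits _ ?_
      have h3 : [a / 2, b / 2, c / 2, d / 2].sum = 16 := by
        have h4 : [a % 2, b % 2, c % 2, d % 2].sum = 1 := by
          rw [h]
          exact (unitList_spec i hi).2
        simp only [List.sum_cons, List.sum_nil] at h4 ⊢
        omega
      rw [← h3]
      exact mono_mem_PDeg rfl
    · intro k hk
      rw [comp_mono, h, if_neg (unitList_ne_cofactor i hi k (Finset.mem_range.1 hk)), map_zero]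

theorem comp_mem_PDeg {i : ℕ} (hi : i < 4) {g : P 4} (hg : g ∈ PDeg 4 33) :
    comp i g ∈ PDeg 4 15 := by
  refine PDeg_induction ((PDeg 4 15).comap (comp i)) (fun l hl hs => ?_) hg
  obtain ⟨a, b, c, d, rfl⟩ := exists_four hl
  simp only [List.sum_cons, List.sum_nil] at hs
  rw [Submodule.mem_comap, comp_mono]
  split_ifs with h
  · have h3 : [a / 2, b / 2, c / 2, d / 2].sum = 15 := by
      have h4 := (cofactor_spec i hi).2.2.2
      rw [← h] at h4
      simp only [List.sum_cons, List.sum_nil] at h4 ⊢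
      omega
    rw [← h3]
    exact mono_mem_PDeg rfl
  · exact zero_mem _

theorem mulSq_mem_PDeg {e : List ℕ} (he : e.length = 4) {n : ℕ} {y : P 4} (hy : y ∈ PDeg 4 n) :
    mulSq (mono 4 e) y ∈ PDeg 4 (e.sum + n * 2) :=
  (mono_mem_PDeg he).mul (IsHomogeneous.pow hy 2)

/-- The only nonzero component of `Sq^{2j}(X_i g^2)` is the `i`-th, namely `Sq^j g`. Hence this hit
polynomial agrees with `X_i (Sq^j g)^2` modulo hits. -/
theorem mulSq_cofactor_mem_hits {i : ℕ} (hi : i < 4) {h : P 4} (hh : h ∈ homHits 4 15) :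
    mulSq (mono 4 (cofactor i)) h ∈ hits 4 := by
  suffices hle : homHits 4 15 ≤ (hits 4).comap (mulSq (mono 4 (cofactor i))) from hle hh
  refine Submodule.span_le.2 ?_
  rintro _ ⟨j, e, g, hj, he, hg, rfl⟩
  obtain ⟨h1, h2, h3, h4⟩ := cofactor_spec i hi
  have hm := Sq_mem_PDeg 4 (2 * j) _ _ (mulSq_mem_PDeg h3 hg)
  rw [h4, show 3 + e * 2 + 2 * j = 33 by omega] at hm
  have h5 := add_sum_mulSq_comp_mem hm
  rw [Finset.sum_eq_single i] at h5
  · rw [comp_Sq_mulSq_of_ne h1 h2 hi, if_pos ⟨rfl, dvd_mul_right 2 j⟩,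
      Nat.mul_div_cancel_left j two_pos] at h5
    exact ((hits 4).add_mem_iff_right (Submodule.subset_span ⟨2 * j, _, by omega, rfl⟩)).1 h5
  · intro k hk hne
    have hk := Finset.mem_range.1 hk
    rw [comp_Sq_mulSq_of_ne h1 h2 hk, if_neg fun hc => hne (cofactor_inj i hi k hk hc.1).symm,
      map_zero]
  · simp [hi]

/-- The shift by `n` places. -/
def shiftLin (n : ℕ) : (ℕ → ZMod 2) →ₗ[ZMod 2] (ℕ → ZMod 2) where
  toFun v m := if n ≤ m then v (m - n) else 0
  map_add' v w := by
    funext m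
    simp only [Pi.add_apply]
    split_ifs <;> simp
  map_smul' c v := by
    funext m
    simp only [Pi.smul_apply, RingHom.id_apply]
    split_ifs <;> simp

theorem shiftLin_apply (n : ℕ) (v : ℕ → ZMod 2) (m : ℕ) :
    shiftLin n v m = if n ≤ m then v (m - n) else 0 := rfl

theorem bits_shiftLeft (v n : ℕ) : bits (Nat.shiftLeft v n) = shiftLin n (bits v) := by
  funext m
  change (if (v <<< n).testBit m then (1 : ZMod 2) else 0) = _
  rw [Nat.testBit_shiftLeft, shiftLin_apply, bits]
  by_cases h : n ≤ m <;> simp [h]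

theorem normalForm_lt (l : List ℕ) : normalForm l < 2 ^ 75 := by
  unfold normalForm
  split
  · exact Nat.mod_lt _ (by norm_num)
  · norm_num

/-- Ensures that the four blocks of 75 coordinates do not overlap. -/
theorem coords15_eq_zero_of_le (g : P 4) {n : ℕ} (hn : 75 ≤ n) : coords15 g n = 0 := by
  refine mono_induction (LinearMap.ker (LinearMap.proj n ∘ₗ coords15)) (fun l hl => ?_) g
  rw [LinearMap.mem_ker, LinearMap.comp_apply, LinearMap.proj_apply, coords15_mono l hl]
  have h := normalForm_lt l
  generalize normalForm l = v at h
  split_ifs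
  · rw [bits, Nat.testBit_lt_two_pow (h.trans_le (Nat.pow_le_pow_right two_pos hn))]
    rfl
  · rfl

/-- The coordinates of the polynomials `comp i g`. -/
def coordsComp : P 4 →ₗ[ZMod 2] (ℕ → ZMod 2) :=
  ∑ i ∈ Finset.range 4, shiftLin (75 * i) ∘ₗ coords15 ∘ₗ comp i

theorem coordsComp_apply (g : P 4) : coordsComp g =
    ∑ i ∈ Finset.range 4, shiftLin (75 * i) (coords15 (comp i g)) := by
  rw [coordsComp, LinearMap.sum_apply]
  rfl

theorem coordsComp_add {g : P 4} {i n : ℕ} (hi : i < 4) (hn : n < 75) :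
    coordsComp g (75 * i + n) = coords15 (comp i g) n := by
  rw [coordsComp_apply, Finset.sum_apply, Finset.sum_eq_single i]
  · rw [shiftLin_apply, if_pos (by omega), Nat.add_sub_cancel_left]
  · intro k _ hk
    rw [shiftLin_apply]
    split_ifs with h
    · exact coords15_eq_zero_of_le _ (by omega)
    · rfl
  · simp [hi]

theorem coordsComp_of_le {g : P 4} {n : ℕ} (hn : 300 ≤ n) : coordsComp g n = 0 := by
  rw [coordsComp_apply, Finset.sum_apply]
  refine Finset.sum_eq_zero fun k hk => ?_
  have := Finset.mem_range.1 hk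
  rw [shiftLin_apply, if_pos (by omega)]
  exact coords15_eq_zero_of_le _ (by omega)

theorem coordsComp_mono {l : List ℕ} (hl : l.length = 4) (hs : l.sum = 33) :
    coordsComp (mono 4 l) = bits (row33 l) := by
  rw [coordsComp_apply, row33, bits_xorSum, List.map_map, sum_map_range]
  refine Finset.sum_congr rfl fun i hi => ?_
  have hi := Finset.mem_range.1 hi
  obtain ⟨a, b, c, d, rfl⟩ := exists_four hl
  simp only [List.sum_cons, List.sum_nil] at hs
  rw [comp_mono, Function.comp_apply]
  have h0 : ([a, b, c, d].map fun a => Nat.mod a 2) = [a % 2, b % 2, c % 2, d % 2] := rfl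
  have h1 : ([a, b, c, d].map fun a => Nat.div a 2) = [a / 2, b / 2, c / 2, d / 2] := rfl
  rw [h0, h1]
  by_cases h : [a % 2, b % 2, c % 2, d % 2] = cofactor i
  · have h3 : [a / 2, b / 2, c / 2, d / 2].sum = 15 := by
      have h4 := (cofactor_spec i hi).2.2.2
      rw [← h] at h4
      simp only [List.sum_cons, List.sum_nil] at h4 ⊢
      omega
    rw [if_pos h, coords15_mono _ rfl, if_pos h3, beq_iff_eq.2 h, cond_true, bits_shiftLeft]
    rfl
  · rw [if_neg h, beq_eq_false_iff_ne.2 h, cond_false, bits_zero, map_zero, map_zero]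

/-- The right inverse of `coordsComp` modulo hit polynomials. -/
def span33 : (ℕ → ZMod 2) →ₗ[ZMod 2] P 4 :=
  ∑ i ∈ Finset.range 4, mulSq (mono 4 (cofactor i)) ∘ₗ span15 basis15 ∘ₗ
    LinearMap.funLeft (ZMod 2) (ZMod 2) (75 * i + ·)

theorem span15_congr (B : List (List ℕ)) {v w : ℕ → ZMod 2} (h : ∀ n < B.length, v n = w n) :
    span15 B v = span15 B w := by
  induction B generalizing v w with
  | nil => rfl
  | cons l B ih =>
    rw [span15, LinearMap.add_apply, LinearMap.add_apply, LinearMap.smulRight_apply,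
      LinearMap.smulRight_apply, LinearMap.proj_apply, LinearMap.proj_apply,
      h 0 (Nat.succ_pos _), LinearMap.comp_apply, LinearMap.comp_apply]
    congr 1
    exact ih fun n hn => h (n + 1) (Nat.succ_lt_succ hn)

theorem length_basis15 : basis15.length = 75 := by decide +kernel

/-- The classes of `X_i b^2`, with `b` in `basis15`, span the quotient in degree 33: reduce to
components, then reduce each component in degree 15. -/
theorem add_span33_coordsComp_mem {g : P 4} (hg : g ∈ PDeg 4 33) :
    g + span33 (coordsComp g) ∈ hits 4 := by
  have h1 := add_sum_mulSq_comp_mem hg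
  have h2 : ∑ i ∈ Finset.range 4, mulSq (mono 4 (cofactor i))
      (comp i g + span15 basis15 (coords15 (comp i g))) ∈ hits 4 :=
    Submodule.sum_mem _ fun i hi => mulSq_cofactor_mem_hits (Finset.mem_range.1 hi)
      (add_span15_coords15_mem _ (comp_mem_PDeg (Finset.mem_range.1 hi) hg))
  have h3 : span33 (coordsComp g) = ∑ i ∈ Finset.range 4, mulSq (mono 4 (cofactor i))
      (span15 basis15 (coords15 (comp i g))) := by
    rw [span33, LinearMap.sum_apply]
    refine Finset.sum_congr rfl fun i hi => ?_
    rw [LinearMap.comp_apply, LinearMap.comp_apply]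
    congr 1
    refine span15_congr _ fun n hn => ?_
    rw [length_basis15] at hn
    exact coordsComp_add (Finset.mem_range.1 hi) hn
  have h4 := add_mem h1 h2
  simp only [map_add, Finset.sum_add_distrib] at h4
  rwa [← h3, add_assoc, ← add_assoc (∑ i ∈ Finset.range 4, _), CharTwo.add_self_eq_zero,
    zero_add] at h4

/-- The map `w ↦ ∑ e_i ⊗ x_i w` in coordinates. -/
def koszul : P 4 →ₗ[ZMod 2] (ℕ → ZMod 2) :=
  ∑ i ∈ Finset.range 4, shiftLin (75 * i) ∘ₗ coords15 ∘ₗ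
    LinearMap.mulLeft (ZMod 2) (mono 4 (unitList i))

theorem koszul_apply (w : P 4) : koszul w =
    ∑ i ∈ Finset.range 4, shiftLin (75 * i) (coords15 (mono 4 (unitList i) * w)) := by
  rw [koszul, LinearMap.sum_apply]
  rfl

theorem mono_mul_mono {l l' : List ℕ} (hl : l.length = 4) (hl' : l'.length = 4) :
    mono 4 l * mono 4 l' = mono 4 (List.zipWith Nat.add l l') := by
  obtain ⟨a, b, c, d, rfl⟩ := exists_four hl
  obtain ⟨a', b', c', d', rfl⟩ := exists_four hl'
  refine Eq.trans ?_ (mono_four (a + a') (b + b') (c + c') (d + d')).symm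
  rw [mono_four, mono_four]
  ring

theorem koszul_mono {l : List ℕ} (hl : l.length = 4) :
    koszul (mono 4 l) = if l.sum = 14 then bits (koszulRow l) else 0 := by
  rw [koszul_apply]
  split_ifs with hs
  · rw [koszulRow, bits_xorSum, List.map_map, sum_map_range]
    refine Finset.sum_congr rfl fun i hi => ?_
    obtain ⟨h1, h2⟩ := unitList_spec i (Finset.mem_range.1 hi)
    have h3 : (List.zipWith Nat.add (unitList i) l).length = 4 := by simp [h1, hl]
    have h4 : (List.zipWith Nat.add (unitList i) l).sum = 15 := by
      obtain ⟨a, b, c, d, rfl⟩ := exists_four hl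
      obtain ⟨a', b', c', d', h5⟩ := exists_four h1
      rw [h5] at h2 ⊢
      simp only [List.zipWith_cons_cons, List.zipWith_nil_left, List.sum_cons, List.sum_nil,
        Nat.add_eq] at h2 hs ⊢
      omega
    rw [mono_mul_mono h1 hl, coords15_mono _ h3, if_pos h4, Function.comp_apply, bits_shiftLeft]
    rfl
  · refine Finset.sum_eq_zero fun i hi => ?_
    obtain ⟨h1, h2⟩ := unitList_spec i (Finset.mem_range.1 hi)
    rw [coords15_eq_zero (e := (unitList i).sum + l.sum) (by omega)
      ((mono_mem_PDeg h1).mul (mono_mem_PDeg hl)), map_zero]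

theorem mem_koszulRows {v : ℕ} : v ∈ koszulRows ↔
    ∃ l : List ℕ, (l.length = 4 ∧ l.sum = 14) ∧ koszulRow l = v := by
  rw [koszulRows, List.mem_flatMap]
  constructor
  · rintro ⟨s, hs, hv⟩
    obtain ⟨l, hl, rfl⟩ := List.mem_map.1 hv
    have h1 : ∀ s ∈ supports, s.length = 4 := by decide
    have h2 := length_of_mem_compositions hl
    exact ⟨l, ⟨h2.1.trans (h1 s hs), h2.2⟩, rfl⟩
  · rintro ⟨l, ⟨hl, hs⟩, rfl⟩
    refine ⟨_, map_blt_mem_supports l hl, List.mem_map_of_mem ?_⟩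
    rw [← hs]
    exact mem_compositions l

/-- The rows cover all monomials `w` of degree 14; in other degrees `koszul w` is zero already. -/
theorem reduceLin_koszul (w : P 4) : reduceLin relations33 (koszul w) = 0 := by
  refine mono_induction (LinearMap.ker (reduceLin relations33 ∘ₗ koszul)) (fun l hl => ?_) w
  rw [LinearMap.mem_ker, LinearMap.comp_apply, koszul_mono hl]
  split_ifs with hs
  · have h := reduce_gauss koszulRows _ (mem_koszulRows.2 ⟨l, ⟨hl, hs⟩, rfl⟩)
    rw [← bits_reduce, relations33, h, bits_zero]
  · exact LinearMap.map_zero _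

/-- The coordinates of polynomials of degree 33 modulo hit polynomials. -/
def coords33 : P 4 →ₗ[ZMod 2] (ℕ → ZMod 2) := reduceLin relations33 ∘ₗ coordsComp

theorem coords33_apply (g : P 4) : coords33 g = reduceLin relations33 (coordsComp g) := rfl

/-- Split off the odd part `e` of a monomial. For `e ≠ [1, 1, 1, 1]` each component of the square is
zero or a square of positive degree, killed by `coords15`. For `e = [1, 1, 1, 1]` the components all
vanish or are `x_i w` with a common `w`, a relation removed by `relations33`. -/
theorem coords33_Sq (j : ℕ) (hj : 1 ≤ j) (g : P 4) : coords33 (Sq 4 j g) = 0 := by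
  refine mono_induction (LinearMap.ker (coords33 ∘ₗ Sq 4 j)) (fun l hl => ?_) g
  obtain ⟨a, b, c, d, rfl⟩ := exists_four hl
  rw [LinearMap.mem_ker, LinearMap.comp_apply, mono_eq_mulSq, coords33_apply]
  have he := map_mod_mem_binaryLists a b c d
  generalize [a % 2, b % 2, c % 2, d % 2] = e at he
  generalize mono 4 [a / 2, b / 2, c / 2, d / 2] = y
  by_cases h1 : e = [1, 1, 1, 1]
  · subst h1
    by_cases h2 : 2 ∣ j - 1
    · rw [← reduceLin_koszul (Sq 4 ((j - 1) / 2) y), koszul_apply, coordsComp_apply]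
      congr 1
      refine Finset.sum_congr rfl fun i hi => ?_
      rw [comp_Sq_mulSq_ones (Finset.mem_range.1 hi) j hj, if_pos h2]
    · rw [coordsComp_apply, Finset.sum_eq_zero, LinearMap.map_zero]
      intro i hi
      rw [comp_Sq_mulSq_ones (Finset.mem_range.1 hi) j hj, if_neg h2, map_zero, map_zero]
  · rw [coordsComp_apply, Finset.sum_eq_zero, LinearMap.map_zero]
    intro i hi
    rw [comp_Sq_mulSq_of_ne he h1 (Finset.mem_range.1 hi)]
    split_ifs with h2
    · rw [coords15_Sq _ (by omega), map_zero]
    · rw [map_zero, map_zero]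

theorem coords33_eq_zero_of_mem_hits {g : P 4} (hg : g ∈ hits 4) : coords33 g = 0 := by
  suffices h : hits 4 ≤ LinearMap.ker coords33 from h hg
  refine Submodule.span_le.2 ?_
  rintro _ ⟨j, g, hj, rfl⟩
  exact coords33_Sq j hj g

theorem Sq_zero_apply (k : ℕ) (g : P k) : Sq k 0 g = g := by
  have h : g ∈ LinearMap.ker (Sq k 0 - LinearMap.id) := mono_induction _ (fun l _ => by
    rw [LinearMap.mem_ker, LinearMap.sub_apply, mono, Sq_monomial]
    simp) g
  exact sub_eq_zero.1 h

/-- The relations do hold modulo hits: `Sq^1(x_1 x_2 x_3 x_4 w^2)` has the components `x_i w`. -/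
theorem span33_koszulRow_mem : ∀ v ∈ koszulRows, bits v ∈ (hits 4).comap span33 := by
  intro v hv
  obtain ⟨l, ⟨hl, hs⟩, rfl⟩ := mem_koszulRows.1 hv
  have hm := Sq_mem_PDeg 4 1 _ _
    (mulSq_mem_PDeg (e := [1, 1, 1, 1]) rfl (hs ▸ mono_mem_PDeg hl : mono 4 l ∈ PDeg 4 14))
  have h1 := add_span33_coordsComp_mem hm
  have h2 : coordsComp (Sq 4 1 (mulSq (mono 4 [1, 1, 1, 1]) (mono 4 l))) = bits (koszulRow l) := by
    rw [← (koszul_mono hl).trans (if_pos hs), koszul_apply, coordsComp_apply]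
    refine Finset.sum_congr rfl fun i hi => ?_
    rw [comp_Sq_mulSq_ones (Finset.mem_range.1 hi) 1 le_rfl, if_pos (by simp)]
    congr 3
    exact Sq_zero_apply 4 _
  rw [h2] at h1
  exact ((hits 4).add_mem_iff_right (Submodule.subset_span ⟨1, _, le_rfl, rfl⟩)).1 h1

theorem add_span33_coords33_mem {g : P 4} (hg : g ∈ PDeg 4 33) :
    g + span33 (coords33 g) ∈ hits 4 := by
  have h0 : ∀ s ∈ relations33, bits s.2 ∈ (hits 4).comap span33 := by
    rw [relations33]
    exact mem_of_mem_gauss _ _ span33_koszulRow_mem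
  have h1 := reduceLin_sub_mem _ _ h0 (coordsComp g)
  rw [← coords33_apply, Submodule.mem_comap, LinearMap.map_sub] at h1
  have h2 := add_mem (add_span33_coordsComp_mem hg) h1
  rwa [add_assoc, add_sub_cancel] at h2

theorem mem_hits_of_coords33 {g : P 4} (hg : g ∈ PDeg 4 33) (h : coords33 g = 0) : g ∈ hits 4 := by
  have h1 := add_span33_coords33_mem hg
  rwa [h, LinearMap.map_zero, add_zero] at h1

/-! ## Invariants in degree 33 -/

/-- The transvection `x_t ↦ x_t + x_{t+1}`, indices modulo four. -/
def cyclicTransvection (t : Fin 4) : G 4 where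
  -- Column `t` holds the coefficients of the image of `x_t`, hence the order of the indices. In
  -- characteristic two a transvection is its own inverse.
  val := Matrix.transvection (t + 1) t 1
  inv := Matrix.transvection (t + 1) t 1
  val_inv := by revert t; decide +kernel
  inv_val := by revert t; decide +kernel

theorem subst_cyclicTransvection_X (t j : Fin 4) : subst 4 (cyclicTransvection t) (X j) =
    if j = t then X t + X (t + 1) else X j := by
  have h : ∀ t : Fin 4, Matrix.transvection (t + 1) t (1 : ZMod 2) =
      Matrix.of fun i j => if i = j ∨ i = t + 1 ∧ j = t then 1 else 0 := by decide +kernel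
  have h1 : ∀ i : Fin 4, (cyclicTransvection t).val i j =
      if i = j ∨ i = t + 1 ∧ j = t then 1 else 0 := fun i => congrFun (congrFun (h t) i) j
  rw [subst_X]
  simp only [h1]
  revert t j
  intro t j _
  fin_cases t <;> fin_cases j <;> simp [Fin.sum_univ_four, add_comm]

theorem add_pow_eq_sum_sqChoices (u w : P 4) (a : ℕ) :
    (u + w) ^ a = ((sqChoices a).map fun q => u ^ (a - q) * w ^ q).sum := by
  have hc : sqChoices a = choices oddChoose a := nth_map_range _ _ _
  rw [hc, choices, sum_map_filter, sum_map_range, add_comm, add_pow]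
  refine Finset.sum_congr rfl fun q _ => ?_
  have h : ((a.choose q : ℕ) : P 4) = C (a.choose q : ZMod 2) := (map_natCast C _).symm
  rw [h, oddChoose_eq]
  split_ifs
  · rw [C_1]; ring
  · rw [C_0, mul_zero]

theorem subst_cyclicTransvection_mono (t : Fin 4) {l : List ℕ} (hl : l.length = 4) :
    subst 4 (cyclicTransvection t) (mono 4 l) = ((transvectionTerms t l).map (mono 4)).sum := by
  obtain ⟨a, b, c, d, rfl⟩ := exists_four hl
  simp only [mono_four, map_mul, map_pow, subst_cyclicTransvection_X]
  fin_cases t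
  · change (X 0 + X 1) ^ a * X 1 ^ b * X 2 ^ c * X 3 ^ d = (((sqChoices a).map fun q =>
      [Nat.sub a q, Nat.add b q, c, d]).map (mono 4)).sum
    rw [add_pow_eq_sum_sqChoices, mul_assoc, mul_assoc, ← List.sum_map_mul_right, List.map_map]
    refine congrArg List.sum (List.map_congr_left fun q _ => ?_)
    rw [Function.comp_apply, mono_four, Nat.sub_eq, Nat.add_eq]
    ring
  · change X 0 ^ a * (X 1 + X 2) ^ b * X 2 ^ c * X 3 ^ d = (((sqChoices b).map fun q =>
      [a, Nat.sub b q, Nat.add c q, d]).map (mono 4)).sum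
    rw [add_pow_eq_sum_sqChoices, mul_comm (X 0 ^ a), mul_assoc, mul_assoc,
      ← List.sum_map_mul_right, List.map_map]
    refine congrArg List.sum (List.map_congr_left fun q _ => ?_)
    rw [Function.comp_apply, mono_four, Nat.sub_eq, Nat.add_eq]
    ring
  · change X 0 ^ a * X 1 ^ b * (X 2 + X 3) ^ c * X 3 ^ d = (((sqChoices c).map fun q =>
      [a, b, Nat.sub c q, Nat.add d q]).map (mono 4)).sum
    rw [add_pow_eq_sum_sqChoices, mul_comm (X 0 ^ a * X 1 ^ b), mul_assoc,
      ← List.sum_map_mul_right, List.map_map]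
    refine congrArg List.sum (List.map_congr_left fun q _ => ?_)
    rw [Function.comp_apply, mono_four, Nat.sub_eq, Nat.add_eq]
    ring
  · change X 0 ^ a * X 1 ^ b * X 2 ^ c * (X 3 + X 0) ^ d = (((sqChoices d).map fun q =>
      [Nat.add a q, b, c, Nat.sub d q]).map (mono 4)).sum
    rw [add_pow_eq_sum_sqChoices, ← List.sum_map_mul_left, List.map_map]
    refine congrArg List.sum (List.map_congr_left fun q _ => ?_)
    rw [Function.comp_apply, mono_four, Nat.sub_eq, Nat.add_eq]
    ring

theorem le_of_mem_sqChoices {a q : ℕ} (h : q ∈ sqChoices a) : q ≤ a := by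
  have hc : sqChoices a = choices oddChoose a := nth_map_range _ _ _
  rw [hc, choices] at h
  have := List.mem_range.1 (List.mem_filter.1 h).1
  omega

theorem transvectionTerms_spec (t : Fin 4) {l : List ℕ} (hl : l.length = 4) :
    ∀ l' ∈ transvectionTerms t l, l'.length = 4 ∧ l'.sum = l.sum := by
  obtain ⟨a, b, c, d, rfl⟩ := exists_four hl
  intro l' hl'
  fin_cases t
  all_goals
    obtain ⟨q, hq, rfl⟩ := List.mem_map.1 hl'
    have := le_of_mem_sqChoices hq
    refine ⟨rfl, ?_⟩
    simp only [List.sum_cons, List.sum_nil, Nat.add_eq, Nat.sub_eq]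
    omega

theorem transvectionTerms_filter_check : ∀ t < 4, ∀ i < 4, ∀ k < 4,
    ((transvectionTerms t (cofactor i)).filter fun l => l.map (· % 2) == cofactor k).map
      (fun l => l.map (· / 2)) =
    if k = i ∨ i = (t + 1) % 4 ∧ k = t then [[0, 0, 0, 0]] else [] := by
  decide +kernel

/-- `X_t` lacks `x_t` and is fixed; `X_{t+1}` becomes `X_{t+1} + X_t`; any other `X_i` gains a term
divisible by `x_{t+1}^2`, whose odd part has only one variable. -/
theorem comp_subst_cofactor (t : Fin 4) {i k : ℕ} (hi : i < 4) (hk : k < 4) :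
    comp k (subst 4 (cyclicTransvection t) (mono 4 (cofactor i))) =
      if k = i ∨ i = (t + 1 : ℕ) % 4 ∧ k = t then 1 else 0 := by
  have hl := (cofactor_spec i hi).2.2.1
  have h1 := congrArg (fun L => (L.map (mono 4)).sum)
    (transvectionTerms_filter_check t t.2 i hi k hk)
  simp only [List.map_map, sum_map_filter] at h1
  rw [subst_cyclicTransvection_mono t hl, map_list_sum, List.map_map]
  have h2 : mono 4 [0, 0, 0, 0] = 1 := by rw [mono_four]; simp
  refine Eq.trans (congrArg List.sum (List.map_congr_left fun l hl' => ?_)) (h1.trans ?_)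
  · obtain ⟨a, b, c, d, rfl⟩ := exists_four (transvectionTerms_spec t hl l hl').1
    simp only [Function.comp_apply]
    rw [comp_mono]
    simp
  · split_ifs <;> simp [h2]

/-- Substitution is multiplicative and `comp` is linear over squares, so the components of the image
are those of the image of `X_i` times the image of the monomial `l`. -/
theorem coordsComp_subst_mulSq (t : Fin 4) {i : ℕ} (hi : i < 4) {l : List ℕ} (hl : l.length = 4)
    (hs : l.sum = 15) :
    coordsComp (subst 4 (cyclicTransvection t) (mulSq (mono 4 (cofactor i)) (mono 4 l))) =
      bits (transvectionRow t i l) := by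
  have h1 : coords15 (subst 4 (cyclicTransvection t) (mono 4 l)) =
      bits (xorSum ((transvectionTerms t l).map normalForm)) := by
    rw [subst_cyclicTransvection_mono t hl, bits_xorSum, map_list_sum, List.map_map, List.map_map]
    refine congrArg List.sum (List.map_congr_left fun l' hl' => ?_)
    obtain ⟨h2, h3⟩ := transvectionTerms_spec t hl l' hl'
    rw [Function.comp_apply, coords15_mono l' h2, if_pos (h3.trans hs)]
    rfl
  have h2 : bits (transvectionRow t i l) = shiftLin (75 * i)
      (bits (xorSum ((transvectionTerms t l).map normalForm))) + if i = (t + 1 : ℕ) % 4 then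
        shiftLin (75 * t) (bits (xorSum ((transvectionTerms t l).map normalForm))) else 0 := by
    unfold transvectionRow
    generalize xorSum ((transvectionTerms t l).map normalForm) = y
    have h3 := bits_xor (Nat.shiftLeft y (Nat.mul 75 i))
      (bif Nat.beq i (Nat.mod (Nat.succ t) 4) then Nat.shiftLeft y (Nat.mul 75 t) else 0)
    refine h3.trans ?_
    rw [bits_shiftLeft]
    congr 1
    by_cases h4 : i = (t + 1 : ℕ) % 4
    · have h5 : Nat.beq i (Nat.mod (Nat.succ t) 4) = true := by
        rw [Nat.beq_eq]
        exact h4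
      rw [if_pos h4, h5, cond_true, bits_shiftLeft]
      rfl
    · have h5 : Nat.beq i (Nat.mod (Nat.succ t) 4) = false := by
        rw [← Bool.not_eq_true]
        exact fun h => h4 (Nat.eq_of_beq_eq_true h)
      rw [if_neg h4, h5, cond_false, bits_zero]
  rw [h2, ← h1, coordsComp_apply]
  have h3 : ∀ k ∈ Finset.range 4,
      shiftLin (75 * k) (coords15 (comp k (subst 4 (cyclicTransvection t)
        (mulSq (mono 4 (cofactor i)) (mono 4 l))))) =
      (if k = i then shiftLin (75 * i) (coords15 (subst 4 (cyclicTransvection t) (mono 4 l)))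
        else 0) + if k = t then (if i = (t + 1 : ℕ) % 4 then
          shiftLin (75 * t) (coords15 (subst 4 (cyclicTransvection t) (mono 4 l))) else 0)
        else 0 := by
    intro k hk
    rw [mulSq_apply, map_mul, map_pow, comp_mul_sq,
      comp_subst_cofactor t hi (Finset.mem_range.1 hk)]
    generalize subst 4 (cyclicTransvection t) (mono 4 l) = y
    have ht := t.2
    by_cases hki : k = i
    · subst hki
      by_cases hkt : k = t
      · rw [if_neg (show ¬k = (t + 1 : ℕ) % 4 by omega)]
        simp
      · simp [hkt]
    · by_cases hkt : k = t
      · subst hkt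
        by_cases h : i = (t + 1 : ℕ) % 4
        · rw [if_pos (Or.inr ⟨h, rfl⟩), one_mul, if_neg hki, if_pos rfl, if_pos h, zero_add]
        · rw [if_neg (by tauto), zero_mul, if_neg hki, if_pos rfl, if_neg h, map_zero, map_zero,
            zero_add]
      · rw [if_neg (by tauto), zero_mul, if_neg hki, if_neg hkt, map_zero, map_zero, zero_add]
  rw [Finset.sum_congr rfl h3, Finset.sum_add_distrib, Finset.sum_ite_eq', Finset.sum_ite_eq',
    if_pos (Finset.mem_range.2 hi), if_pos (Finset.mem_range.2 t.2)]

theorem coords33_sum_mono (L : List (List ℕ)) (hL : ∀ l ∈ L, l.length = 4 ∧ l.sum = 33) :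
    coords33 (L.map (mono 4)).sum = bits (reduce relations33 (xorSum (L.map row33))) := by
  rw [bits_reduce, coords33_apply, bits_xorSum, map_list_sum, List.map_map, List.map_map]
  congr 2
  exact List.map_congr_left fun l hl => coordsComp_mono (hL l hl).1 (hL l hl).2

theorem fLists_spec : ∀ l ∈ fLists, l.length = 4 ∧ l.sum = 33 := by
  decide +kernel

theorem coords33_f : coords33 f = bits fRow := by
  rw [f_eq]
  exact (coords33_sum_mono fLists fLists_spec).trans
    (congrArg bits (Nat.eq_of_beq_eq_true fRow_check))

theorem coords33_subst_f (t : Fin 4) :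
    coords33 (subst 4 (cyclicTransvection t) f) = bits fRow := by
  have hc := List.all_eq_true.1 fRow_transvection_check t (List.mem_range.2 t.2)
  have h1 : subst 4 (cyclicTransvection t) f =
      ((fLists.flatMap (transvectionTerms t)).map (mono 4)).sum := by
    rw [f_eq, sum_map_flatMap, map_list_sum, List.map_map]
    exact congrArg List.sum (List.map_congr_left fun l hl =>
      subst_cyclicTransvection_mono t (fLists_spec l hl).1)
  rw [h1]
  refine (coords33_sum_mono _ fun l' hl' => ?_).trans
    (congrArg bits (Nat.eq_of_beq_eq_true hc))
  obtain ⟨l, hl, hl'⟩ := List.mem_flatMap.1 hl'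
  obtain ⟨h2, h3⟩ := transvectionTerms_spec t (fLists_spec l hl).1 l' hl'
  exact ⟨h2, h3.trans (fLists_spec l hl).2⟩

theorem subst_cyclicTransvection_f (t : Fin 4) :
    subst 4 (cyclicTransvection t) f - f ∈ hits 4 := by
  refine mem_hits_of_coords33 (sub_mem (subst_mem_PDeg 4 33 _ f f_mem) f_mem) ?_
  rw [LinearMap.map_sub, coords33_subst_f, coords33_f, sub_self]

/-- The matrices that fix `[f]` are closed under products, and the cyclic transvections generate all
of `GL_4(F_2)`. -/
theorem subst_f_sub_mem (g : G 4) : subst 4 g f - f ∈ hits 4 := by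
  let Q : Matrix (Fin 4) (Fin 4) (ZMod 2) → Prop := fun M =>
    ∃ g : G 4, g.val = M ∧ subst 4 g f - f ∈ hits 4
  have hmul : ∀ {A B}, Q A → Q B → Q (A * B) := by
    rintro _ _ ⟨g, rfl, hg⟩ ⟨h, rfl, hh⟩
    refine ⟨g * h, rfl, ?_⟩
    have h1 := add_mem (subst_mem_hits 4 g _ hh) hg
    rwa [map_sub, sub_add_sub_cancel, ← AlgHom.comp_apply, ← subst_mul] at h1
  have hone : Q 1 := ⟨1, rfl, by rw [subst_one, AlgHom.id_apply, sub_self]; exact zero_mem _⟩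
  have hcyc : ∀ t : Fin 4, Q (Matrix.transvection (t + 1) t 1) := fun t =>
    ⟨cyclicTransvection t, rfl, subst_cyclicTransvection_f t⟩
  -- The commutator of two elementary matrices is elementary; as both are involutions, it is the
  -- square of their product.
  have hcomm : ∀ i j k : Fin 4, i ≠ j → j ≠ k → i ≠ k →
      Matrix.transvection i k (1 : ZMod 2) =
        (Matrix.transvection i j 1 * Matrix.transvection j k 1) *
          (Matrix.transvection i j 1 * Matrix.transvection j k 1) := by
    decide +kernel
  have hcyc2 : ∀ t : Fin 4, Q (Matrix.transvection (t + 2) t 1) := fun t => by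
    rw [hcomm (t + 2) (t + 1) t (by revert t; decide) (by revert t; decide) (by revert t; decide)]
    have h1 := hcyc (t + 1)
    rw [add_assoc, show (1 + 1 : Fin 4) = 2 from rfl] at h1
    exact hmul (hmul h1 (hcyc t)) (hmul h1 (hcyc t))
  have hcyc3 : ∀ t : Fin 4, Q (Matrix.transvection (t + 3) t 1) := fun t => by
    rw [hcomm (t + 3) (t + 1) t (by revert t; decide) (by revert t; decide) (by revert t; decide)]
    have h1 := hcyc2 (t + 1)
    rw [add_assoc, show (1 + 2 : Fin 4) = 3 from rfl] at h1
    exact hmul (hmul h1 (hcyc t)) (hmul h1 (hcyc t))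
  have htrans : ∀ i j : Fin 4, i ≠ j → Q (Matrix.transvection i j 1) := by
    intro i j hij
    have h : ∀ i j : Fin 4, i ≠ j → i = j + 1 ∨ i = j + 2 ∨ i = j + 3 := by decide
    rcases h i j hij with rfl | rfl | rfl
    · exact hcyc j
    · exact hcyc2 j
    · exact hcyc3 j
  have hall : Q g.val := by
    -- Over `F_2` an invertible diagonal matrix is the identity, and a transvection has coefficient
    -- 0 or 1.
    refine Matrix.diagonal_transvection_induction_of_det_ne_zero Q g.val
      (g.isUnit.map Matrix.detMonoidHom).ne_zero (fun D hD => ?_) (fun s => ?_)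
      fun A B _ _ => hmul
    · have h1 : D = 1 := by
        funext i
        rw [Matrix.det_diagonal] at hD
        have h2 := Finset.prod_ne_zero_iff.1 hD i (Finset.mem_univ i)
        have h3 : ∀ c : ZMod 2, c ≠ 0 → c = 1 := by decide
        exact h3 _ h2
      rw [h1]
      exact Matrix.diagonal_one (n := Fin 4) (α := ZMod 2) ▸ hone
    · obtain ⟨i, j, hij, c⟩ := s
      have h3 : ∀ c : ZMod 2, c = 0 ∨ c = 1 := by decide
      change Q (Matrix.transvection i j c)
      rcases h3 c with rfl | rfl
      · rw [Matrix.transvection_zero]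
        exact hone
      · exact htrans i j hij
  obtain ⟨h, hg, hf⟩ := hall
  rwa [Units.ext hg] at hf

/-! ### Elimination of the invariance conditions -/

theorem normalForm_basis15_check : ((List.range 75).all fun n =>
    Nat.beq (normalForm (nth basis15 [] n)) (Nat.pow 2 n)) = true := by
  decide +kernel

theorem exists_nth {α : Type} {B : List α} {a : α} (d : α) (ha : a ∈ B) :
    ∃ n < B.length, nth B d n = a := by
  induction B with
  | nil => simp at ha
  | cons b B ih =>
    rcases List.mem_cons.1 ha with rfl | ha
    · exact ⟨0, Nat.succ_pos _, rfl⟩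
    · obtain ⟨n, hn, h⟩ := ih ha
      exact ⟨n + 1, Nat.succ_lt_succ hn, h⟩

theorem span15_mem (S : Submodule (ZMod 2) (P 4)) (B : List (List ℕ))
    (hB : ∀ l ∈ B, mono 4 l ∈ S) (w : ℕ → ZMod 2) : span15 B w ∈ S := by
  induction B generalizing w with
  | nil => exact S.zero_mem
  | cons l B ih =>
    rw [span15, LinearMap.add_apply]
    exact S.add_mem (S.smul_mem _ (hB l List.mem_cons_self))
      (ih (fun l' hl' => hB l' (List.mem_cons_of_mem _ hl')) _)

/-- The coordinates of a polynomial of degree 33, followed by those of the differences with its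
images under the cyclic transvections. -/
def invarianceMap : P 4 →ₗ[ZMod 2] (ℕ → ZMod 2) :=
  coords33 + ∑ t : Fin 4, shiftLin (300 * (t + 1)) ∘ₗ coords33 ∘ₗ
    ((subst 4 (cyclicTransvection t)).toLinearMap + LinearMap.id)

theorem invarianceMap_apply (g : P 4) : invarianceMap g = coords33 g +
    ∑ t : Fin 4, shiftLin (300 * (t + 1)) (coords33 (subst 4 (cyclicTransvection t) g + g)) := by
  rw [invarianceMap, LinearMap.add_apply, LinearMap.sum_apply]
  rfl

theorem coordsComp_mulSq {i n : ℕ} (hi : i < 4) {l : List ℕ} (hl : l.length = 4)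
    (hs : l.sum = 15) (hn : normalForm l = Nat.pow 2 n) :
    coordsComp (mulSq (mono 4 (cofactor i)) (mono 4 l)) = bits (Nat.pow 2 (75 * i + n)) := by
  obtain ⟨h1, h2, h3, -⟩ := cofactor_spec i hi
  have h4 : ∀ k ∈ Finset.range 4,
      shiftLin (75 * k) (coords15 (comp k (mulSq (mono 4 (cofactor i)) (mono 4 l)))) =
      if k = i then bits (Nat.pow 2 (75 * i + n)) else 0 := by
    intro k hk
    have hk := Finset.mem_range.1 hk
    have h5 := comp_Sq_mulSq_of_ne h1 h2 hk 0 (mono 4 l)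
    rw [Sq_zero_apply, Nat.zero_div, Sq_zero_apply] at h5
    rw [h5]
    by_cases hki : k = i
    · subst hki
      rw [if_pos ⟨rfl, dvd_zero 2⟩, if_pos rfl, coords15_mono l hl, if_pos hs, hn, ← bits_shiftLeft]
      congr 1
      change (2 ^ n) <<< (75 * k) = 2 ^ (75 * k + n)
      rw [Nat.shiftLeft_eq, ← pow_add, add_comm]
    · rw [if_neg fun hc => hki (cofactor_inj i hi k hk hc.1).symm, if_neg hki, map_zero, map_zero]
  rw [coordsComp_apply, Finset.sum_congr rfl h4, Finset.sum_ite_eq',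
    if_pos (Finset.mem_range.2 hi)]

theorem bits_invarianceRow (i n : ℕ) : bits (invarianceRow i n) =
    reduceLin relations33 (bits (Nat.pow 2 (75 * i + n))) +
    ∑ t : Fin 4, shiftLin (300 * (t + 1)) (reduceLin relations33
      (bits (transvectionRow t i (nth basis15 [] n)) + bits (Nat.pow 2 (75 * i + n)))) := by
  unfold invarianceRow
  generalize relations33 = E
  generalize nth basis15 [] n = l
  have h0 : Nat.pow 2 (Nat.add (Nat.mul 75 i) n) = Nat.pow 2 (75 * i + n) := rfl
  rw [h0]
  generalize Nat.pow 2 (75 * i + n) = e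
  refine (bits_xor _ _).trans ?_
  rw [bits_reduce, bits_xorSum, List.map_map, sum_map_range, Finset.sum_range]
  congr 1
  refine Finset.sum_congr rfl fun t _ => ?_
  rw [Function.comp_apply, bits_shiftLeft, bits_reduce]
  congr 2
  exact bits_xor _ _

theorem invarianceMap_mulSq {i n : ℕ} (hi : i < 4) (hn : n < 75) :
    invarianceMap (mulSq (mono 4 (cofactor i)) (mono 4 (nth basis15 [] n))) =
      bits (invarianceRow i n) := by
  have hb : nth basis15 [] n ∈ basis15 := by
    have h : ∀ (B : List (List ℕ)) (n : ℕ), n < B.length → nth B [] n ∈ B := by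
      intro B
      induction B with
      | nil => intro n hn; simp at hn
      | cons l B ih =>
        intro n hn
        cases n with
        | zero => exact List.mem_cons_self
        | succ n => exact List.mem_cons_of_mem _ (ih n (Nat.lt_of_succ_lt_succ hn))
    exact h _ _ (hn.trans_eq length_basis15.symm)
  obtain ⟨hl, hs⟩ := basis15_spec _ hb
  have h1 := Nat.eq_of_beq_eq_true (List.all_eq_true.1 normalForm_basis15_check n
    (List.mem_range.2 hn))
  rw [bits_invarianceRow, invarianceMap_apply]
  generalize nth basis15 [] n = l at hl hs h1
  simp only [map_add, coords33_apply]
  rw [coordsComp_mulSq hi hl hs h1]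
  simp only [coordsComp_subst_mulSq _ hi hl hs]

theorem invarianceMap_eq_zero {g : P 4} (hg : g ∈ hits 4) : invarianceMap g = 0 := by
  rw [invarianceMap_apply, coords33_eq_zero_of_mem_hits hg, zero_add]
  refine Finset.sum_eq_zero fun t _ => ?_
  rw [coords33_eq_zero_of_mem_hits (add_mem (subst_mem_hits 4 _ g hg) hg), map_zero]

/-- `invarianceMap` vanishes on hits, so its values in degree 33 are combinations of its values at
the spanning elements `X_i b^2`, which are the eliminated rows. -/
theorem reduceLin_invarianceMap {g : P 4} (hg : g ∈ PDeg 4 33) :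
    reduceLin (gauss invarianceRows) (invarianceMap g) = 0 := by
  have h1 : invarianceMap g = invarianceMap (span33 (coordsComp g)) := by
    have h := invarianceMap_eq_zero (add_span33_coordsComp_mem hg)
    rw [map_add] at h
    exact CharTwo.add_eq_zero.1 h
  have hr : ∀ i < 4, ∀ n < 75, invarianceRow i n ∈ invarianceRows := by
    intro i hi n hn
    rw [invarianceRows]
    exact List.mem_flatMap.2 ⟨i, List.mem_range.2 hi, List.mem_map.2 ⟨n, List.mem_range.2 hn, rfl⟩⟩
  have hE : ∀ i < 4, ∀ n < 75, reduceLin (gauss invarianceRows) (bits (invarianceRow i n)) = 0 :=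
    fun i hi n hn => by
      rw [← bits_reduce, reduce_gauss _ _ (hr i hi n hn), bits_zero]
  rw [h1, span33, LinearMap.sum_apply, map_sum, map_sum]
  refine Finset.sum_eq_zero fun i hi => ?_
  have hi := Finset.mem_range.1 hi
  rw [LinearMap.comp_apply, LinearMap.comp_apply]
  generalize gauss invarianceRows = E at hE
  refine span15_mem (LinearMap.ker (reduceLin E ∘ₗ invarianceMap ∘ₗ mulSq (mono 4 (cofactor i))))
    basis15 (fun l hl => ?_) _
  obtain ⟨n, hn, rfl⟩ := exists_nth [] hl
  rw [length_basis15] at hn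
  rw [LinearMap.mem_ker, LinearMap.comp_apply, LinearMap.comp_apply, invarianceMap_mulSq hi hn,
    hE i hi n hn]

/-- The vectors that vanish from a given place on. -/
def vanishFrom (N : ℕ) : Submodule (ZMod 2) (ℕ → ZMod 2) where
  carrier := {u | ∀ n, N ≤ n → u n = 0}
  zero_mem' := fun _ _ => rfl
  add_mem' := fun hu hv n hn => by rw [Pi.add_apply, hu n hn, hv n hn, add_zero]
  smul_mem' := fun c u hu n hn => by rw [Pi.smul_apply, hu n hn, smul_zero]

/-- A vector without digits from `N` on never activates a row with pivot at least `N`. The other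
rows add multiples of `r`, which creates no such digits. -/
theorem reduceLin_of_mem_vanishFrom {N r : ℕ} (hr : bits r ∈ vanishFrom N) (E : List (ℕ × ℕ))
    (hE : ∀ s ∈ E, N ≤ s.1 ∨ s.2 = r) {u : ℕ → ZMod 2} (hu : u ∈ vanishFrom N) :
    ∃ c : ZMod 2, reduceLin E u = u + c • bits r := by
  induction E generalizing u with
  | nil => exact ⟨0, by rw [zero_smul, add_zero]; rfl⟩
  | cons s E ih =>
    rw [reduceLin, LinearMap.comp_apply, LinearMap.add_apply, LinearMap.id_apply,
      LinearMap.smulRight_apply, LinearMap.proj_apply]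
    have hE2 := fun t ht => hE t (List.mem_cons_of_mem _ ht)
    rcases hE s List.mem_cons_self with h | h
    · rw [hu _ h, zero_smul, add_zero]
      exact ih hE2 hu
    · rw [h]
      obtain ⟨c, hc⟩ := ih hE2 (add_mem hu ((vanishFrom N).smul_mem (u s.1) hr))
      exact ⟨u s.1 + c, by rw [hc, add_assoc, add_smul]⟩

theorem coords33_mem_vanishFrom (g : P 4) : coords33 g ∈ vanishFrom 300 := by
  have h0 : ∀ v ∈ koszulRows, bits v ∈ vanishFrom 300 := by
    intro v hv
    obtain ⟨l, ⟨hl, hs⟩, rfl⟩ := mem_koszulRows.1 hv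
    intro n hn
    rw [← (koszul_mono hl).trans (if_pos hs), koszul_apply, Finset.sum_apply]
    refine Finset.sum_eq_zero fun k hk => ?_
    have := Finset.mem_range.1 hk
    rw [shiftLin_apply, if_pos (by omega)]
    exact coords15_eq_zero_of_le _ (by omega)
  have h1 : ∀ s ∈ relations33, bits s.2 ∈ vanishFrom 300 := by
    rw [relations33]
    exact mem_of_mem_gauss _ _ h0
  have h2 := add_mem (reduceLin_sub_mem _ _ h1 (coordsComp g))
    (fun n hn => coordsComp_of_le hn : coordsComp g ∈ vanishFrom 300)
  rwa [sub_add_cancel, ← coords33_apply] at h2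

theorem bits_fRow_mem : bits fRow ∈ vanishFrom 300 := by
  rw [← coords33_f]
  exact coords33_mem_vanishFrom f

/-- For an invariant class the four blocks of differences vanish. Elimination then gives both 0 and
`coords33 g + c • bits fRow`, so `g` has the coordinates of 0 or of `f`. -/
theorem mem_hits_or_sub_f_mem_hits {g : P 4} (hg : g ∈ PDeg 4 33)
    (hinv : ∀ t, subst 4 (cyclicTransvection t) g + g ∈ hits 4) :
    g ∈ hits 4 ∨ g - f ∈ hits 4 := by
  have h1 : invarianceMap g = coords33 g := by
    rw [invarianceMap_apply, Finset.sum_eq_zero, add_zero]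
    intro t _
    rw [coords33_eq_zero_of_mem_hits (hinv t), map_zero]
  have h2 : ∀ s ∈ gauss invarianceRows, 300 ≤ s.1 ∨ s.2 = fRow := by
    intro s hs
    have h := List.all_eq_true.1 invarianceRows_check s hs
    rw [Bool.or_eq_true] at h
    exact h.imp Nat.le_of_ble_eq_true Nat.eq_of_beq_eq_true
  obtain ⟨c, hc⟩ := reduceLin_of_mem_vanishFrom bits_fRow_mem _ h2 (coords33_mem_vanishFrom g)
  rw [← h1, reduceLin_invarianceMap hg, h1, ← coords33_f] at hc
  have h3 : ∀ c : ZMod 2, c = 0 ∨ c = 1 := by decide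
  rcases h3 c with rfl | rfl
  · left
    rw [zero_smul, add_zero] at hc
    exact mem_hits_of_coords33 hg hc.symm
  · right
    rw [one_smul, ← LinearMap.map_add] at hc
    rw [CharTwo.sub_eq_add]
    exact mem_hits_of_coords33 (add_mem hg f_mem) hc.symm

/-! ### The invariant class and its dual -/

theorem mkQ_mem_InvQP (k d : ℕ) (v : PDeg k d) :
    (hitsDeg k d).mkQ v ∈ InvQP k d ↔ ∀ g, subst k g v - v ∈ hits k := by
  rw [Representation.mem_invariants]
  refine forall_congr' fun g => ?_
  exact Submodule.Quotient.eq (hitsDeg k d)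

theorem fClass_mem_InvQP : fClass ∈ InvQP 4 33 :=
  (mkQ_mem_InvQP 4 33 ⟨f, f_mem⟩).2 subst_f_sub_mem

theorem x_mem_prim : toH 4 33 x ∈ prim 4 33 := toH_mem_prim 4 33 x dualSq_x

/-- A primitive vanishes on hits, but `x` pairs to 1 with `f`. -/
theorem f_not_mem_hits : f ∉ hits 4 := fun h => by
  have h1 := prim_apply_eq_zero x_mem_prim ⟨f, f_mem⟩ h
  rw [pairing_x_f] at h1
  exact one_ne_zero h1

theorem eq_zero_or_eq_fClass {w : QP 4 33} (hw : w ∈ InvQP 4 33) : w = 0 ∨ w = fClass := by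
  obtain ⟨v, rfl⟩ := (hitsDeg 4 33).mkQ_surjective w
  have h := (mkQ_mem_InvQP 4 33 v).1 hw
  refine (mem_hits_or_sub_f_mem_hits v.2 fun t => ?_).imp (fun h1 => ?_) fun h1 => ?_
  · rw [← CharTwo.sub_eq_add]
    exact h _
  · exact (Submodule.Quotient.mk_eq_zero _).2 h1
  · exact (Submodule.Quotient.eq (hitsDeg 4 33)).2 h1

theorem exists_basis_InvQP : ∃ b : Module.Basis (Fin 1) (ZMod 2) (InvQP 4 33),
    b 0 = ⟨fClass, fClass_mem_InvQP⟩ := by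
  have h1 : LinearIndependent (ZMod 2) fun _ : Fin 1 =>
      (⟨fClass, fClass_mem_InvQP⟩ : InvQP 4 33) := by
    refine LinearIndependent.of_subsingleton 0 fun h => f_not_mem_hits ?_
    exact (Submodule.Quotient.mk_eq_zero (hitsDeg 4 33)).1 (congrArg Subtype.val h)
  refine ⟨Module.Basis.mk h1 ?_, Module.Basis.mk_apply h1 _ 0⟩
  rintro ⟨w, hw⟩ -
  rcases eq_zero_or_eq_fClass hw with rfl | rfl
  · exact zero_mem _
  · exact Submodule.subset_span ⟨0, rfl⟩

end SingerTransfer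

end

/-! ### The main theorem -/

theorem mainTheorem6 :
    -- the space of invariants has dimension one
    Module.finrank (ZMod 2) (SingerTransfer.InvQP 4 33) = 1 ∧
    -- `x` is annihilated by the dual Steenrod squares and is a preimage of the class of `p0Word`
    (∀ j : ℕ, 1 ≤ j → SingerTransfer.dualSq 4 j SingerTransfer.x = 0) ∧
    SingerTransfer.toLam (SingerTransfer.diff SingerTransfer.p0Word) = 0 ∧
    SingerTransfer.transfer 4 SingerTransfer.x =
      SingerTransfer.toLam SingerTransfer.p0Word ∧
    -- the pairing of `x` with `f` is non-zero
    SingerTransfer.toH 4 33 SingerTransfer.x ⟨SingerTransfer.f, SingerTransfer.f_mem⟩ = 1 ∧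
    -- `[f]` is a basis of the invariants
    ∃ (b : Module.Basis (Fin 1) (ZMod 2) (SingerTransfer.InvQP 4 33))
      (hx : SingerTransfer.toH 4 33 SingerTransfer.x ∈ SingerTransfer.prim 4 33),
      (b 0 : SingerTransfer.QP 4 33) = SingerTransfer.fClass ∧
      -- the pairing identifies the coinvariants with the dual of the invariants, `[x]` with `[f]^*`
      ∃ Φ : SingerTransfer.CoinvPrim 4 33 ≃ₗ[ZMod 2]
          Module.Dual (ZMod 2) (SingerTransfer.InvQP 4 33),
        (∀ (u : SingerTransfer.prim 4 33) (v : SingerTransfer.PDeg 4 33)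
          (hv : (SingerTransfer.hitsDeg 4 33).mkQ v ∈ SingerTransfer.InvQP 4 33),
          Φ (Representation.Coinvariants.mk (SingerTransfer.repPrim 4 33) u)
              ⟨(SingerTransfer.hitsDeg 4 33).mkQ v, hv⟩ =
            (u : SingerTransfer.H 4 33) v) ∧
        Φ (Representation.Coinvariants.mk (SingerTransfer.repPrim 4 33)
            ⟨SingerTransfer.toH 4 33 SingerTransfer.x, hx⟩) = b.coord 0 := by
  obtain ⟨b, hb⟩ := SingerTransfer.exists_basis_InvQP
  refine ⟨by simpa using Module.finrank_eq_card_basis b, SingerTransfer.dualSq_x,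
    SingerTransfer.toLam_diff_p0Word, SingerTransfer.transfer_x, SingerTransfer.pairing_x_f,
    b, SingerTransfer.x_mem_prim, by rw [hb], SingerTransfer.coinvEquiv 4 33,
    SingerTransfer.coinvEquiv_mk 4 33, b.ext fun i => ?_⟩
  -- Both functionals are compared on the single basis vector `[f]`, where each takes the value 1.
  rw [Subsingleton.elim i 0, Module.Basis.coord_apply, Module.Basis.repr_self,
    Finsupp.single_eq_same, hb]
  exact (SingerTransfer.coinvEquiv_mk 4 33 ⟨_, SingerTransfer.x_mem_prim⟩
    ⟨SingerTransfer.f, SingerTransfer.f_mem⟩ SingerTransfer.fClass_mem_InvQP).trans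
      SingerTransfer.pairing_x_f
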